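/- **Setting.** Let $\mathcal M=(\mathcal S,\mathcal A,r,c,P,\rho)$ be a constrained Markov decision process with finite $\mathcal S,\mathcal A$, $r:\mathcal S\times\mathcal A\to[0,1]$, $c:\mathcal S\times\mathcal A\to[-1,1]$; let $\pi_\theta$, $\theta\in\mathbb R^d$, be policies, $\Theta\subseteq\mathbb R^d$, and let $\phi_g:\mathcal S\to\mathbb R^m$, $\|\phi_g\|\le 1$, $g\in\{r,c\}$, be feature maps. For a policy $\pi$ let $P^\pi(s,s')=\sum_a\pi(a|s)P(s'|s,a)$, let $d^\pi$ be its stationary distribution, $J_g^\pi=\lim_n\frac1n\mathbb E_\pi[\sum_{t<n}g(s_t,a_t)\mid s_0\sim\rho]$, $Q_g^\pi(s,a)=\sum_{t\ge0}(\mathbb E_\pi[g(s_t,a_t)\mid s_0=s,a_0=a]-J_g^\pi)$, $V_g^\pi(s)=\sum_a\pi(a|s)Q_g^\pi(s,a)$, $J_g(\theta)=J_g^{\pi_\theta}$. Let $\tau_{\rm mix}=\sup_{\theta\in\Theta}\min\{t\ge1:\|(P^{\pi_\theta})^t(s,\cdot)-d^{\pi_\theta}\|_1\le\frac14\ \forall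 s\}$. Write $\mathbb E_\theta$ for the expectation over $z=(s,a,s')$ with $s\sim d^{\pi_\theta}$, $a\sim\pi_\theta(\cdot|s)$, $s'\sim P(\cdot|s,a)$, and $u_\theta(z)=\nabla_\theta\log\pi_\theta(a|s)$. Put $F(\theta)=\mathbb E_\theta[u_\theta u_\theta^\top]$ and $\omega^*_{g,\theta}=F(\theta)^{-1}\nabla J_g(\theta)$. For $c_\gamma>0$ let $$\mathbf A_g(z)=\begin{pmatrix}c_\gamma&0\\ \phi_g(s)&\phi_g(s)(\phi_g(s)-\phi_g(s'))^\top\end{pmatrix},\qquad \mathbf b_g(z)=\begin{pmatrix}c_\gamma g(s,a)\\ g(s,a)\phi_g(s)\end{pmatrix},$$ $\xi_g^*(\theta)=\mathbb E_\theta[\mathbf A_g(z)]^{-1}\mathbb E_\theta[\mathbf b_g(z)]=[\eta_g^*(\theta),\zeta_g^*(\theta)]$, and $\epsilon_{\rm app}=\max_{g}\sup_{\theta\in\Theta}\mathbb E_{s\sim d^{\pi_\theta}}[(\zeta_g^*(\theta)^\top\phi_g(s)-V_g^{\pi_\theta}(s))^2]$. **Algorithm.** For samples $f(z^0),f(z^1),\dots$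 and a level $q\ge1$ put $f^j=2^{-j}\sum_{t<2^j}f(z^t)$ and $\mathrm{MLMC}(f)=f^0+2^q(f^q-f^{q-1})\mathbf 1(2^q\le T_{\max})$. Start from an arbitrary $\theta_0$, $\lambda_0=0$ and $s_0\sim\rho$. Each epoch $k=0,\dots,K-1$ first performs $H$ critic steps and then $H$ actor steps under $\pi_{\theta_k}$. Each of these steps draws $q$ with $\Pr(q=j)=2^{-j}$, $j\ge1$, continues the Markov chain from its current state for $2^q$ transitions if $2^q\le T_{\max}$ and for one transition otherwise, and uses these transitions for both $g\in\{r,c\}$. Critic steps are $\xi\leftarrow\xi-\gamma_\xi\,\mathrm{MLMC}(\mathbf A_g(\cdot)\xi-\mathbf b_g(\cdot))$ from $\xi=0$, with final value $\xi_g^k=[\eta_g^k,\zeta_g^k]$; actor steps are $\omega\leftarrow\omega-\gamma_\omega\,\mathrm{MLMC}\big(u_{\theta_k}u_{\theta_k}^\top\omega-[g(s,a)-\eta_g^k+\langle\zeta_g^k,\phi_g(s')-\phi_g(s)\rangle]u_{\theta_k}\big)$ from $\omega=0$, with final value $\omega_g^k$. Then $\theta_{k+1}=\theta_k+\alpha(\omega_r^k+\lambda_k\omega_c^k)$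 and $\lambda_{k+1}$ is the projection of $\lambda_k-\beta\eta_c^k$ onto $[0,2/\delta]$, where $\delta>0$. Let $\mathbb E_k$ be the conditional expectation given everything drawn before epoch $k$. **Assumptions.** (i) Under every policy the chain of states is irreducible and aperiodic. (ii) $\epsilon_{\rm app}<\infty$. (iii) $v^\top\mathbb E_\theta[\phi_g(s)(\phi_g(s)-\phi_g(s'))^\top]v\ge\lambda\|v\|^2$ for all $v\in\mathbb R^m$, $\theta\in\Theta$, $g\in\{r,c\}$, where $\lambda>0$. (iv) For all $(s,a)$, $\pi_\theta(a|s)$ is positive and differentiable in $\theta$ at every point of $\Theta$, and on $\Theta$ the score $\nabla_\theta\log\pi_\theta(a|s)$ is bounded in norm by $G_1>0$ and $G_2$-Lipschitz. (v) $F(\theta)-\mu I$ is positive semidefinite for all $\theta\in\Theta$, where $\mu>0$. (vi) $J_r$ and $J_c$ are differentiable on $\Theta$ with $L$-Lipschitz gradient. **Theorem.** There are a universal $\kappa\in\mathbb N$ and, for all $G_1,\mu,\lambda>0$, a constant $C=C(G_1,\mu,\lambda)>0$ such that the following holds in the above setting. Let $T\ge1$, $H\ge1$, $T_{\max}\ge2$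 be integers with $$\gamma_\omega=\frac{2\log T}{\mu H}\le\frac{\mu}{4(6G_1^4\tau_{\rm mix}\log T_{\max}+2G_1^2\tau_{\rm mix}^2\log T_{\max})},\qquad T_{\max}\ge\frac{8G_1^4\tau_{\rm mix}}{\mu}.$$ Then for $g\in\{r,c\}$, every $k\in\{0,\dots,K-1\}$ and every history before epoch $k$ of positive probability with $\theta_k\in\Theta$, the variables $\omega_g^k$ and $\xi_g^k$ are conditionally square integrable and, with $\omega^*_{g,k}=\omega^*_{g,\theta_k}$ and $\Lambda=C\,[(1+\log T)(1+\log T_{\max})]^{\kappa}$, $$\big\|\mathbb E_k[\omega_g^k]-\omega_{g,k}^*\big\|^2\le\Lambda\Big(\epsilon_{\rm app}+\frac{\tau_{\rm mix}^2}{T^2}+\frac{\tau_{\rm mix}^2}{T_{\max}}\big\{\mathbb E_k\|\xi_g^k-\xi_g^*(\theta_k)\|^2+\tau_{\rm mix}^2\big\}+\big\|\mathbb E_k[\xi_g^k]-\xi_g^*(\theta_k)\big\|^2\Big),$$ $$\mathbb E_k\|\omega_g^k-\omega_{g,k}^*\|^2\le\Lambda\Big(\epsilon_{\rm app}+\Big(\frac1{T^2}+\frac{\tau_{\rm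 mix}}{H}+\frac{\tau_{\rm mix}}{T_{\max}}\Big)\tau_{\rm mix}^2+\mathbb E_k\|\xi_g^k-\xi_g^*(\theta_k)\|^2\Big).$$ -/

import Mathlib

open MeasureTheory ProbabilityTheory Filter Topology
open scoped ENNReal Matrix

noncomputable section

namespace PDNAC

/-- The index `g ∈ {r, c}`: reward or constraint cost. -/
inductive Signal
  | r
  | c

/-- A constrained Markov decision process `(S, A, r, c, P, ρ)`. -/
structure CMDP (S A : Type*) where
  reward : S → A → ℝ
  cost : S → A → ℝ
  P : S → A → PMF S
  ρ : PMF S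
  reward_mem : ∀ s a, reward s a ∈ Set.Icc (0 : ℝ) 1
  cost_mem : ∀ s a, cost s a ∈ Set.Icc (-1 : ℝ) 1

/-- The policy parameter space `ℝ^d`. -/
abbrev Param (d : ℕ) := EuclideanSpace ℝ (Fin d)

/-- Critic parameters `ξ = [η, ζ] ∈ ℝ^{1+m}`; `η` is the `Sum.inl` coordinate. -/
abbrev CriticVec (m : ℕ) := EuclideanSpace ℝ (Unit ⊕ Fin m)

/-- A parametrized policy `θ ↦ π_θ` and, for each `g`, a feature map `φ_g` with `‖φ_g(s)‖ ≤ 1`. -/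
structure Approximator (S A : Type*) (d m : ℕ) where
  π : Param d → S → PMF A
  φ : Signal → S → EuclideanSpace ℝ (Fin m)
  φ_norm_le : ∀ g s, ‖φ g s‖ ≤ 1

/-- Inputs of the algorithm other than the CMDP and the approximator: initial policy parameter,
step sizes `α, β, γ_ξ, γ_ω`, the constant `c_γ`, the number `δ` in the dual projection onto
`[0, 2/δ]`, the inner loop length `H` and the truncation level `T_max`. -/
structure AlgParams (d : ℕ) where
  θ₀ : Param d
  α : ℝ
  β : ℝ
  γξ : ℝ
  γω : ℝ
  cγ : ℝ
  δ : ℝ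
  H : ℕ
  Tmax : ℕ

section MDP

variable {S A : Type*} [Fintype S] [DecidableEq S] [Fintype A]

def CMDP.signal (M : CMDP S A) : Signal → S → A → ℝ
  | .r => M.reward
  | .c => M.cost

/-- `P^π(s, s') = ∑_a π(a|s) P(s'|s, a)`. -/
def CMDP.transMat (M : CMDP S A) (π : S → PMF A) : Matrix S S ℝ :=
  Matrix.of fun s s' => ∑ a, (π s a).toReal * (M.P s a s').toReal

/-- Every return time to `s` is divisible by `n` only if `n = 1`, for each state `s`. -/
def Aperiodic (B : Matrix S S ℝ) : Prop :=
  ∀ s, ∀ n : ℕ, (∀ t : ℕ, 0 < t → 0 < (B ^ t) s s → n ∣ t) → n = 1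

/-- The chain induced by every policy is irreducible and aperiodic. -/
def CMDP.Ergodic (M : CMDP S A) : Prop :=
  ∀ π : S → PMF A, (M.transMat π).IsIrreducible ∧ Aperiodic (M.transMat π)

def IsStationary (B : Matrix S S ℝ) (p : S → ℝ) : Prop :=
  (∀ s, 0 ≤ p s) ∧ ∑ s, p s = 1 ∧ p ᵥ* B = p

/-- The stationary distribution `d^π` (it exists and is unique for an ergodic CMDP). -/
def CMDP.stat (M : CMDP S A) (π : S → PMF A) : S → ℝ :=
  Classical.epsilon (IsStationary (M.transMat π))

/-- `E[g(s_t, a_t) | s_0 = s]` under `π`. -/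
def CMDP.expSignal (M : CMDP S A) (g : Signal) (π : S → PMF A) (t : ℕ) (s : S) : ℝ :=
  ((M.transMat π ^ t) *ᵥ fun s' => ∑ a, (π s' a).toReal * M.signal g s' a) s

/-- The average value `J_g^π = lim_n (1/n) E[∑_{t<n} g(s_t, a_t) | s_0 ∼ ρ]`. -/
def CMDP.J (M : CMDP S A) (g : Signal) (π : S → PMF A) : ℝ :=
  limUnder atTop fun n : ℕ =>
    (1 / (n : ℝ)) * ∑ t ∈ Finset.range n, ∑ s, (M.ρ s).toReal * M.expSignal g π t s

/-- `E[g(s_t, a_t) | s_0 = s, a_0 = a]` under `π`. -/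
def CMDP.expSignalSA (M : CMDP S A) (g : Signal) (π : S → PMF A) (s : S) (a : A) : ℕ → ℝ
  | 0 => M.signal g s a
  | t + 1 => ∑ s', (M.P s a s').toReal * M.expSignal g π t s'

def CMDP.Q (M : CMDP S A) (g : Signal) (π : S → PMF A) (s : S) (a : A) : ℝ :=
  ∑' t : ℕ, (M.expSignalSA g π s a t - M.J g π)

def CMDP.V (M : CMDP S A) (g : Signal) (π : S → PMF A) (s : S) : ℝ :=
  ∑ a, (π s a).toReal * M.Q g π s a

/-- Expectation of `f(s, a, s')` for `s ∼ d^π`, `a ∼ π(·|s)`, `s' ∼ P(·|s, a)`. -/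
def CMDP.statExp (M : CMDP S A) (π : S → PMF A) {E : Type*} [AddCommMonoid E] [Module ℝ E]
    (f : S × A × S → E) : E :=
  ∑ s, ∑ a, ∑ s', (M.stat π s * (π s a).toReal * (M.P s a s').toReal) • f (s, a, s')

/-- `min {t ≥ 1 | ‖(P^π)^t(s, ·) - d^π‖₁ ≤ 1/4 for all s}`. -/
def CMDP.mixTimeOf (M : CMDP S A) (π : S → PMF A) : ℕ :=
  sInf {t : ℕ | 1 ≤ t ∧ ∀ s, ∑ s', |(M.transMat π ^ t) s s' - M.stat π s'| ≤ 1 / 4}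

end MDP

section Approx

variable {S A : Type*} [Fintype S] [DecidableEq S] [Fintype A] {d m : ℕ}

/-- The overall mixing time `τ_mix = sup_{θ ∈ Θ} τ_mix^θ`. -/
def mixTime (M : CMDP S A) (X : Approximator S A d m) (Θ : Set (Param d)) : ℕ :=
  sSup ((fun θ => M.mixTimeOf (X.π θ)) '' Θ)

/-- The score `∇_θ log π_θ(a|s)`. -/
def score (X : Approximator S A d m) (θ : Param d) (s : S) (a : A) : Param d :=
  gradient (fun θ' => Real.log (X.π θ' s a).toReal) θ

/-- `J_g(θ) = J_g^{π_θ}`. -/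
def objective (M : CMDP S A) (X : Approximator S A d m) (g : Signal) (θ : Param d) : ℝ :=
  M.J g (X.π θ)

/-- Single-sample Fisher matrix `∇ log π_θ(a|s) ⊗ ∇ log π_θ(a|s)`. -/
def fisherSample (X : Approximator S A d m) (θ : Param d) (z : S × A × S) :
    Matrix (Fin d) (Fin d) ℝ :=
  Matrix.vecMulVec (score X θ z.1 z.2.1).ofLp (score X θ z.1 z.2.1).ofLp

/-- The Fisher information matrix `F(θ)`. -/
def fisher (M : CMDP S A) (X : Approximator S A d m) (θ : Param d) :
    Matrix (Fin d) (Fin d) ℝ :=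
  M.statExp (X.π θ) (fisherSample X θ)

/-- The natural policy gradient `F(θ)⁻¹ ∇J_g(θ)`. -/
def npgDir (M : CMDP S A) (X : Approximator S A d m) (g : Signal) (θ : Param d) : Param d :=
  Matrix.toEuclideanLin (fisher M X θ)⁻¹ (gradient (objective M X g) θ)

/-- The rank one matrix `φ_g(s) (φ_g(s) - φ_g(s'))ᵀ`. -/
def tdSample (X : Approximator S A d m) (g : Signal) (z : S × A × S) :
    Matrix (Fin m) (Fin m) ℝ :=
  Matrix.vecMulVec (X.φ g z.1).ofLp (X.φ g z.1 - X.φ g z.2.2).ofLp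

/-- `A_g(θ; z)`. -/
def criticMatSample (X : Approximator S A d m) (cγ : ℝ) (g : Signal) (z : S × A × S) :
    Matrix (Unit ⊕ Fin m) (Unit ⊕ Fin m) ℝ :=
  Matrix.fromBlocks (Matrix.of fun _ _ => cγ) 0 (Matrix.of fun i _ => X.φ g z.1 i)
    (tdSample X g z)

/-- `b_g(θ; z)`. -/
def criticVecSample (M : CMDP S A) (X : Approximator S A d m) (cγ : ℝ) (g : Signal)
    (z : S × A × S) : CriticVec m :=
  WithLp.toLp 2 (Sum.elim (fun _ => cγ * M.signal g z.1 z.2.1)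
    (fun i => M.signal g z.1 z.2.1 * X.φ g z.1 i))

/-- `ξ_g^*(θ) = A_g(θ)⁻¹ b_g(θ)`. -/
def criticOpt (M : CMDP S A) (X : Approximator S A d m) (cγ : ℝ) (g : Signal) (θ : Param d) :
    CriticVec m :=
  Matrix.toEuclideanLin (M.statExp (X.π θ) (criticMatSample X cγ g))⁻¹
    (M.statExp (X.π θ) (criticVecSample M X cγ g))

/-- The `ζ`-part of `ξ = [η, ζ]`. -/
def zetaPart (ξ : CriticVec m) : EuclideanSpace ℝ (Fin m) :=
  WithLp.toLp 2 fun i => ξ (Sum.inr i)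

/-- `E_{s ∼ d^{π_θ}} [(ζ_g^*(θ)ᵀ φ_g(s) - V_g^{π_θ}(s))²]`. -/
def criticErrorAt (M : CMDP S A) (X : Approximator S A d m) (cγ : ℝ) (g : Signal)
    (θ : Param d) : ℝ :=
  ∑ s, M.stat (X.π θ) s *
    (inner ℝ (zetaPart (criticOpt M X cγ g θ)) (X.φ g s) - M.V g (X.π θ) s) ^ 2

/-- The worst-case critic approximation error `ε_app = max_g sup_{θ ∈ Θ}`. -/
def epsApp (M : CMDP S A) (X : Approximator S A d m) (cγ : ℝ) (Θ : Set (Param d)) : ℝ :=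
  max (sSup (criticErrorAt M X cγ Signal.r '' Θ)) (sSup (criticErrorAt M X cγ Signal.c '' Θ))

/-- `E_θ[φ_g(s)(φ_g(s) - φ_g(s'))ᵀ] - λ I` has a nonnegative quadratic form; the matrix need not
be symmetric. -/
def CriticPositive (M : CMDP S A) (X : Approximator S A d m) (Θ : Set (Param d)) (lam : ℝ) :
    Prop :=
  ∀ θ ∈ Θ, ∀ g, ∀ v : EuclideanSpace ℝ (Fin m),
    lam * ‖v‖ ^ 2 ≤ v.ofLp ⬝ᵥ (M.statExp (X.π θ) (tdSample X g) *ᵥ v.ofLp)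

/-- The score exists on `Θ`, is bounded by `G₁` and is `G₂`-Lipschitz. -/
structure ScoreBounds (X : Approximator S A d m) (Θ : Set (Param d)) (G₁ G₂ : ℝ) : Prop where
  pos : ∀ θ ∈ Θ, ∀ s a, 0 < (X.π θ s a).toReal
  diff : ∀ θ ∈ Θ, ∀ s a, DifferentiableAt ℝ (fun θ' => (X.π θ' s a).toReal) θ
  bound : ∀ θ ∈ Θ, ∀ s a, ‖score X θ s a‖ ≤ G₁
  lipschitz : ∀ θ₁ ∈ Θ, ∀ θ₂ ∈ Θ, ∀ s a,
    ‖score X θ₁ s a - score X θ₂ s a‖ ≤ G₂ * ‖θ₁ - θ₂‖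

/-- `F(θ) - μ I` is positive semidefinite on `Θ`. -/
def FisherNondegenerate (M : CMDP S A) (X : Approximator S A d m) (Θ : Set (Param d))
    (μ : ℝ) : Prop :=
  ∀ θ ∈ Θ, (fisher M X θ - μ • (1 : Matrix (Fin d) (Fin d) ℝ)).PosSemidef

/-- `f` is differentiable on `Θ` with `L`-Lipschitz gradient. -/
def SmoothOn (f : Param d → ℝ) (Θ : Set (Param d)) (L : ℝ) : Prop :=
  (∀ θ ∈ Θ, DifferentiableAt ℝ f θ) ∧
    ∀ θ₁ ∈ Θ, ∀ θ₂ ∈ Θ, ‖gradient f θ₁ - gradient f θ₂‖ ≤ L * ‖θ₁ - θ₂‖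

end Approx

section Algorithm

/-- One inner-loop sample: the level drawn from `Geom(1/2)` and the transitions
`z^t = (s^t, a^t, s^{t+1})` observed. -/
abbrev Batch (S A : Type*) := ℕ × List (S × A × S)

/-- The samples of one epoch: those of the critic loop, then those of the actor loop. -/
abbrev Epoch (S A : Type*) := List (Batch S A) × List (Batch S A)

/-- Everything drawn so far: the initial state and the samples of the epochs already run. -/
structure History (S A : Type*) where
  init : S
  epochs : List (Epoch S A)

instance (S A : Type*) : MeasurableSpace (History S A) := ⊤

/-- `Geom(1/2)` on `{1, 2, …}`: level `j` has probability `2^{-j}`. -/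
def levelLaw : PMF ℕ :=
  ⟨fun j => if j = 0 then 0 else (2 : ℝ≥0∞)⁻¹ ^ j, by
    have h : ∑' j : ℕ, (if j = 0 then 0 else (2 : ℝ≥0∞)⁻¹ ^ j) = 1 := by
      rw [tsum_eq_zero_add' ENNReal.summable]
      simp only [if_true, Nat.succ_ne_zero, if_false, zero_add]
      rw [ENNReal.tsum_geometric_add_one, ENNReal.one_sub_inv_two, inv_inv]
      exact ENNReal.inv_mul_cancel two_ne_zero ENNReal.ofNat_ne_top
    exact h ▸ ENNReal.summable.hasSum⟩

/-- `(2^q - 1) 1(2^q ≤ T_max) + 1`. -/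
def trajLength (Tmax q : ℕ) : ℕ := if 2 ^ q ≤ Tmax then 2 ^ q else 1

/-- `2^{-j} ∑_{t < 2^j} f(z^t)`. -/
def levelAvg {Z E : Type*} [AddCommGroup E] [Module ℝ E] (f : Z → E) (l : List Z) (j : ℕ) : E :=
  ((2 : ℝ) ^ j)⁻¹ • ((l.take (2 ^ j)).map f).sum

/-- The multi-level Monte Carlo combination of the samples `f(z^t)`. -/
def mlmc {Z E : Type*} [AddCommGroup E] [Module ℝ E] (Tmax : ℕ) (f : Z → E)
    (b : ℕ × List Z) : E :=
  levelAvg f b.2 0 +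
    if 2 ^ b.1 ≤ Tmax then (2 : ℝ) ^ b.1 • (levelAvg f b.2 b.1 - levelAvg f b.2 (b.1 - 1)) else 0

/-- The state at the end of a trajectory started in `s`. -/
def endState {S A : Type*} (s : S) (b : Batch S A) : S :=
  (b.2.getLast?.map fun z => z.2.2).getD s

def History.upTo {S A : Type*} (x : History S A) (k : ℕ) : History S A :=
  ⟨x.init, x.epochs.take k⟩

def History.epoch {S A : Type*} (x : History S A) (k : ℕ) : Epoch S A :=
  x.epochs.getD k ([], [])

variable {S A : Type*} {d m : ℕ}

/-- Law of the first `n` transitions under `π` from `s`. -/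
def trajLaw (M : CMDP S A) (π : S → PMF A) : ℕ → S → PMF (List (S × A × S))
  | 0, _ => PMF.pure []
  | n + 1, s => (π s).bind fun a => (M.P s a).bind fun s' =>
      (trajLaw M π n s').map fun l => (s, a, s') :: l

def batchLaw (M : CMDP S A) (π : S → PMF A) (Tmax : ℕ) (s : S) : PMF (Batch S A) :=
  levelLaw.bind fun q => (trajLaw M π (trajLength Tmax q) s).map fun l => (q, l)

/-- Law of `n` consecutive batches, each started where the previous one ended. -/
def loopLaw (M : CMDP S A) (π : S → PMF A) (Tmax : ℕ) : ℕ → S → PMF (List (Batch S A))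
  | 0, _ => PMF.pure []
  | n + 1, s => (batchLaw M π Tmax s).bind fun b =>
      (loopLaw M π Tmax n (endState s b)).map fun l => b :: l

/-- Law of the samples of one epoch: `H` critic steps, then `H` actor steps. -/
def epochLaw (M : CMDP S A) (π : S → PMF A) (H Tmax : ℕ) (s : S) : PMF (Epoch S A) :=
  (loopLaw M π Tmax H s).bind fun cs =>
    (loopLaw M π Tmax H (cs.foldl endState s)).map fun as => (cs, as)

/-- Critic output: `ξ_{h+1} = ξ_h - γ_ξ v_g(θ, ξ_h)` from `ξ_0 = 0`, where `v_g` is the MLMC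
combination of `A_g(θ; z) ξ_h - b_g(θ; z)`. -/
def criticOut (M : CMDP S A) (X : Approximator S A d m) (p : AlgParams d) (g : Signal)
    (cs : List (Batch S A)) : CriticVec m :=
  cs.foldl (fun ξ b => ξ - p.γξ • mlmc p.Tmax (fun z =>
    Matrix.toEuclideanLin (criticMatSample X p.cγ g z) ξ - criticVecSample M X p.cγ g z) b) 0

/-- `[g(s, a) - η + ⟨ζ, φ_g(s') - φ_g(s)⟩] ∇ log π_θ(a|s)`. -/
def gradSample (M : CMDP S A) (X : Approximator S A d m) (g : Signal) (θ : Param d)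
    (ξ : CriticVec m) (z : S × A × S) : Param d :=
  (M.signal g z.1 z.2.1 - ξ (Sum.inl ()) +
    inner ℝ (zetaPart ξ) (X.φ g z.2.2 - X.φ g z.1)) • score X θ z.1 z.2.1

/-- Actor output: `ω_{h+1} = ω_h - γ_ω ∇̂f_g(θ, ω_h, ξ)` from `ω_0 = 0`, where `∇̂f_g` is the MLMC
combination of `F̂(θ; z) ω_h - ∇̂J_g(θ, ξ; z)`. -/
def actorOut (M : CMDP S A) (X : Approximator S A d m) (p : AlgParams d) (g : Signal)
    (θ : Param d) (ξ : CriticVec m) (as : List (Batch S A)) : Param d :=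
  as.foldl (fun ω b => ω - p.γω • mlmc p.Tmax (fun z =>
    Matrix.toEuclideanLin (fisherSample X θ z) ω - gradSample M X g θ ξ z) b) 0

/-- The primal-dual iterates `(θ, λ)` and the current state of the environment. -/
structure AlgState (S : Type*) (d : ℕ) where
  θ : Param d
  lam : ℝ
  s : S

/-- The end of an epoch: `θ ← θ + α(ω_r + λ ω_c)` and `λ ← Proj_{[0, 2/δ]}(λ - β η_c)`. -/
def epochUpdate (M : CMDP S A) (X : Approximator S A d m) (p : AlgParams d)
    (y : AlgState S d) (e : Epoch S A) : AlgState S d where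
  θ := y.θ + p.α • (actorOut M X p .r y.θ (criticOut M X p .r e.1) e.2 +
    y.lam • actorOut M X p .c y.θ (criticOut M X p .c e.1) e.2)
  lam := max 0 (min (2 / p.δ) (y.lam - p.β * criticOut M X p .c e.1 (Sum.inl ())))
  s := e.2.foldl endState (e.1.foldl endState y.s)

/-- The state of the algorithm after the epochs recorded in a history. -/
def History.state (M : CMDP S A) (X : Approximator S A d m) (p : AlgParams d)
    (x : History S A) : AlgState S d :=
  x.epochs.foldl (epochUpdate M X p) ⟨p.θ₀, 0, x.init⟩

/-- Law of a run of the algorithm with `K` epochs. -/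
def runLaw (M : CMDP S A) (X : Approximator S A d m) (p : AlgParams d) :
    ℕ → PMF (History S A)
  | 0 => M.ρ.map fun s => ⟨s, []⟩
  | K + 1 => (runLaw M X p K).bind fun x =>
      (epochLaw M (X.π (x.state M X p).θ) p.H p.Tmax (x.state M X p).s).map fun e =>
        ⟨x.init, x.epochs ++ [e]⟩

/-- `θ_k`. -/
def thetaAt (M : CMDP S A) (X : Approximator S A d m) (p : AlgParams d) (k : ℕ)
    (x : History S A) : Param d :=
  ((x.upTo k).state M X p).θ

/-- The critic estimate `ξ_g^k`. -/
def xiAt (M : CMDP S A) (X : Approximator S A d m) (p : AlgParams d) (g : Signal) (k : ℕ)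
    (x : History S A) : CriticVec m :=
  criticOut M X p g (x.epoch k).1

/-- The NPG estimate `ω_g^k`. -/
def omegaAt (M : CMDP S A) (X : Approximator S A d m) (p : AlgParams d) (g : Signal) (k : ℕ)
    (x : History S A) : Param d :=
  actorOut M X p g (thetaAt M X p k x) (xiAt M X p g k x) (x.epoch k).2

/-- The conditional law of a run of `K` epochs given that its history before epoch `k` is `h`;
integrals against it are the values of `E_k` on that event. -/
def condLaw (M : CMDP S A) (X : Approximator S A d m) (p : AlgParams d) (K k : ℕ)
    (h : History S A) : Measure (History S A) :=
  cond (runLaw M X p K).toMeasure {x | x.upTo k = h}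

end Algorithm

end PDNAC

end

/-! Fix an epoch and let x = ω − ω^* be the actor error. One actor step is affine in x: it replaces
x by x − γ(MLMC(F̂x) + MLMC(drift)), where drift(z) = F̂(z)ω^* − ∇̂J(ξ; z) involves only the critic
output ξ. Since Fω^* = ∇J, and since functions of the current state alone integrate to zero against
the score, the stationary mean of the drift is E[(V(s') − ζᵀφ(s'))u]. This is affine in ξ and has
norm at most G₁(√ε_app + ‖ξ − ξ^*‖): see `Regular.meanDrift_eq` and `Regular.norm_meanDrift_le`.
Behind it stand the Poisson equation, the performance difference identity and the policy gradient
formula, all resting on the bound 8τ/3 for the summed distances to stationarity.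

Let J = ⌊log₂ T_max⌋. Telescoping over the levels makes the mean of an MLMC estimate equal to the
average over 2^J consecutive samples (`ex_mlmc`). Its bias is therefore of order τ/2^J, while its
variance is only of order Jτ (`CMDP.Ergodic.ex_norm_mlmc_sub_sq_le`).

The second moment is treated by a dichotomy. If 8G₁²τ ≤ μ2^J, the mean of MLMC(F̂x) is close enough
to Fx for each step to contract the second moment by 1 − γμ, and γμH = 2 log T turns the initial
error into a multiple of T⁻². In the opposite case no contraction is available, but then τ/T_max ≥
μ/(16G₁²), so the right-hand sides already contain a fixed multiple of τ² + E‖ξ − ξ^*‖², and it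
suffices that the iterates do not blow up. They do not, because ‖F̂x‖² ≤ G₁²⟨x, F̂x⟩ holds sample by
sample: the noise of the linear part is absorbed by the descent term, whatever the mixing.

For the bias, Jensen's inequality alone would leave E‖ξ − ξ^*‖². Instead, for long trajectories, the
conditional mean of x is compared with the noiseless recursion y ↦ y − γ(Fy + v), where v is the
mean drift at ξ; the difference is of order τ/2^J. The noiseless iterate is affine in v, and v is
affine in ξ, so averaging over the critic loop produces the same recursion at E[ξ]. This is where
‖E[ξ] − ξ^*‖² comes from.

Only the levels make the sample space infinite, and all levels above J act alike. Identifying them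
makes every law finitely supported, so that all estimates concern finite sums `ex`;
`integral_condLaw` carries them back to the conditional expectations of the run. -/

noncomputable section

set_option linter.unusedSectionVars false

namespace PDNAC

/-! ### Finite Markov chains: primitivity, merging of rows, stationary distributions -/

section Chain

variable {S : Type*} [Fintype S] [DecidableEq S]

/-- Aperiodicity and irreducibility make some power of the matrix entrywise positive. -/
theorem exists_pow_pos {B : Matrix S S ℝ} (hB : B.IsIrreducible) (ha : Aperiodic B) :
    ∃ n, ∀ s s', 0 < (B ^ n) s s' := by
  have hnn := hB.nonneg
  have hpnn : ∀ t s s', 0 ≤ (B ^ t) s s' := fun t => Matrix.pow_apply_nonneg hnn t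
  have hmul : ∀ a b s s' s'', 0 < (B ^ a) s s' → 0 < (B ^ b) s' s'' →
      0 < (B ^ (a + b)) s s'' := by
    intro a b s s' s'' h1 h2
    rw [pow_add, Matrix.mul_apply]
    exact Finset.sum_pos' (fun i _ => mul_nonneg (hpnn _ _ _) (hpnn _ _ _))
      ⟨s', Finset.mem_univ _, mul_pos h1 h2⟩
  have hret : ∀ s, ∃ n, ∀ t ≥ n, 0 < (B ^ t) s s := by
    intro s
    -- The return times to s form an additive submonoid of ℕ. Aperiodicity makes its gcd equal to 1,
    -- so it contains every large integer.
    let R : AddSubmonoid ℕ :=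
      { carrier := {t | 0 < (B ^ t) s s}
        zero_mem' := by simp
        add_mem' := fun {a b} h1 h2 => hmul a b s s s h1 h2 }
    have hg : Nat.setGcd (R : Set ℕ) = 1 :=
      ha s _ fun t _ ht => Nat.setGcd_dvd_of_mem ht
    obtain ⟨n, hn⟩ := Nat.exists_mem_closure_of_ge (R : Set ℕ)
    refine ⟨n, fun t ht => ?_⟩
    have := hn t ht (by rw [hg]; exact one_dvd _)
    rw [AddSubmonoid.closure_eq] at this
    exact this
  choose n hn using hret
  choose k _ hk using (Matrix.isIrreducible_iff_exists_pow_pos hnn).1 hB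
  refine ⟨∑ s, n s + ∑ s, ∑ s', k s s', fun s s' => ?_⟩
  have h1 : n s ≤ ∑ s, n s := Finset.single_le_sum (fun _ _ => Nat.zero_le _) (Finset.mem_univ s)
  have h2 : k s s' ≤ ∑ s, ∑ s', k s s' :=
    (Finset.single_le_sum (f := fun s' => k s s') (fun _ _ => Nat.zero_le _)
      (Finset.mem_univ s')).trans
      (Finset.single_le_sum (f := fun s => ∑ s', k s s') (fun _ _ => Nat.zero_le _)
        (Finset.mem_univ s))
  have h3 := hmul (∑ s, n s + ∑ s, ∑ s', k s s' - k s s') (k s s') s s s'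
    (hn s _ (by omega)) (hk s s')
  rwa [Nat.sub_add_cancel (by omega)] at h3

theorem sum_abs_vecMul_le {B : Matrix S S ℝ} (hB : B ∈ Matrix.rowStochastic ℝ S) (v : S → ℝ) :
    ∑ s', |(v ᵥ* B) s'| ≤ ∑ s, |v s| := by
  have h := Matrix.mem_rowStochastic_iff_sum.1 hB
  calc ∑ s', |(v ᵥ* B) s'| ≤ ∑ s', ∑ s, |v s| * B s s' := by
        refine Finset.sum_le_sum fun s' _ => ?_
        refine (Finset.abs_sum_le_sum_abs _ _).trans (Finset.sum_le_sum fun s _ => ?_)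
        rw [abs_mul, abs_of_nonneg (h.1 s s')]
    _ = ∑ s, |v s| := by
        rw [Finset.sum_comm]
        exact Finset.sum_congr rfl fun s _ => by rw [← Finset.mul_sum, h.2 s, mul_one]

/-- Doeblin contraction: because v has total mass zero, subtracting α from every entry of B does not
change v B, and the reduced nonnegative matrix has row sums 1 − |S| α. -/
theorem sum_abs_vecMul_le_of_le {B : Matrix S S ℝ} (hB : B ∈ Matrix.rowStochastic ℝ S) {α : ℝ}
    (hα : ∀ s s', α ≤ B s s') {v : S → ℝ} (hv : ∑ s, v s = 0) :
    ∑ s', |(v ᵥ* B) s'| ≤ (1 - Fintype.card S * α) * ∑ s, |v s| := by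
  have h := Matrix.mem_rowStochastic_iff_sum.1 hB
  calc ∑ s', |(v ᵥ* B) s'| ≤ ∑ s', ∑ s, |v s| * (B s s' - α) := by
        refine Finset.sum_le_sum fun s' _ => ?_
        have : (v ᵥ* B) s' = ∑ s, v s * (B s s' - α) := by
          simp only [mul_sub, Finset.sum_sub_distrib, ← Finset.sum_mul, hv, zero_mul, sub_zero]
          rfl
        rw [this]
        refine (Finset.abs_sum_le_sum_abs _ _).trans (Finset.sum_le_sum fun s _ => ?_)
        rw [abs_mul, abs_of_nonneg (sub_nonneg.2 (hα s s'))]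
    _ = _ := by
        rw [Finset.sum_comm, Finset.mul_sum]
        refine Finset.sum_congr rfl fun s _ => ?_
        rw [← Finset.mul_sum, Finset.sum_sub_distrib, h.2 s]
        simp; ring

theorem pow_add_row_sub (B : Matrix S S ℝ) (n k : ℕ) (s s₁ : S) :
    (fun s' => (B ^ (n + k)) s s' - (B ^ (n + k)) s₁ s') =
      (fun s' => (B ^ n) s s' - (B ^ n) s₁ s') ᵥ* B ^ k := by
  ext s'
  simp only [pow_add, Matrix.mul_apply, Matrix.vecMul, dotProduct, sub_mul,
    Finset.sum_sub_distrib]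

/-- The rows of large powers are close to each other. -/
theorem exists_rows_close {B : Matrix S S ℝ} (hB : B ∈ Matrix.rowStochastic ℝ S)
    (hi : B.IsIrreducible) (ha : Aperiodic B) :
    ∃ n, ∀ s s₁, ∑ s', |(B ^ n) s s' - (B ^ n) s₁ s'| < 1 / 4 := by
  obtain ⟨n, hn⟩ := exists_pow_pos hi ha
  rcases isEmpty_or_nonempty S with hS | hS
  · exact ⟨0, fun s => (hS.false s).elim⟩
  -- The least entry α of a positive power gives the contraction factor ρ = 1 − |S| α < 1 for every
  -- n steps; unit row sums give ρ ≥ 0.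
  obtain ⟨z, hz⟩ := Finite.exists_min (fun z : S × S => (B ^ n) z.1 z.2)
  set α := (B ^ n) z.1 z.2
  have hα : 0 < α := hn _ _
  have hst : ∀ t, B ^ t ∈ Matrix.rowStochastic ℝ S := fun t => pow_mem hB t
  have hsum : ∀ t s, ∑ s', (B ^ t) s s' = 1 :=
    fun t => (Matrix.mem_rowStochastic_iff_sum.1 (hst t)).2
  set ρ := 1 - Fintype.card S * α with hρ
  have hcard : (0 : ℝ) < Fintype.card S := by exact_mod_cast Fintype.card_pos
  have hρ1 : ρ < 1 := by have := mul_pos hcard hα; linarith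
  have hρ0 : 0 ≤ ρ := by
    have h1 := hsum n z.1
    have h2 : ∑ _s' : S, α ≤ ∑ s', (B ^ n) z.1 s' :=
      Finset.sum_le_sum fun s' _ => hz (z.1, s')
    rw [h1] at h2
    simp at h2
    linarith
  have key : ∀ k s s₁, ∑ s', |(B ^ (n * k)) s s' - (B ^ (n * k)) s₁ s'| ≤ 2 * ρ ^ k := by
    intro k
    induction k with
    | zero =>
      intro s s₁
      refine (Finset.sum_le_sum fun s' _ => abs_sub _ _).trans ?_
      rw [Finset.sum_add_distrib]
      simp only [mul_zero, pow_zero]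
      have : ∀ s : S, ∑ s', |(1 : Matrix S S ℝ) s s'| = 1 := by
        intro s
        rw [← hsum 0 s]
        refine Finset.sum_congr rfl fun s' _ => ?_
        rw [pow_zero, Matrix.one_apply]; split_ifs <;> simp
      rw [this, this]; norm_num
    | succ k ih =>
      intro s s₁
      have h0 := pow_add_row_sub B (n * k) n s s₁
      have h1 := sum_abs_vecMul_le_of_le (hst n) (fun s s' => hz (s, s'))
        (v := fun s' => (B ^ (n * k)) s s' - (B ^ (n * k)) s₁ s')
        (by rw [Finset.sum_sub_distrib, hsum, hsum, sub_self])
      rw [← h0] at h1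
      rw [mul_add, mul_one, pow_succ]
      refine h1.trans ?_
      have := mul_le_mul_of_nonneg_left (ih s s₁) hρ0
      linarith
  obtain ⟨k, hk⟩ := exists_pow_lt_of_lt_one (show (0 : ℝ) < 1 / 8 by norm_num) hρ1
  exact ⟨n * k, fun s s₁ => (key k s s₁).trans_lt (by linarith)⟩

theorem rows_close_mono {B : Matrix S S ℝ} (hB : B ∈ Matrix.rowStochastic ℝ S) {n k : ℕ}
    (hnk : n ≤ k) (s s₁ : S) :
    ∑ s', |(B ^ k) s s' - (B ^ k) s₁ s'| ≤ ∑ s', |(B ^ n) s s' - (B ^ n) s₁ s'| := by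
  obtain ⟨j, rfl⟩ := Nat.exists_eq_add_of_le hnk
  have := sum_abs_vecMul_le (pow_mem hB j) (fun s' => (B ^ n) s s' - (B ^ n) s₁ s')
  rwa [← pow_add_row_sub] at this

/-- A stochastic matrix has a stationary distribution. -/
theorem exists_isStationary [Nonempty S] {B : Matrix S S ℝ} (hB : B ∈ Matrix.rowStochastic ℝ S) :
    ∃ p, IsStationary B p := by
  have h := Matrix.mem_rowStochastic_iff_sum.1 hB
  -- The constant vector is a right null vector of B − 1, so a nonzero left null vector v exists as
  -- well; its sign is not yet known.
  have hdet : (B - 1).det = 0 := by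
    refine Matrix.exists_mulVec_eq_zero_iff.1 ⟨fun _ => 1, ?_, ?_⟩
    · intro h0
      exact one_ne_zero (congrFun h0 (Classical.arbitrary S))
    · ext s
      simp [Matrix.mulVec, dotProduct, h.2 s, Matrix.one_apply]
  obtain ⟨v, hv0, hv⟩ := Matrix.exists_vecMul_eq_zero_iff.2 hdet
  have hvB : v ᵥ* B = v := by
    rw [Matrix.vecMul_sub, Matrix.vecMul_one, sub_eq_zero] at hv; exact hv
  -- The vector |v| lies entrywise below |v| B and both have the same total mass, so they agree.
  -- Hence |v|, normalized, is stationary.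
  have hle : ∀ s', |v s'| ≤ ((fun s => |v s|) ᵥ* B) s' := by
    intro s'
    calc |v s'| = |(v ᵥ* B) s'| := by rw [hvB]
      _ ≤ _ := by
        refine (Finset.abs_sum_le_sum_abs _ _).trans (Finset.sum_le_sum fun s _ => ?_)
        rw [abs_mul, abs_of_nonneg (h.1 s s')]
  have hsum : ∑ s', ((fun s => |v s|) ᵥ* B) s' = ∑ s', |v s'| := by
    simp only [Matrix.vecMul, dotProduct]
    rw [Finset.sum_comm]
    exact Finset.sum_congr rfl fun s _ => by rw [← Finset.mul_sum, h.2 s, mul_one]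
  have heq : ∀ s', |v s'| = ((fun s => |v s|) ᵥ* B) s' := fun s' =>
    (Finset.sum_eq_sum_iff_of_le fun i _ => hle i).1 hsum.symm s' (Finset.mem_univ _)
  have hpos : 0 < ∑ s, |v s| := by
    obtain ⟨s, hs⟩ := Function.ne_iff.1 hv0
    exact Finset.sum_pos' (fun _ _ => abs_nonneg _) ⟨s, Finset.mem_univ _, abs_pos.2 hs⟩
  refine ⟨fun s => (∑ s, |v s|)⁻¹ * |v s|, fun s => by positivity, ?_, ?_⟩
  · rw [← Finset.mul_sum, inv_mul_cancel₀ hpos.ne']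
  · ext s'
    have : ((fun s => (∑ s, |v s|)⁻¹ * |v s|) ᵥ* B) s' =
        (∑ s, |v s|)⁻¹ * ((fun s => |v s|) ᵥ* B) s' := by
      simp only [Matrix.vecMul, dotProduct, Finset.mul_sum, mul_assoc]
    rw [this, ← heq]

end Chain

/-! ### Uniform mixing over all policies and summable distance to stationarity -/

section Mixing

variable {S A : Type*} [Fintype S] [DecidableEq S] [Fintype A]

theorem pmf_sum_toReal {α : Type*} [Fintype α] (p : PMF α) : ∑ a, (p a).toReal = 1 := by
  rw [← ENNReal.toReal_sum fun a _ => p.apply_ne_top a, ← tsum_fintype (L := .unconditional _),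
    p.tsum_coe, ENNReal.toReal_one]

theorem CMDP.transMat_mem (M : CMDP S A) (π : S → PMF A) :
    M.transMat π ∈ Matrix.rowStochastic ℝ S := by
  refine Matrix.mem_rowStochastic_iff_sum.2 ⟨fun s s' => ?_, fun s => ?_⟩
  · exact Finset.sum_nonneg fun a _ => mul_nonneg ENNReal.toReal_nonneg ENNReal.toReal_nonneg
  · simp only [CMDP.transMat, Matrix.of_apply]
    rw [Finset.sum_comm]
    simp only [← Finset.mul_sum, pmf_sum_toReal, mul_one]

theorem CMDP.nonempty {S A : Type*} (M : CMDP S A) : Nonempty S := M.ρ.support_nonempty.to_subtype.map (·.1)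

theorem CMDP.stat_spec (M : CMDP S A) (π : S → PMF A) :
    IsStationary (M.transMat π) (M.stat π) := by
  have := M.nonempty
  exact Classical.epsilon_spec (exists_isStationary (M.transMat_mem π))

theorem IsStationary.vecMul_pow {B : Matrix S S ℝ} {p : S → ℝ} (hp : IsStationary B p) (n : ℕ) :
    p ᵥ* B ^ n = p := by
  induction n with
  | zero => simp
  | succ n ih => rw [pow_succ, ← Matrix.vecMul_vecMul, ih, hp.2.2]

/-- A number of steps after which every policy has mixed. -/
theorem CMDP.Ergodic.exists_uniform_mixing {M : CMDP S A} (hM : M.Ergodic) :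
    ∃ N, 1 ≤ N ∧ ∀ π : S → PMF A, ∀ s,
      ∑ s', |(M.transMat π ^ N) s s' - M.stat π s'| ≤ 1 / 4 := by
  -- Compactness over policies: every point of the product of simplices is an ergodic policy, so the
  -- open sets `U n`, where the rows after n steps are within 1/4 of each other, cover it. A finite
  -- subcover, together with the monotonicity of row distances in n, gives one N for all policies.
  let mat : (S → A → ℝ) → Matrix S S ℝ :=
    fun p => Matrix.of fun s s' => ∑ a, p s a * (M.P s a s').toReal
  let K : Set (S → A → ℝ) := Set.pi Set.univ fun _ => stdSimplex ℝ A
  have hK : IsCompact K := isCompact_univ_pi fun _ => isCompact_stdSimplex ℝ A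
  have hmat : Continuous mat := by
    refine continuous_matrix fun s s' => ?_
    simp only [mat, Matrix.of_apply]
    fun_prop
  let U : ℕ → Set (S → A → ℝ) := fun n =>
    {p | ∀ s s₁, ∑ s', |(mat p ^ n) s s' - (mat p ^ n) s₁ s'| < 1 / 4}
  have hU : ∀ n, IsOpen (U n) := by
    intro n
    have : U n = ⋂ s, ⋂ s₁, {p | ∑ s', |(mat p ^ n) s s' - (mat p ^ n) s₁ s'| < 1 / 4} := by
      ext p; simp [U]
    rw [this]
    refine isOpen_iInter_of_finite fun s => isOpen_iInter_of_finite fun s₁ => ?_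
    refine isOpen_lt (continuous_finsetSum _ fun s' _ => ?_) continuous_const
    have hp : Continuous fun p => mat p ^ n := hmat.pow n
    exact ((hp.matrix_elem s s').sub (hp.matrix_elem s₁ s')).abs
  have hpol : ∀ p ∈ K, ∃ π : S → PMF A, mat p = M.transMat π := by
    intro p hp
    have hp' : ∀ s, p s ∈ stdSimplex ℝ A := fun s => hp s (Set.mem_univ _)
    refine ⟨fun s => PMF.ofFintype (fun a => ENNReal.ofReal (p s a)) ?_, ?_⟩
    · rw [← ENNReal.ofReal_sum_of_nonneg fun a _ => (hp' s).1 a, (hp' s).2, ENNReal.ofReal_one]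
    · ext s s'
      simp only [mat, CMDP.transMat, Matrix.of_apply, PMF.ofFintype_apply]
      exact Finset.sum_congr rfl fun a _ => by rw [ENNReal.toReal_ofReal ((hp' s).1 a)]
  have hcov : K ⊆ ⋃ n, U n ∩ K := by
    intro p hp
    obtain ⟨π, hπ⟩ := hpol p hp
    obtain ⟨n, hn⟩ := exists_rows_close (M.transMat_mem π) (hM π).1 (hM π).2
    exact Set.mem_iUnion.2 ⟨n, by simpa [U, hπ] using hn, hp⟩
  have hcov' : K ⊆ ⋃ n, U n := hcov.trans (Set.iUnion_mono fun n => Set.inter_subset_left)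
  obtain ⟨t, ht⟩ := hK.elim_finite_subcover U hU hcov'
  refine ⟨t.sup id + 1, by omega, fun π s => ?_⟩
  let p : S → A → ℝ := fun s a => (π s a).toReal
  have hp : p ∈ K := fun s _ => ⟨fun a => ENNReal.toReal_nonneg, pmf_sum_toReal _⟩
  have hpm : mat p = M.transMat π := rfl
  obtain ⟨n, hnt, hn⟩ : ∃ n ∈ t, p ∈ U n := by simpa using ht hp
  have hle : n ≤ t.sup id + 1 := (Finset.le_sup (f := id) hnt).trans (Nat.le_succ _)
  have hrow : ∀ s₁, ∑ s', |(M.transMat π ^ (t.sup id + 1)) s s' -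
      (M.transMat π ^ (t.sup id + 1)) s₁ s'| ≤ 1 / 4 := fun s₁ =>
    (rows_close_mono (M.transMat_mem π) hle s s₁).trans (hn s s₁).le
  generalize t.sup id + 1 = N at hrow
  have hst := M.stat_spec π
  have hpw := hst.vecMul_pow N
  calc ∑ s', |(M.transMat π ^ N) s s' - M.stat π s'|
      ≤ ∑ s', ∑ s₁, M.stat π s₁ * |(M.transMat π ^ N) s s' - (M.transMat π ^ N) s₁ s'| := by
        refine Finset.sum_le_sum fun s' _ => ?_
        have : (M.transMat π ^ N) s s' - M.stat π s' =
            ∑ s₁, M.stat π s₁ * ((M.transMat π ^ N) s s' - (M.transMat π ^ N) s₁ s') := by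
          simp only [mul_sub, Finset.sum_sub_distrib, ← Finset.sum_mul, hst.2.1, one_mul]
          congr 1
          exact (congrFun hpw s').symm
        rw [this]
        refine (Finset.abs_sum_le_sum_abs _ _).trans (Finset.sum_le_sum fun s₁ _ => ?_)
        rw [abs_mul, abs_of_nonneg (hst.1 s₁)]
    _ = ∑ s₁, M.stat π s₁ *
          ∑ s', |(M.transMat π ^ N) s s' - (M.transMat π ^ N) s₁ s'| := by
        rw [Finset.sum_comm]; simp only [Finset.mul_sum]
    _ ≤ ∑ s₁, M.stat π s₁ * (1 / 4) :=
        Finset.sum_le_sum fun s₁ _ => mul_le_mul_of_nonneg_left (hrow s₁) (hst.1 s₁)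
    _ = 1 / 4 := by rw [← Finset.sum_mul, hst.2.1, one_mul]

theorem CMDP.Ergodic.mixTimeOf_spec {M : CMDP S A} (hM : M.Ergodic) (π : S → PMF A) :
    1 ≤ M.mixTimeOf π ∧
      ∀ s, ∑ s', |(M.transMat π ^ M.mixTimeOf π) s s' - M.stat π s'| ≤ 1 / 4 := by
  obtain ⟨N, hN, h⟩ := hM.exists_uniform_mixing
  exact Nat.sInf_mem (s := {t : ℕ | 1 ≤ t ∧
    ∀ s, ∑ s', |(M.transMat π ^ t) s s' - M.stat π s'| ≤ 1 / 4}) ⟨N, hN, h π⟩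

/-- The supremum of an unbounded set of naturals is 0 by convention, so this needs the mixing times
to be bounded uniformly over policies. -/
theorem CMDP.Ergodic.mixTimeOf_le_mixTime {d m : ℕ} {M : CMDP S A} (hM : M.Ergodic)
    (X : Approximator S A d m) {Θ : Set (Param d)} {θ : Param d} (hθ : θ ∈ Θ) :
    M.mixTimeOf (X.π θ) ≤ mixTime M X Θ := by
  obtain ⟨N, hN, h⟩ := hM.exists_uniform_mixing
  refine le_csSup ⟨N, ?_⟩ ⟨θ, hθ, rfl⟩
  rintro _ ⟨θ', -, rfl⟩
  exact Nat.sInf_le ⟨hN, h (X.π θ')⟩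

/-- The distance of the `t`-step distribution from `s` to stationarity. -/
def CMDP.mixDist (M : CMDP S A) (π : S → PMF A) (t : ℕ) (s : S) : ℝ :=
  ∑ s', |(M.transMat π ^ t) s s' - M.stat π s'|

theorem CMDP.mixDist_nonneg (M : CMDP S A) (π : S → PMF A) (t : ℕ) (s : S) :
    0 ≤ M.mixDist π t s := Finset.sum_nonneg fun _ _ => abs_nonneg _

theorem CMDP.pow_nonneg (M : CMDP S A) (π : S → PMF A) (t : ℕ) (s s' : S) :
    0 ≤ (M.transMat π ^ t) s s' :=
  (Matrix.mem_rowStochastic_iff_sum.1 (pow_mem (M.transMat_mem π) t)).1 s s'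

theorem CMDP.pow_sum (M : CMDP S A) (π : S → PMF A) (t : ℕ) (s : S) :
    ∑ s', (M.transMat π ^ t) s s' = 1 :=
  (Matrix.mem_rowStochastic_iff_sum.1 (pow_mem (M.transMat_mem π) t)).2 s

theorem CMDP.mixDist_le_two (M : CMDP S A) (π : S → PMF A) (t : ℕ) (s : S) :
    M.mixDist π t s ≤ 2 := by
  have hst := M.stat_spec π
  refine (Finset.sum_le_sum fun s' _ => abs_sub _ _).trans ?_
  rw [Finset.sum_add_distrib]
  have h1 : ∑ s', |(M.transMat π ^ t) s s'| = 1 := by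
    rw [← M.pow_sum π t s]
    exact Finset.sum_congr rfl fun s' _ => abs_of_nonneg (M.pow_nonneg π t s s')
  have h2 : ∑ s', |M.stat π s'| = 1 := by
    rw [← hst.2.1]; exact Finset.sum_congr rfl fun s' _ => abs_of_nonneg (hst.1 s')
  rw [h1, h2]; norm_num

/-- The difference of the `t`-step row and the stationary law has mass zero, so it may be pushed
through P^τ − 1⊗d in place of P^τ; each row of that matrix has ℓ¹ norm at most 1/4. -/
theorem CMDP.Ergodic.mixDist_add_le {M : CMDP S A} (hM : M.Ergodic) (π : S → PMF A) (t : ℕ)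
    (s : S) : M.mixDist π (t + M.mixTimeOf π) s ≤ 1 / 4 * M.mixDist π t s := by
  have hst := M.stat_spec π
  have hτ := (hM.mixTimeOf_spec π).2
  generalize M.mixTimeOf π = τ at hτ
  calc M.mixDist π (t + τ) s
      ≤ ∑ s', ∑ s₁, |(M.transMat π ^ t) s s₁ - M.stat π s₁| *
          |(M.transMat π ^ τ) s₁ s' - M.stat π s'| := by
        refine Finset.sum_le_sum fun s' _ => ?_
        have h0 : ∑ s₁, ((M.transMat π ^ t) s s₁ - M.stat π s₁) = 0 := by
          rw [Finset.sum_sub_distrib, M.pow_sum, hst.2.1, sub_self]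
        have : (M.transMat π ^ (t + τ)) s s' - M.stat π s' =
            ∑ s₁, ((M.transMat π ^ t) s s₁ - M.stat π s₁) *
              ((M.transMat π ^ τ) s₁ s' - M.stat π s') := by
          simp only [mul_sub, Finset.sum_sub_distrib, ← Finset.sum_mul, h0, zero_mul, sub_zero]
          simp only [sub_mul, Finset.sum_sub_distrib]
          rw [pow_add, Matrix.mul_apply]
          congr 1
          exact (congrFun (hst.vecMul_pow τ) s').symm
        rw [this]
        refine (Finset.abs_sum_le_sum_abs _ _).trans (Finset.sum_le_sum fun s₁ _ => ?_)
        rw [abs_mul]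
    _ = ∑ s₁, |(M.transMat π ^ t) s s₁ - M.stat π s₁| *
          ∑ s', |(M.transMat π ^ τ) s₁ s' - M.stat π s'| := by
        rw [Finset.sum_comm]; simp only [Finset.mul_sum]
    _ ≤ ∑ s₁, |(M.transMat π ^ t) s s₁ - M.stat π s₁| * (1 / 4) :=
        Finset.sum_le_sum fun s₁ _ => mul_le_mul_of_nonneg_left (hτ s₁) (abs_nonneg _)
    _ = 1 / 4 * M.mixDist π t s := by rw [← Finset.sum_mul, mul_comm]; rfl

/-- The first τ terms are at most 2 each and shifting by τ costs a factor 1/4, so the sum Σ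
satisfies Σ ≤ 2τ + Σ/4. This is the origin of every 8/3 below. -/
theorem CMDP.Ergodic.sum_mixDist_le {M : CMDP S A} (hM : M.Ergodic) (π : S → PMF A) (n : ℕ)
    (s : S) : ∑ t ∈ Finset.range n, M.mixDist π t s ≤ 8 / 3 * M.mixTimeOf π := by
  set τ := M.mixTimeOf π
  have h1 : ∑ t ∈ Finset.range n, M.mixDist π t s ≤
      ∑ t ∈ Finset.range (τ + n), M.mixDist π t s :=
    Finset.sum_le_sum_of_subset_of_nonneg (Finset.range_mono (Nat.le_add_left _ _))
      fun _ _ _ => M.mixDist_nonneg π _ s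
  rw [Finset.sum_range_add] at h1
  have h2 : ∑ t ∈ Finset.range τ, M.mixDist π t s ≤ 2 * τ := by
    refine (Finset.sum_le_sum fun t _ => M.mixDist_le_two π t s).trans ?_
    simp [mul_comm]
  have h3 : ∑ t ∈ Finset.range n, M.mixDist π (τ + t) s ≤
      1 / 4 * ∑ t ∈ Finset.range n, M.mixDist π t s := by
    rw [Finset.mul_sum]
    refine Finset.sum_le_sum fun t _ => ?_
    rw [add_comm]
    exact hM.mixDist_add_le π t s
  linarith

theorem CMDP.Ergodic.summable_mixDist {M : CMDP S A} (hM : M.Ergodic) (π : S → PMF A) (s : S) :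
    Summable fun t => M.mixDist π t s :=
  summable_of_sum_range_le (fun t => M.mixDist_nonneg π t s) fun n => hM.sum_mixDist_le π n s

theorem CMDP.Ergodic.tsum_mixDist_le {M : CMDP S A} (hM : M.Ergodic) (π : S → PMF A) (s : S) :
    ∑' t, M.mixDist π t s ≤ 8 / 3 * M.mixTimeOf π :=
  Real.tsum_le_of_sum_range_le (fun t => M.mixDist_nonneg π t s)
    fun n => hM.sum_mixDist_le π n s

end Mixing

/-! ### Poisson equation, value functions and perturbation of the stationary law -/

section Poisson

variable {S A : Type*} [Fintype S] [DecidableEq S] [Fintype A]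

/-- Both weight vectors have mass one, so w may be recentred at any c. The freedom in c is used for
the Fisher samples, which are centred at a midpoint. -/
theorem CMDP.norm_sum_pow_smul_sub_le {E : Type*} [NormedAddCommGroup E] [NormedSpace ℝ E]
    (M : CMDP S A) (π : S → PMF A) {w : S → E} {c : E} {b : ℝ} (hw : ∀ s, ‖w s - c‖ ≤ b)
    (t : ℕ) (s : S) :
    ‖∑ s', (M.transMat π ^ t) s s' • w s' - ∑ s', M.stat π s' • w s'‖ ≤
      b * M.mixDist π t s := by
  have hst := M.stat_spec π
  have : ∑ s', (M.transMat π ^ t) s s' • w s' - ∑ s', M.stat π s' • w s' =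
      ∑ s', ((M.transMat π ^ t) s s' - M.stat π s') • (w s' - c) := by
    simp only [smul_sub, sub_smul, Finset.sum_sub_distrib, ← Finset.sum_smul, M.pow_sum, hst.2.1]
    abel
  rw [this, CMDP.mixDist, Finset.mul_sum]
  refine (norm_sum_le _ _).trans (Finset.sum_le_sum fun s' _ => ?_)
  rw [norm_smul, Real.norm_eq_abs, mul_comm]
  exact mul_le_mul_of_nonneg_right (hw s') (abs_nonneg _)

/-- The solution `∑_t (P^t w - d·w)` of the Poisson equation for `w`. -/
def CMDP.biasFun (M : CMDP S A) (π : S → PMF A) (w : S → ℝ) (s : S) : ℝ :=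
  ∑' t : ℕ, ((M.transMat π ^ t *ᵥ w) s - M.stat π ⬝ᵥ w)

theorem CMDP.abs_mulVec_sub_le (M : CMDP S A) (π : S → PMF A) {w : S → ℝ} {b : ℝ}
    (hw : ∀ s, |w s| ≤ b) (t : ℕ) (s : S) :
    |(M.transMat π ^ t *ᵥ w) s - M.stat π ⬝ᵥ w| ≤ b * M.mixDist π t s :=
  M.norm_sum_pow_smul_sub_le π (w := w) (c := 0) (by simpa using hw) t s

theorem exists_abs_le (w : S → ℝ) : ∃ b, ∀ s, |w s| ≤ b :=
  ⟨∑ s, |w s|, fun s => Finset.single_le_sum (f := fun s => |w s|) (fun _ _ => abs_nonneg _)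
    (Finset.mem_univ s)⟩

theorem CMDP.Ergodic.summable_bias {M : CMDP S A} (hM : M.Ergodic) (π : S → PMF A) (w : S → ℝ)
    (s : S) : Summable fun t : ℕ => (M.transMat π ^ t *ᵥ w) s - M.stat π ⬝ᵥ w := by
  obtain ⟨b, hb⟩ := exists_abs_le w
  exact Summable.of_norm_bounded ((hM.summable_mixDist π s).mul_left b)
    fun t => M.abs_mulVec_sub_le π hb t s

theorem CMDP.Ergodic.abs_biasFun_le {M : CMDP S A} (hM : M.Ergodic) (π : S → PMF A) {w : S → ℝ}
    {b : ℝ} (hb0 : 0 ≤ b) (hb : ∀ s, |w s| ≤ b) (s : S) :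
    |M.biasFun π w s| ≤ b * (8 / 3 * M.mixTimeOf π) := by
  have h1 : ‖M.biasFun π w s‖ ≤ ∑' t, b * M.mixDist π t s :=
    tsum_of_norm_bounded ((hM.summable_mixDist π s).mul_left b).hasSum
      fun t => M.abs_mulVec_sub_le π hb t s
  refine h1.trans ?_
  rw [tsum_mul_left]
  exact mul_le_mul_of_nonneg_left (hM.tsum_mixDist_le π s) hb0

/-- The term t = 0 of the series is w minus its stationary mean; the remaining terms are the same
series averaged over one transition. -/
theorem CMDP.Ergodic.biasFun_eq {M : CMDP S A} (hM : M.Ergodic) (π : S → PMF A) (w : S → ℝ)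
    (s : S) :
    M.biasFun π w s = w s - M.stat π ⬝ᵥ w + (M.transMat π *ᵥ M.biasFun π w) s := by
  rw [CMDP.biasFun, (hM.summable_bias π w s).tsum_eq_zero_add]
  simp only [pow_zero, Matrix.one_mulVec]
  congr 1
  change _ = ∑ s', M.transMat π s s' *
    ∑' t : ℕ, ((M.transMat π ^ t *ᵥ w) s' - M.stat π ⬝ᵥ w)
  simp only [← tsum_mul_left]
  rw [← Summable.tsum_finsetSum fun s' _ => (hM.summable_bias π w s').mul_left _]
  refine tsum_congr fun t => ?_
  simp only [mul_sub, Finset.sum_sub_distrib, ← Finset.sum_mul]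
  have : ∑ s', M.transMat π s s' = 1 := by simpa using M.pow_sum π 1 s
  rw [this, one_mul, pow_succ']
  congr 1
  simp only [Matrix.mulVec, Matrix.mul_apply, dotProduct, Finset.sum_mul, Finset.mul_sum]
  rw [Finset.sum_comm]
  simp only [mul_assoc]

/-- The expected signal `∑_a π(a|s) g(s, a)`. -/
def CMDP.meanSignal (M : CMDP S A) (g : Signal) (π : S → PMF A) (s : S) : ℝ :=
  ∑ a, (π s a).toReal * M.signal g s a

theorem CMDP.abs_signal_le {S A : Type*} (M : CMDP S A) (g : Signal) (s : S) (a : A) :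
    |M.signal g s a| ≤ 1 := by
  cases g
  · have := M.reward_mem s a
    exact abs_le.2 ⟨by have := this.1; simp only [CMDP.signal]; linarith, this.2⟩
  · exact abs_le.2 (M.cost_mem s a)

theorem CMDP.abs_meanSignal_le (M : CMDP S A) (g : Signal) (π : S → PMF A) (s : S) :
    |M.meanSignal g π s| ≤ 1 := by
  refine (Finset.abs_sum_le_sum_abs _ _).trans ?_
  rw [← pmf_sum_toReal (π s)]
  refine Finset.sum_le_sum fun a _ => ?_
  rw [abs_mul, abs_of_nonneg ENNReal.toReal_nonneg]
  exact mul_le_of_le_one_right ENNReal.toReal_nonneg (M.abs_signal_le g s a)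

/-- The centred expectations are terms of a convergent series, hence tend to zero from every initial
state; the Cesàro means then have the same limit. -/
theorem CMDP.Ergodic.J_eq {M : CMDP S A} (hM : M.Ergodic) (g : Signal) (π : S → PMF A) :
    M.J g π = M.stat π ⬝ᵥ M.meanSignal g π := by
  refine Tendsto.limUnder_eq ?_
  have h1 : ∀ s, Tendsto (fun t => M.expSignal g π t s) atTop
      (𝓝 (M.stat π ⬝ᵥ M.meanSignal g π)) := by
    intro s
    have := (hM.summable_bias π (M.meanSignal g π) s).tendsto_atTop_zero
    have h := this.add_const (M.stat π ⬝ᵥ M.meanSignal g π)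
    simp only [sub_add_cancel, zero_add] at h
    exact h
  have h2 : Tendsto (fun t => ∑ s, (M.ρ s).toReal * M.expSignal g π t s) atTop
      (𝓝 (∑ s, (M.ρ s).toReal * M.stat π ⬝ᵥ M.meanSignal g π)) :=
    tendsto_finsetSum _ fun s _ => (h1 s).const_mul _
  rw [← Finset.sum_mul, pmf_sum_toReal, one_mul] at h2
  simpa using h2.cesaro

theorem CMDP.stat_le_one (M : CMDP S A) (π : S → PMF A) (s : S) : M.stat π s ≤ 1 := by
  have hst := M.stat_spec π
  rw [← hst.2.1]
  exact Finset.single_le_sum (fun s _ => hst.1 s) (Finset.mem_univ s)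

theorem CMDP.abs_stat_dot_le (M : CMDP S A) (π : S → PMF A) {w : S → ℝ} {b : ℝ}
    (hw : ∀ s, |w s| ≤ b) : |M.stat π ⬝ᵥ w| ≤ b := by
  have hst := M.stat_spec π
  refine (Finset.abs_sum_le_sum_abs _ _).trans ?_
  calc ∑ s, |M.stat π s * w s| ≤ ∑ s, M.stat π s * b := Finset.sum_le_sum fun s _ => by
        rw [abs_mul, abs_of_nonneg (hst.1 s)]
        exact mul_le_mul_of_nonneg_left (hw s) (hst.1 s)
    _ = b := by rw [← Finset.sum_mul, hst.2.1, one_mul]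

theorem CMDP.Ergodic.abs_J_le {M : CMDP S A} (hM : M.Ergodic) (g : Signal) (π : S → PMF A) :
    |M.J g π| ≤ 1 := by
  rw [hM.J_eq]; exact M.abs_stat_dot_le π (M.abs_meanSignal_le g π)

theorem CMDP.transMat_mulVec (M : CMDP S A) (π : S → PMF A) (w : S → ℝ) (s : S) :
    (M.transMat π *ᵥ w) s = ∑ a, (π s a).toReal * ∑ s', (M.P s a s').toReal * w s' := by
  simp only [Matrix.mulVec, dotProduct, CMDP.transMat, Matrix.of_apply, Finset.sum_mul,
    Finset.mul_sum]
  rw [Finset.sum_comm]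
  simp only [mul_assoc]

theorem CMDP.Ergodic.Q_eq_bias {M : CMDP S A} (hM : M.Ergodic) (g : Signal) (π : S → PMF A)
    (s : S) (a : A) :
    M.Q g π s a = M.signal g s a - M.J g π +
      ∑ s', (M.P s a s').toReal * M.biasFun π (M.meanSignal g π) s' := by
  have hs : ∀ t, M.expSignalSA g π s a (t + 1) - M.J g π =
      ∑ s', (M.P s a s').toReal *
        ((M.transMat π ^ t *ᵥ M.meanSignal g π) s' - M.stat π ⬝ᵥ M.meanSignal g π) := by
    intro t
    simp only [mul_sub, Finset.sum_sub_distrib, ← Finset.sum_mul, pmf_sum_toReal, one_mul]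
    rw [hM.J_eq]; rfl
  have hsum : ∀ s', Summable fun t : ℕ => (M.P s a s').toReal *
        ((M.transMat π ^ t *ᵥ M.meanSignal g π) s' - M.stat π ⬝ᵥ M.meanSignal g π) :=
    fun s' => (hM.summable_bias π _ s').mul_left _
  have hS : Summable fun t => M.expSignalSA g π s a t - M.J g π := by
    rw [← summable_nat_add_iff 1]
    simp only [hs]
    exact summable_sum fun s' _ => hsum s'
  rw [CMDP.Q, hS.tsum_eq_zero_add]
  congr 1
  simp only [hs]
  rw [Summable.tsum_finsetSum fun s' _ => hsum s']
  exact Finset.sum_congr rfl fun s' _ => tsum_mul_left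

theorem CMDP.Ergodic.V_eq_bias {M : CMDP S A} (hM : M.Ergodic) (g : Signal) (π : S → PMF A)
    (s : S) : M.V g π s = M.biasFun π (M.meanSignal g π) s := by
  rw [hM.biasFun_eq, CMDP.V, M.transMat_mulVec, ← hM.J_eq]
  simp only [hM.Q_eq_bias, mul_add, mul_sub, Finset.sum_add_distrib, Finset.sum_sub_distrib,
    ← Finset.sum_mul, pmf_sum_toReal, one_mul]
  rfl

theorem CMDP.Ergodic.Q_eq {M : CMDP S A} (hM : M.Ergodic) (g : Signal) (π : S → PMF A)
    (s : S) (a : A) :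
    M.Q g π s a = M.signal g s a - M.J g π + ∑ s', (M.P s a s').toReal * M.V g π s' := by
  simp only [hM.Q_eq_bias, hM.V_eq_bias]

theorem CMDP.Ergodic.abs_V_le {M : CMDP S A} (hM : M.Ergodic) (g : Signal) (π : S → PMF A)
    (s : S) : |M.V g π s| ≤ 8 / 3 * M.mixTimeOf π := by
  rw [hM.V_eq_bias]
  simpa using hM.abs_biasFun_le π zero_le_one (M.abs_meanSignal_le g π) s

/-- The performance difference identity. -/
theorem CMDP.Ergodic.J_sub_J {M : CMDP S A} (hM : M.Ergodic) (g : Signal) (π' π : S → PMF A) :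
    M.J g π' - M.J g π =
      ∑ s, M.stat π' s * ∑ a, ((π' s a).toReal - (π s a).toReal) * M.Q g π s a := by
  have hst := M.stat_spec π'
  -- By the Bellman equation, the inner sum is the mean signal under π' minus J^π, plus P'V − V.
  -- Stationarity of d' under P' removes the last two terms.
  have h1 : ∀ s, ∑ a, ((π' s a).toReal - (π s a).toReal) * M.Q g π s a =
      M.meanSignal g π' s - M.J g π + (M.transMat π' *ᵥ M.V g π) s - M.V g π s := by
    intro s
    simp only [sub_mul, Finset.sum_sub_distrib]
    congr 1
    simp only [hM.Q_eq, mul_add, mul_sub, Finset.sum_add_distrib, Finset.sum_sub_distrib,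
      ← Finset.sum_mul, pmf_sum_toReal, one_mul, M.transMat_mulVec]
    rfl
  have h2 : M.stat π' ⬝ᵥ (M.transMat π' *ᵥ M.V g π) = M.stat π' ⬝ᵥ M.V g π := by
    rw [Matrix.dotProduct_mulVec, hst.2.2]
  simp only [h1, mul_sub, mul_add, Finset.sum_sub_distrib, Finset.sum_add_distrib,
    ← Finset.sum_mul, hst.2.1, one_mul]
  simp only [dotProduct] at h2
  rw [h2, hM.J_eq g π', dotProduct]
  ring

/-- The stationary law of π' is paired with the Poisson equation for π, so that the only dependence
on π' beyond its stationary law is P' − P. -/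
theorem CMDP.Ergodic.stat_dot_sub {M : CMDP S A} (hM : M.Ergodic) (π' π : S → PMF A)
    (w : S → ℝ) :
    M.stat π' ⬝ᵥ w - M.stat π ⬝ᵥ w =
      M.stat π' ⬝ᵥ ((M.transMat π' - M.transMat π) *ᵥ M.biasFun π w) := by
  have hst := M.stat_spec π'
  rw [Matrix.sub_mulVec, dotProduct_sub, Matrix.dotProduct_mulVec, hst.2.2]
  have : M.biasFun π w = fun s => w s - M.stat π ⬝ᵥ w + (M.transMat π *ᵥ M.biasFun π w) s :=
    funext (hM.biasFun_eq π w)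
  nth_rewrite 1 [this]
  simp only [dotProduct, mul_sub, mul_add, Finset.sum_sub_distrib, Finset.sum_add_distrib,
    ← Finset.sum_mul, hst.2.1, one_mul]
  ring

/-- The perturbation identity is applied to the indicator of s: the bias function belongs to the
fixed θ, and the transition matrices converge as θ' tends to θ. -/
theorem CMDP.Ergodic.continuousAt_stat {d m : ℕ} {M : CMDP S A} (hM : M.Ergodic)
    (X : Approximator S A d m) {θ : Param d}
    (hc : ∀ s a, ContinuousAt (fun θ' => (X.π θ' s a).toReal) θ) (s : S) :
    ContinuousAt (fun θ' => M.stat (X.π θ') s) θ := by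
  set h := M.biasFun (X.π θ) (Pi.single s 1)
  have hstat : ∀ θ', M.stat (X.π θ') s = M.stat (X.π θ') ⬝ᵥ Pi.single s 1 := by simp
  have hz : Tendsto (fun θ' =>
      ∑ s, |((M.transMat (X.π θ') - M.transMat (X.π θ)) *ᵥ h) s|) (𝓝 θ) (𝓝 0) := by
    have : ContinuousAt (fun θ' =>
        ∑ s, |((M.transMat (X.π θ') - M.transMat (X.π θ)) *ᵥ h) s|) θ := by
      simp only [Matrix.mulVec, dotProduct, Matrix.sub_apply, CMDP.transMat, Matrix.of_apply]
      fun_prop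
    simpa [ContinuousAt] using this
  refine tendsto_iff_norm_sub_tendsto_zero.2 (squeeze_zero (fun _ => norm_nonneg _) ?_ hz)
  intro θ'
  change ‖M.stat (X.π θ') s - M.stat (X.π θ) s‖ ≤ _
  rw [hstat, hstat, hM.stat_dot_sub, Real.norm_eq_abs]
  refine (Finset.abs_sum_le_sum_abs _ _).trans (Finset.sum_le_sum fun s' _ => ?_)
  rw [abs_mul, abs_of_nonneg ((M.stat_spec _).1 s')]
  exact mul_le_of_le_one_left (abs_nonneg _) (M.stat_le_one _ s')

end Poisson

/-! ### Stationary expectation over transitions -/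

section StatExp

variable {S A : Type*} [Fintype S] [DecidableEq S] [Fintype A]

/-- The weight of the transition `z` under the stationary law. -/
def CMDP.statWeight (M : CMDP S A) (π : S → PMF A) (z : S × A × S) : ℝ :=
  M.stat π z.1 * (π z.1 z.2.1).toReal * (M.P z.1 z.2.1 z.2.2).toReal

theorem CMDP.statWeight_nonneg (M : CMDP S A) (π : S → PMF A) (z : S × A × S) :
    0 ≤ M.statWeight π z :=
  mul_nonneg (mul_nonneg ((M.stat_spec π).1 _) ENNReal.toReal_nonneg) ENNReal.toReal_nonneg

theorem CMDP.statExp_eq_sum (M : CMDP S A) (π : S → PMF A) {E : Type*} [AddCommMonoid E]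
    [Module ℝ E] (f : S × A × S → E) : M.statExp π f = ∑ z, M.statWeight π z • f z := by
  simp only [Fintype.sum_prod_type]; rfl

theorem CMDP.sum_statWeight (M : CMDP S A) (π : S → PMF A) : ∑ z, M.statWeight π z = 1 := by
  simp only [Fintype.sum_prod_type, CMDP.statWeight, ← Finset.mul_sum, pmf_sum_toReal, mul_one]
  exact (M.stat_spec π).2.1

variable {E F : Type*}

theorem CMDP.map_statExp (M : CMDP S A) (π : S → PMF A) [AddCommMonoid E] [Module ℝ E]
    [AddCommMonoid F] [Module ℝ F] (T : E →ₗ[ℝ] F) (f : S × A × S → E) :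
    T (M.statExp π f) = M.statExp π fun z => T (f z) := by
  simp only [CMDP.statExp_eq_sum, map_sum, map_smul]

theorem CMDP.statExp_add (M : CMDP S A) (π : S → PMF A) [AddCommMonoid E] [Module ℝ E]
    (f g : S × A × S → E) :
    M.statExp π (fun z => f z + g z) = M.statExp π f + M.statExp π g := by
  simp only [CMDP.statExp_eq_sum, smul_add, Finset.sum_add_distrib]

theorem CMDP.statExp_sub (M : CMDP S A) (π : S → PMF A) [AddCommGroup E] [Module ℝ E]
    (f g : S × A × S → E) :
    M.statExp π (fun z => f z - g z) = M.statExp π f - M.statExp π g := by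
  simp only [CMDP.statExp_eq_sum, smul_sub, Finset.sum_sub_distrib]

theorem CMDP.statExp_const (M : CMDP S A) (π : S → PMF A) [AddCommMonoid E] [Module ℝ E]
    (c : E) : M.statExp π (fun _ => c) = c := by
  rw [CMDP.statExp_eq_sum, ← Finset.sum_smul, M.sum_statWeight, one_smul]

theorem CMDP.statExp_mono (M : CMDP S A) (π : S → PMF A) {f g : S × A × S → ℝ}
    (h : ∀ z, f z ≤ g z) : M.statExp π f ≤ M.statExp π g := by
  simp only [CMDP.statExp_eq_sum]
  exact Finset.sum_le_sum fun z _ => mul_le_mul_of_nonneg_left (h z) (M.statWeight_nonneg π z)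

theorem CMDP.norm_statExp_le_statExp (M : CMDP S A) (π : S → PMF A) [NormedAddCommGroup E]
    [NormedSpace ℝ E] (f : S × A × S → E) : ‖M.statExp π f‖ ≤ M.statExp π fun z => ‖f z‖ := by
  simp only [CMDP.statExp_eq_sum]
  refine (norm_sum_le _ _).trans (Finset.sum_le_sum fun z _ => ?_)
  rw [norm_smul, Real.norm_of_nonneg (M.statWeight_nonneg π z), smul_eq_mul]

theorem CMDP.norm_statExp_le (M : CMDP S A) (π : S → PMF A) [NormedAddCommGroup E]
    [NormedSpace ℝ E] {f : S × A × S → E} {b : ℝ} (h : ∀ z, ‖f z‖ ≤ b) : ‖M.statExp π f‖ ≤ b :=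
  ((M.norm_statExp_le_statExp π f).trans (M.statExp_mono π h)).trans_eq (M.statExp_const π b)

theorem CMDP.norm_statExp_sq_le (M : CMDP S A) (π : S → PMF A) [NormedAddCommGroup E]
    [NormedSpace ℝ E] (f : S × A × S → E) :
    ‖M.statExp π f‖ ^ 2 ≤ M.statExp π fun z => ‖f z‖ ^ 2 := by
  refine (pow_le_pow_left₀ (norm_nonneg _) (M.norm_statExp_le_statExp π f) 2).trans ?_
  simp only [CMDP.statExp_eq_sum, smul_eq_mul]
  exact (even_two.convexOn_pow (𝕜 := ℝ)).map_sum_le (fun z _ => M.statWeight_nonneg π z)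
    (M.sum_statWeight π) (fun _ _ => Set.mem_univ _)

theorem CMDP.statExp_fst (M : CMDP S A) (π : S → PMF A) [AddCommMonoid E] [Module ℝ E]
    (w : S → A → E) :
    M.statExp π (fun z => w z.1 z.2.1) =
      ∑ s, M.stat π s • ∑ a, (π s a).toReal • w s a := by
  simp only [CMDP.statExp, ← Finset.sum_smul, ← Finset.mul_sum, pmf_sum_toReal, mul_one,
    Finset.smul_sum, smul_smul]

/-- One step from the stationary law gives the stationary law again. This is what identifies an
error at the next state with `criticErrorAt`. -/
theorem CMDP.statExp_next (M : CMDP S A) (π : S → PMF A) (w : S → ℝ) :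
    M.statExp π (fun z => w z.2.2) = M.stat π ⬝ᵥ w := by
  have h : M.stat π ⬝ᵥ (M.transMat π *ᵥ w) = M.stat π ⬝ᵥ w := by
    rw [Matrix.dotProduct_mulVec, (M.stat_spec π).2.2]
  rw [← h]
  simp only [CMDP.statExp, dotProduct, M.transMat_mulVec, Finset.mul_sum, smul_eq_mul, mul_assoc]

end StatExp

/-! ### Policy gradient formula -/

section PolicyGradient

variable {S A : Type*} [Fintype S] [DecidableEq S] [Fintype A] {d m : ℕ}

/-- Since f vanishes at x, the term in which c would be differentiated drops out, so continuity of c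
is enough. -/
theorem hasFDerivAt_mul_of_continuousAt {E : Type*} [NormedAddCommGroup E] [NormedSpace ℝ E]
    {c f : E → ℝ} {f' : E →L[ℝ] ℝ} {x : E} (hc : ContinuousAt c x) (hf : HasFDerivAt f f' x)
    (h0 : f x = 0) : HasFDerivAt (fun y => c y * f y) (c x • f') x := by
  rw [hasFDerivAt_iff_isLittleO] at hf ⊢
  have h1 : (fun y => c y * (f y - f x - f' (y - x))) =o[𝓝 x] fun y => y - x := by
    have := hc.norm.isBoundedUnder_le.isBigO_one ℝ |>.mul_isLittleO hf.norm_right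
    simpa using this.norm_right
  have h2 : (fun y => (c y - c x) * f' (y - x)) =o[𝓝 x] fun y => y - x := by
    have hc' : (fun y => c y - c x) =o[𝓝 x] fun _ => (1 : ℝ) := by
      rw [Asymptotics.isLittleO_one_iff]
      simpa using hc.tendsto.sub_const (c x)
    have := hc'.mul_isBigO ((f'.isBigO_sub (𝓝 x) x).norm_right)
    simpa using this.norm_right
  refine (h1.add h2).congr_left fun y => ?_
  simp only [h0, smul_apply, smul_eq_mul]
  ring

theorem ScoreBounds.hasGradientAt {X : Approximator S A d m} {Θ : Set (Param d)} {G₁ G₂ : ℝ}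
    (hX : ScoreBounds X Θ G₁ G₂) {θ : Param d} (hθ : θ ∈ Θ) (s : S) (a : A) :
    HasGradientAt (fun θ' => (X.π θ' s a).toReal) ((X.π θ s a).toReal • score X θ s a) θ := by
  have hp := hX.pos θ hθ s a
  have h1 := (hX.diff θ hθ s a).hasGradientAt
  have h2 : HasGradientAt (fun θ' => Real.log (X.π θ' s a).toReal)
      ((X.π θ s a).toReal⁻¹ • gradient (fun θ' => (X.π θ' s a).toReal) θ) θ := by
    rw [hasGradientAt_iff_hasFDerivAt] at h1 ⊢
    have := h1.log hp.ne'
    simpa using this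
  have h3 : score X θ s a =
      (X.π θ s a).toReal⁻¹ • gradient (fun θ' => (X.π θ' s a).toReal) θ := h2.gradient
  rw [h3, smul_smul, mul_inv_cancel₀ hp.ne', one_smul]
  exact h1

/-- The probabilities sum to one for every parameter, so their gradients sum to zero. -/
theorem ScoreBounds.sum_smul_score {X : Approximator S A d m} {Θ : Set (Param d)} {G₁ G₂ : ℝ}
    (hX : ScoreBounds X Θ G₁ G₂) {θ : Param d} (hθ : θ ∈ Θ) (s : S) :
    ∑ a, (X.π θ s a).toReal • score X θ s a = 0 := by
  have h1 : HasFDerivAt (fun θ' => ∑ a, (X.π θ' s a).toReal)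
      (∑ a, InnerProductSpace.toDual ℝ (Param d) ((X.π θ s a).toReal • score X θ s a)) θ :=
    HasFDerivAt.fun_sum fun a _ => (hX.hasGradientAt hθ s a).hasFDerivAt
  simp only [pmf_sum_toReal] at h1
  have h2 := h1.unique (hasFDerivAt_const (1 : ℝ) θ)
  rw [← map_sum] at h2
  exact (map_eq_zero_iff _ (InnerProductSpace.toDual ℝ (Param d)).injective).1 h2

/-- In the performance difference identity the stationary law of θ' multiplies a factor that
vanishes at θ' = θ. The product rule for a merely continuous factor applies, and the stationary law
need not be differentiated. -/
theorem CMDP.Ergodic.gradient_objective {M : CMDP S A} (hM : M.Ergodic)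
    {X : Approximator S A d m} {Θ : Set (Param d)} {G₁ G₂ : ℝ} (hX : ScoreBounds X Θ G₁ G₂)
    (g : Signal) {θ : Param d} (hθ : θ ∈ Θ) :
    gradient (objective M X g) θ = ∑ s, M.stat (X.π θ) s •
      ∑ a, (X.π θ s a).toReal • (M.Q g (X.π θ) s a • score X θ s a) := by
  have hobj : objective M X g = fun θ' => objective M X g θ +
      ∑ s, M.stat (X.π θ') s *
        ∑ a, ((X.π θ' s a).toReal - (X.π θ s a).toReal) * M.Q g (X.π θ) s a := by
    funext θ'
    rw [← hM.J_sub_J]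
    simp [objective]
  have hgr : HasFDerivAt (objective M X g) (∑ s, M.stat (X.π θ) s •
      ∑ a, M.Q g (X.π θ) s a •
        InnerProductSpace.toDual ℝ (Param d) ((X.π θ s a).toReal • score X θ s a)) θ := by
    rw [hobj]
    refine HasFDerivAt.const_add _ (HasFDerivAt.fun_sum fun s _ => ?_)
    refine hasFDerivAt_mul_of_continuousAt (hM.continuousAt_stat X
      (fun s a => (hX.diff θ hθ s a).continuousAt) s) ?_ (by simp)
    exact HasFDerivAt.fun_sum fun a _ =>
      (((hX.hasGradientAt hθ s a).hasFDerivAt).sub_const _).mul_const _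
  have : HasGradientAt (objective M X g) (∑ s, M.stat (X.π θ) s •
      ∑ a, (X.π θ s a).toReal • (M.Q g (X.π θ) s a • score X θ s a)) θ := by
    rw [hasGradientAt_iff_hasFDerivAt]
    refine hgr.congr_fderiv (ContinuousLinearMap.ext fun v => ?_)
    simp only [InnerProductSpace.toDual_apply_apply, sum_inner, real_inner_smul_left, sum_apply,
      smul_apply, smul_eq_mul]
    refine Finset.sum_congr rfl fun s _ => ?_
    congr 1
    exact Finset.sum_congr rfl fun a _ => mul_left_comm _ _ _
  exact this.gradient

/-- The policy gradient as a stationary expectation over transitions. -/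
theorem CMDP.Ergodic.gradient_objective_eq_statExp {M : CMDP S A} (hM : M.Ergodic)
    {X : Approximator S A d m} {Θ : Set (Param d)} {G₁ G₂ : ℝ} (hX : ScoreBounds X Θ G₁ G₂)
    (g : Signal) {θ : Param d} (hθ : θ ∈ Θ) :
    gradient (objective M X g) θ = M.statExp (X.π θ) fun z =>
      (M.signal g z.1 z.2.1 - M.J g (X.π θ) + M.V g (X.π θ) z.2.2) • score X θ z.1 z.2.1 := by
  rw [hM.gradient_objective hX g hθ]
  simp only [CMDP.statExp, Finset.smul_sum, smul_smul]
  refine Finset.sum_congr rfl fun s _ => Finset.sum_congr rfl fun a _ => ?_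
  rw [← Finset.sum_smul, hM.Q_eq]
  congr 1
  have h : M.signal g s a - M.J g (X.π θ) =
      ∑ s', (M.P s a s').toReal * (M.signal g s a - M.J g (X.π θ)) := by
    rw [← Finset.sum_mul, pmf_sum_toReal, one_mul]
  rw [h, ← Finset.sum_add_distrib, Finset.mul_sum, Finset.mul_sum, ← h]
  exact Finset.sum_congr rfl fun s' _ => by ring

/-- A baseline, that is a function of the current state only, is invisible to the policy gradient.
-/
theorem CMDP.statExp_smul_score (M : CMDP S A) {X : Approximator S A d m} {Θ : Set (Param d)}
    {G₁ G₂ : ℝ} (hX : ScoreBounds X Θ G₁ G₂) {θ : Param d} (hθ : θ ∈ Θ) (w : S → ℝ) :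
    M.statExp (X.π θ) (fun z => w z.1 • score X θ z.1 z.2.1) = 0 := by
  rw [M.statExp_fst (X.π θ) fun s a => w s • score X θ s a]
  refine Finset.sum_eq_zero fun s _ => ?_
  have : ∑ a, (X.π θ s a).toReal • (w s • score X θ s a) =
      w s • ∑ a, (X.π θ s a).toReal • score X θ s a := by
    rw [Finset.smul_sum]
    exact Finset.sum_congr rfl fun a _ => smul_comm _ _ _
  rw [this, hX.sum_smul_score hθ s, smul_zero, smul_zero]

/-- The constant 5 covers 1 + 1 + (8/3) τ, from the signal, its average and the value function, as τ
≥ 1. -/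
theorem CMDP.Ergodic.norm_gradient_objective_le {M : CMDP S A} (hM : M.Ergodic)
    {X : Approximator S A d m} {Θ : Set (Param d)} {G₁ G₂ : ℝ} (hX : ScoreBounds X Θ G₁ G₂)
    (g : Signal) {θ : Param d} (hθ : θ ∈ Θ) :
    ‖gradient (objective M X g) θ‖ ≤ 5 * M.mixTimeOf (X.π θ) * G₁ := by
  rw [hM.gradient_objective_eq_statExp hX g hθ]
  refine M.norm_statExp_le _ fun z => ?_
  rw [norm_smul]
  refine mul_le_mul ?_ (hX.bound θ hθ _ _) (norm_nonneg _) (by positivity)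
  have h1 := M.abs_signal_le g z.1 z.2.1
  have h2 := hM.abs_J_le g (X.π θ)
  have h3 := hM.abs_V_le g (X.π θ) z.2.2
  have h4 : (1 : ℝ) ≤ M.mixTimeOf (X.π θ) := by exact_mod_cast (hM.mixTimeOf_spec (X.π θ)).1
  rw [Real.norm_eq_abs]
  rw [abs_le] at *
  constructor <;> linarith [h1.1, h1.2, h2.1, h2.2, h3.1, h3.2]

end PolicyGradient

/-! ### Fisher matrix and natural gradient -/

section Fisher

variable {S A : Type*} [Fintype S] [DecidableEq S] [Fintype A] {d m : ℕ}

theorem toEuclideanLin_vecMulVec {k l : Type*} [Fintype k] [Fintype l] [DecidableEq l]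
    (u : EuclideanSpace ℝ k) (v x : EuclideanSpace ℝ l) :
    Matrix.toEuclideanLin (Matrix.vecMulVec u.ofLp v.ofLp) x = inner ℝ v x • u := by
  ext i
  simp only [Matrix.toLpLin_apply, Matrix.vecMulVec_mulVec, PiLp.smul_apply,
    EuclideanSpace.inner_eq_star_dotProduct]
  simp [dotProduct_comm, mul_comm]

theorem fisherSample_apply (X : Approximator S A d m) (θ : Param d) (z : S × A × S)
    (x : Param d) : Matrix.toEuclideanLin (fisherSample X θ z) x =
      inner ℝ (score X θ z.1 z.2.1) x • score X θ z.1 z.2.1 :=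
  toEuclideanLin_vecMulVec _ _ _

theorem fisher_apply (M : CMDP S A) (X : Approximator S A d m) (θ x : Param d) :
    Matrix.toEuclideanLin (fisher M X θ) x =
      M.statExp (X.π θ) fun z => Matrix.toEuclideanLin (fisherSample X θ z) x :=
  M.map_statExp (X.π θ)
    ((LinearMap.applyₗ x).comp (Matrix.toEuclideanLin (𝕜 := ℝ) (m := Fin d)
      (n := Fin d)).toLinearMap) (fisherSample X θ)

theorem inner_fisher (M : CMDP S A) (X : Approximator S A d m) (θ x : Param d) :
    inner ℝ x (Matrix.toEuclideanLin (fisher M X θ) x) =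
      M.statExp (X.π θ) fun z => inner ℝ (score X θ z.1 z.2.1) x ^ 2 := by
  rw [fisher_apply]
  have := M.map_statExp (X.π θ) (innerSL ℝ x).toLinearMap
    fun z => Matrix.toEuclideanLin (fisherSample X θ z) x
  simp only [ContinuousLinearMap.coe_coe, innerSL_apply_apply] at this
  rw [this]
  congr 1
  funext z
  rw [fisherSample_apply, inner_smul_right, real_inner_comm, sq]

theorem FisherNondegenerate.le_inner {M : CMDP S A} {X : Approximator S A d m}
    {Θ : Set (Param d)} {μ : ℝ} (hF : FisherNondegenerate M X Θ μ) {θ : Param d} (hθ : θ ∈ Θ)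
    (x : Param d) : μ * ‖x‖ ^ 2 ≤ inner ℝ x (Matrix.toEuclideanLin (fisher M X θ) x) := by
  have h := (hF θ hθ).dotProduct_mulVec_nonneg x.ofLp
  have h1 : inner ℝ x (Matrix.toEuclideanLin (fisher M X θ) x) =
      x.ofLp ⬝ᵥ (fisher M X θ *ᵥ x.ofLp) := by
    rw [EuclideanSpace.inner_eq_star_dotProduct, dotProduct_comm]
    simp
  have h2 : ‖x‖ ^ 2 = x.ofLp ⬝ᵥ x.ofLp := by
    rw [EuclideanSpace.norm_sq_eq]
    simp [dotProduct, sq]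
  rw [h1, h2]
  rw [Matrix.sub_mulVec, dotProduct_sub, Matrix.smul_mulVec, Matrix.one_mulVec,
    dotProduct_smul] at h
  simpa using h

theorem FisherNondegenerate.isUnit_det {M : CMDP S A} {X : Approximator S A d m}
    {Θ : Set (Param d)} {μ : ℝ} (hμ : 0 < μ) (hF : FisherNondegenerate M X Θ μ) {θ : Param d}
    (hθ : θ ∈ Θ) : IsUnit (fisher M X θ).det := by
  rw [isUnit_iff_ne_zero]
  intro h
  obtain ⟨v, hv, h0⟩ := Matrix.exists_mulVec_eq_zero_iff.2 h
  have h1 := hF.le_inner hθ (WithLp.toLp 2 v)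
  have h2 : Matrix.toEuclideanLin (fisher M X θ) (WithLp.toLp 2 v) = 0 := by
    rw [Matrix.toLpLin_apply]
    simp [h0]
  rw [h2, inner_zero_right] at h1
  have h3 : ‖WithLp.toLp 2 v‖ ^ 2 ≤ 0 := by
    by_contra h4
    push Not at h4
    nlinarith
  have h4 : WithLp.toLp 2 v = 0 := norm_eq_zero.1 (by nlinarith [norm_nonneg (WithLp.toLp 2 v)])
  exact hv (by simpa using h4)

theorem toEuclideanLin_mul_inv_apply {k : Type*} [Fintype k] [DecidableEq k]
    {B : Matrix k k ℝ} (hB : IsUnit B.det) (x : EuclideanSpace ℝ k) :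
    Matrix.toEuclideanLin B (Matrix.toEuclideanLin B⁻¹ x) = x := by
  simp [Matrix.toLpLin_apply, Matrix.mulVec_mulVec, Matrix.mul_nonsing_inv B hB]

theorem fisher_npgDir {M : CMDP S A} {X : Approximator S A d m}
    {Θ : Set (Param d)} {μ : ℝ} (hμ : 0 < μ) (hF : FisherNondegenerate M X Θ μ) {θ : Param d}
    (hθ : θ ∈ Θ) (g : Signal) :
    Matrix.toEuclideanLin (fisher M X θ) (npgDir M X g θ) = gradient (objective M X g) θ :=
  toEuclideanLin_mul_inv_apply (hF.isUnit_det hμ hθ) _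

/-- Coercivity of F at ω^* gives μ‖ω^*‖² ≤ ⟨ω^*, ∇J⟩, and one factor ‖ω^*‖ cancels. -/
theorem CMDP.Ergodic.norm_npgDir_le {M : CMDP S A} (hM : M.Ergodic) {X : Approximator S A d m}
    {Θ : Set (Param d)} {μ G₁ G₂ : ℝ} (hμ : 0 < μ) (hF : FisherNondegenerate M X Θ μ)
    (hX : ScoreBounds X Θ G₁ G₂) {θ : Param d} (hθ : θ ∈ Θ) (g : Signal) :
    ‖npgDir M X g θ‖ ≤ 5 * M.mixTimeOf (X.π θ) * G₁ / μ := by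
  rw [le_div_iff₀ hμ]
  have h1 := hF.le_inner hθ (npgDir M X g θ)
  rw [fisher_npgDir hμ hF hθ] at h1
  have h2 := (h1.trans (real_inner_le_norm _ _)).trans
    (mul_le_mul_of_nonneg_left (hM.norm_gradient_objective_le hX g hθ) (norm_nonneg _))
  rcases (norm_nonneg (npgDir M X g θ)).eq_or_lt with h0 | h0
  · rw [← h0, zero_mul]
    exact (norm_nonneg _).trans (hM.norm_gradient_objective_le hX g hθ)
  · exact le_of_mul_le_mul_left (by linarith) h0

/-- Jensen's inequality reduces this to one sample, where ‖⟨u, x⟩u‖² ≤ G₁²⟨u, x⟩². It is the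
cocoercivity that makes I − γF a contraction for small γ. -/
theorem norm_fisher_sq_le (M : CMDP S A) {X : Approximator S A d m}
    {Θ : Set (Param d)} {G₁ G₂ : ℝ} (hX : ScoreBounds X Θ G₁ G₂) {θ : Param d} (hθ : θ ∈ Θ)
    (x : Param d) : ‖Matrix.toEuclideanLin (fisher M X θ) x‖ ^ 2 ≤
      G₁ ^ 2 * inner ℝ x (Matrix.toEuclideanLin (fisher M X θ) x) := by
  rw [inner_fisher, fisher_apply]
  refine (M.norm_statExp_sq_le _ _).trans ?_
  have := M.map_statExp (X.π θ) (LinearMap.mulLeft ℝ (G₁ ^ 2))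
    fun z => inner ℝ (score X θ z.1 z.2.1) x ^ 2
  simp only [LinearMap.mulLeft_apply] at this
  rw [this]
  refine M.statExp_mono _ fun z => ?_
  rw [fisherSample_apply, norm_smul, mul_pow, Real.norm_eq_abs, sq_abs, mul_comm]
  exact mul_le_mul_of_nonneg_right
    (pow_le_pow_left₀ (norm_nonneg _) (hX.bound θ hθ _ _) 2) (sq_nonneg _)

theorem norm_fisher_le (M : CMDP S A) {X : Approximator S A d m}
    {Θ : Set (Param d)} {G₁ G₂ : ℝ} (hX : ScoreBounds X Θ G₁ G₂) {θ : Param d} (hθ : θ ∈ Θ)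
    (x : Param d) : ‖Matrix.toEuclideanLin (fisher M X θ) x‖ ≤ G₁ ^ 2 * ‖x‖ := by
  rw [fisher_apply]
  refine M.norm_statExp_le _ fun z => ?_
  rw [fisherSample_apply, norm_smul, sq]
  have h1 := hX.bound θ hθ z.1 z.2.1
  have h2 := norm_inner_le_norm (𝕜 := ℝ) (score X θ z.1 z.2.1) x
  have h3 := norm_nonneg (score X θ z.1 z.2.1)
  calc _ ≤ (‖score X θ z.1 z.2.1‖ * ‖x‖) * ‖score X θ z.1 z.2.1‖ := by gcongr
    _ ≤ (G₁ * ‖x‖) * G₁ := by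
      have := h3.trans h1
      gcongr
    _ = _ := by ring

end Fisher

/-! ### Critic fixed point -/

section Critic

variable {S A : Type*} [Fintype S] [DecidableEq S] [Fintype A] {d m : ℕ}

theorem zetaPart_add (ξ ξ' : CriticVec m) : zetaPart (ξ + ξ') = zetaPart ξ + zetaPart ξ' := rfl

theorem zetaPart_smul (c : ℝ) (ξ : CriticVec m) : zetaPart (c • ξ) = c • zetaPart ξ := rfl

theorem norm_zetaPart_le (ξ : CriticVec m) : ‖zetaPart ξ‖ ≤ ‖ξ‖ := by
  refine (abs_le_of_sq_le_sq' ?_ (norm_nonneg _)).2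
  rw [EuclideanSpace.norm_sq_eq, EuclideanSpace.norm_sq_eq, Fintype.sum_sum_type]
  simp only [zetaPart]
  exact le_add_of_nonneg_left (by positivity)

theorem zetaPart_sub (ξ ξ' : CriticVec m) : zetaPart (ξ - ξ') = zetaPart ξ - zetaPart ξ' := rfl

theorem statExp_criticMatSample (M : CMDP S A) (X : Approximator S A d m) (cγ : ℝ) (g : Signal)
    (π : S → PMF A) :
    M.statExp π (criticMatSample X cγ g) =
      Matrix.fromBlocks (Matrix.of fun _ _ => cγ) 0
        (Matrix.of fun i _ => M.statExp π (fun z => X.φ g z.1) i)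
        (M.statExp π (tdSample X g)) := by
  have h := fun i j => M.map_statExp π
    (Matrix.entryLinearMap ℝ ℝ i j) (criticMatSample X cγ g)
  simp only [Matrix.entryLinearMap_apply] at h
  ext i j
  rw [h]
  rcases i with i | i <;> rcases j with j | j
  · simp only [criticMatSample, Matrix.fromBlocks_apply₁₁, Matrix.of_apply]
    exact M.statExp_const π cγ
  · simp only [criticMatSample, Matrix.fromBlocks_apply₁₂, Matrix.zero_apply]
    exact M.statExp_const π 0
  · simp only [criticMatSample, Matrix.fromBlocks_apply₂₁, Matrix.of_apply]
    exact (M.map_statExp π (EuclideanSpace.projₗ i : EuclideanSpace ℝ (Fin m) →ₗ[ℝ] ℝ)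
      fun z => X.φ g z.1).symm
  · simp only [criticMatSample, Matrix.fromBlocks_apply₂₂]
    exact (M.map_statExp π (Matrix.entryLinearMap ℝ ℝ i j) (tdSample X g)).symm

theorem CriticPositive.isUnit_det {M : CMDP S A} {X : Approximator S A d m} {Θ : Set (Param d)}
    {lam : ℝ} (hlam : 0 < lam) (hC : CriticPositive M X Θ lam) {θ : Param d} (hθ : θ ∈ Θ)
    {cγ : ℝ} (hc : 0 < cγ) (g : Signal) :
    IsUnit (M.statExp (X.π θ) (criticMatSample X cγ g)).det := by
  rw [statExp_criticMatSample, Matrix.det_fromBlocks_zero₁₂, isUnit_iff_ne_zero]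
  refine mul_ne_zero (by simpa using hc.ne') fun h => ?_
  obtain ⟨v, hv, h0⟩ := Matrix.exists_mulVec_eq_zero_iff.2 h
  have h1 := hC θ hθ g (WithLp.toLp 2 v)
  rw [h0, dotProduct_zero] at h1
  have h2 : 0 < ‖WithLp.toLp 2 v‖ := norm_pos_iff.2 (by simpa using hv)
  have := mul_pos hlam (pow_pos h2 2)
  linarith

/-- The system is block lower triangular. Its first row forces η = J; the second then reads T ζ = r
− J φ̄ with a right-hand side of norm at most 2, and coercivity of T gives the bound on ζ. -/
theorem criticOpt_spec {M : CMDP S A} (hM : M.Ergodic) {X : Approximator S A d m}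
    {Θ : Set (Param d)} {lam : ℝ} (hlam : 0 < lam) (hC : CriticPositive M X Θ lam)
    {θ : Param d} (hθ : θ ∈ Θ) {cγ : ℝ} (hc : 0 < cγ) (g : Signal) :
    criticOpt M X cγ g θ (Sum.inl ()) = M.J g (X.π θ) ∧
      ‖zetaPart (criticOpt M X cγ g θ)‖ ≤ 2 / lam := by
  set ξ := criticOpt M X cγ g θ with hξ
  have h1 : Matrix.toEuclideanLin (M.statExp (X.π θ) (criticMatSample X cγ g)) ξ =
      M.statExp (X.π θ) (criticVecSample M X cγ g) :=
    toEuclideanLin_mul_inv_apply (hC.isUnit_det hlam hθ hc g) _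
  have hb := fun i => M.map_statExp (X.π θ)
    (EuclideanSpace.projₗ i : CriticVec m →ₗ[ℝ] ℝ) (criticVecSample M X cγ g)
  have hcoord : ∀ i, ∑ j, M.statExp (X.π θ) (criticMatSample X cγ g) i j * ξ j =
      M.statExp (X.π θ) (criticVecSample M X cγ g) i := by
    intro i
    rw [← h1]
    simp [Matrix.toLpLin_apply, Matrix.mulVec, dotProduct]
  have hinl : ξ (Sum.inl ()) = M.J g (X.π θ) := by
    have h2 := hcoord (Sum.inl ())
    have h3 : M.statExp (X.π θ) (criticVecSample M X cγ g) (Sum.inl ()) =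
        M.statExp (X.π θ) fun z => cγ * M.signal g z.1 z.2.1 := hb (Sum.inl ())
    simp only [statExp_criticMatSample, Fintype.sum_sum_type, Matrix.fromBlocks_apply₁₁,
      Matrix.fromBlocks_apply₁₂, Matrix.of_apply, Matrix.zero_apply, zero_mul,
      Finset.sum_const_zero, add_zero, Finset.univ_unique, Finset.sum_singleton] at h2
    have h4 : M.statExp (X.π θ) (fun z => cγ * M.signal g z.1 z.2.1) =
        cγ * M.J g (X.π θ) := by
      have := M.map_statExp (X.π θ) (LinearMap.mulLeft ℝ cγ) fun z => M.signal g z.1 z.2.1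
      simp only [LinearMap.mulLeft_apply] at this
      rw [← this, M.statExp_fst (X.π θ) fun s a => M.signal g s a, hM.J_eq]
      rfl
    rw [h4] at h3
    exact mul_left_cancel₀ hc.ne' (h2.trans h3)
  refine ⟨hinl, ?_⟩
  set φb := M.statExp (X.π θ) (fun z => X.φ g z.1)
  set r := M.statExp (X.π θ) (fun z => M.signal g z.1 z.2.1 • X.φ g z.1)
  have hT : M.statExp (X.π θ) (tdSample X g) *ᵥ (zetaPart ξ).ofLp =
      (r - M.J g (X.π θ) • φb).ofLp := by
    ext i
    have h2 := hcoord (Sum.inr i)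
    have h3 : M.statExp (X.π θ) (criticVecSample M X cγ g) (Sum.inr i) =
        M.statExp (X.π θ) fun z => M.signal g z.1 z.2.1 * X.φ g z.1 i := hb (Sum.inr i)
    have h5 : r i = M.statExp (X.π θ) fun z => M.signal g z.1 z.2.1 * X.φ g z.1 i := M.map_statExp (X.π θ)
      (EuclideanSpace.projₗ i : EuclideanSpace ℝ (Fin m) →ₗ[ℝ] ℝ)
      (fun z => M.signal g z.1 z.2.1 • X.φ g z.1)
    simp only [statExp_criticMatSample, Fintype.sum_sum_type, Matrix.fromBlocks_apply₂₁,
      Matrix.fromBlocks_apply₂₂, Matrix.of_apply,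
      Finset.univ_unique, Finset.sum_singleton] at h2
    have h6 : (M.statExp (X.π θ) (tdSample X g) *ᵥ (zetaPart ξ).ofLp) i =
      ∑ j, M.statExp (X.π θ) (tdSample X g) i j * ξ (Sum.inr j) := rfl
    rw [h6]
    simp only [PiLp.sub_apply, PiLp.smul_apply, smul_eq_mul]
    rw [← hinl]
    rw [h3, ← h5] at h2
    have h8 : ξ (Sum.inl default) = ξ (Sum.inl ()) := rfl
    rw [h8] at h2
    linarith
  have h2 := hC θ hθ g (zetaPart ξ)
  rw [hT] at h2
  have h3 : (zetaPart ξ).ofLp ⬝ᵥ (r - M.J g (X.π θ) • φb).ofLp =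
      inner ℝ (zetaPart ξ) (r - M.J g (X.π θ) • φb) := by
    rw [EuclideanSpace.inner_eq_star_dotProduct, dotProduct_comm]
    simp
  rw [h3] at h2
  have hφb : ‖φb‖ ≤ 1 := M.norm_statExp_le _ fun z => X.φ_norm_le g z.1
  have hr : ‖r‖ ≤ 1 := M.norm_statExp_le _ fun z => by
    rw [norm_smul]
    exact mul_le_one₀ (M.abs_signal_le g _ _) (norm_nonneg _) (X.φ_norm_le g z.1)
  have h4 : ‖r - M.J g (X.π θ) • φb‖ ≤ 2 := by
    refine (norm_sub_le _ _).trans ?_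
    rw [norm_smul]
    have := mul_le_one₀ (hM.abs_J_le g (X.π θ)) (norm_nonneg _) hφb
    rw [Real.norm_eq_abs]
    linarith
  have h5 := (h2.trans (real_inner_le_norm _ _)).trans
    (mul_le_mul_of_nonneg_left h4 (norm_nonneg _))
  rw [le_div_iff₀ hlam]
  rcases (norm_nonneg (zetaPart ξ)).eq_or_lt with h0 | h0
  · rw [← h0, zero_mul]; norm_num
  · exact le_of_mul_le_mul_left (by linarith) h0

end Critic

/-! ### Drift of the actor recursion at the natural gradient -/

section Drift

variable {S A : Type*} [Fintype S] [DecidableEq S] [Fintype A] {d m : ℕ}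

/-- The sampled actor direction at the natural gradient, `F̂(z) ω^* - ∇̂J_g(ξ; z)`. -/
def drift (M : CMDP S A) (X : Approximator S A d m) (g : Signal) (θ : Param d)
    (ξ : CriticVec m) (z : S × A × S) : Param d :=
  Matrix.toEuclideanLin (fisherSample X θ z) (npgDir M X g θ) - gradSample M X g θ ξ z

/-- The stationary expectation of the drift. -/
def meanDrift (M : CMDP S A) (X : Approximator S A d m) (g : Signal) (θ : Param d)
    (ξ : CriticVec m) : Param d :=
  M.statExp (X.π θ) (drift M X g θ ξ)

/-- The hypotheses on the model and the approximator at a fixed parameter `θ`. -/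
structure Regular (M : CMDP S A) (X : Approximator S A d m) (Θ : Set (Param d))
    (G₁ G₂ μ lam : ℝ) (θ : Param d) : Prop where
  ergodic : M.Ergodic
  scoreBounds : ScoreBounds X Θ G₁ G₂
  nondeg : FisherNondegenerate M X Θ μ
  criticPos : CriticPositive M X Θ lam
  mem : θ ∈ Θ
  G₁_pos : 0 < G₁
  μ_pos : 0 < μ
  lam_pos : 0 < lam

variable {M : CMDP S A} {X : Approximator S A d m} {Θ : Set (Param d)} {G₁ G₂ μ lam : ℝ}
  {θ : Param d}

/-- Since Fω^* = ∇J, the policy gradient formula can be subtracted sample by sample. The signals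
cancel, the terms η − J + ζᵀφ(s) form a baseline with zero mean, and only the critic error at the
next state survives. -/
theorem Regular.meanDrift_eq (h : Regular M X Θ G₁ G₂ μ lam θ) (g : Signal) (ξ : CriticVec m) :
    meanDrift M X g θ ξ = M.statExp (X.π θ) fun z =>
      (M.V g (X.π θ) z.2.2 - inner ℝ (zetaPart ξ) (X.φ g z.2.2)) • score X θ z.1 z.2.1 := by
  have h1 : meanDrift M X g θ ξ =
      gradient (objective M X g) θ - M.statExp (X.π θ) (gradSample M X g θ ξ) := by
    rw [meanDrift, ← fisher_npgDir h.μ_pos h.nondeg h.mem, fisher_apply, ← M.statExp_sub]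
    rfl
  rw [h1, h.ergodic.gradient_objective_eq_statExp h.scoreBounds g h.mem, ← M.statExp_sub,
    ← sub_eq_zero, ← M.statExp_sub,
    ← M.statExp_smul_score h.scoreBounds h.mem
      fun s => ξ (Sum.inl ()) - M.J g (X.π θ) + inner ℝ (zetaPart ξ) (X.φ g s)]
  congr 1
  funext z
  simp only [gradSample, ← sub_smul, inner_sub_right]
  congr 1
  ring

/-- Affinity lets the expectation over the critic samples pass inside; this yields the bias of ξ,
not its mean square error, in the bias bound. -/
theorem Regular.exists_meanDrift_affine (h : Regular M X Θ G₁ G₂ μ lam θ) (g : Signal) :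
    ∃ (a : Param d) (T : CriticVec m →L[ℝ] Param d), ∀ ξ, meanDrift M X g θ ξ = a - T ξ := by
  let T : CriticVec m →ₗ[ℝ] Param d :=
    { toFun := fun ξ => M.statExp (X.π θ) fun z =>
        inner ℝ (zetaPart ξ) (X.φ g z.2.2) • score X θ z.1 z.2.1
      map_add' := fun ξ ξ' => by
        rw [← M.statExp_add]
        simp only [zetaPart_add, inner_add_left, add_smul]
      map_smul' := fun c ξ => by
        have := M.map_statExp (X.π θ) (LinearMap.lsmul ℝ (Param d) c) fun z =>
          inner ℝ (zetaPart ξ) (X.φ g z.2.2) • score X θ z.1 z.2.1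
        simp only [LinearMap.lsmul_apply] at this
        rw [RingHom.id_apply, this]
        simp only [zetaPart_smul, real_inner_smul_left, mul_smul] }
  refine ⟨M.statExp (X.π θ) fun z => M.V g (X.π θ) z.2.2 • score X θ z.1 z.2.1,
    LinearMap.toContinuousLinearMap T, fun ξ => ?_⟩
  rw [h.meanDrift_eq g ξ]
  simp only [sub_smul, M.statExp_sub]
  rfl

/-- At ξ^* the error at the next state has mean square `criticErrorAt` by stationarity; moving from
ξ^* to ξ changes the mean drift by at most G₁‖ξ − ξ^*‖. -/
theorem Regular.norm_meanDrift_le (h : Regular M X Θ G₁ G₂ μ lam θ) (g : Signal) (cγ : ℝ)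
    (ξ : CriticVec m) :
    ‖meanDrift M X g θ ξ‖ ≤
      G₁ * (√(criticErrorAt M X cγ g θ) + ‖ξ - criticOpt M X cγ g θ‖) := by
  set ξs := criticOpt M X cγ g θ
  have hG := h.G₁_pos
  have h1 : meanDrift M X g θ ξ = meanDrift M X g θ ξs -
      M.statExp (X.π θ) fun z =>
        inner ℝ (zetaPart (ξ - ξs)) (X.φ g z.2.2) • score X θ z.1 z.2.1 := by
    rw [h.meanDrift_eq g ξ, h.meanDrift_eq g ξs, ← M.statExp_sub]
    congr 1
    funext z
    rw [← sub_smul, zetaPart_sub, inner_sub_left]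
    congr 1
    ring
  have h2 : ‖meanDrift M X g θ ξs‖ ≤ G₁ * √(criticErrorAt M X cγ g θ) := by
    rw [h.meanDrift_eq g ξs]
    refine abs_le_of_sq_le_sq' ?_ (by positivity) |>.2
    have hE : criticErrorAt M X cγ g θ = M.statExp (X.π θ) fun z =>
        (M.V g (X.π θ) z.2.2 - inner ℝ (zetaPart ξs) (X.φ g z.2.2)) ^ 2 := by
      rw [M.statExp_next (X.π θ) fun s =>
        (M.V g (X.π θ) s - inner ℝ (zetaPart ξs) (X.φ g s)) ^ 2]
      refine Finset.sum_congr rfl fun s _ => ?_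
      congr 1
      ring
    have hE0 : 0 ≤ criticErrorAt M X cγ g θ :=
      Finset.sum_nonneg fun s _ => mul_nonneg ((M.stat_spec _).1 s) (sq_nonneg _)
    rw [mul_pow, Real.sq_sqrt hE0, hE]
    refine (M.norm_statExp_sq_le _ _).trans ?_
    have := M.map_statExp (X.π θ) (LinearMap.mulLeft ℝ (G₁ ^ 2)) fun z =>
      (M.V g (X.π θ) z.2.2 - inner ℝ (zetaPart ξs) (X.φ g z.2.2)) ^ 2
    simp only [LinearMap.mulLeft_apply] at this
    rw [this]
    refine M.statExp_mono _ fun z => ?_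
    rw [norm_smul, mul_pow, Real.norm_eq_abs, sq_abs, mul_comm]
    exact mul_le_mul_of_nonneg_right
      (pow_le_pow_left₀ (norm_nonneg _) (h.scoreBounds.bound θ h.mem _ _) 2) (sq_nonneg _)
  have h3 : ‖M.statExp (X.π θ) fun z =>
        inner ℝ (zetaPart (ξ - ξs)) (X.φ g z.2.2) • score X θ z.1 z.2.1‖ ≤
      G₁ * ‖ξ - ξs‖ := by
    refine M.norm_statExp_le _ fun z => ?_
    rw [norm_smul, mul_comm]
    refine mul_le_mul (h.scoreBounds.bound θ h.mem _ _) ?_ (norm_nonneg _) hG.le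
    refine (norm_inner_le_norm _ _).trans ?_
    refine (mul_le_mul (norm_zetaPart_le _) (X.φ_norm_le g _) (norm_nonneg _)
      (norm_nonneg _)).trans_eq (mul_one _)
  rw [h1]
  refine (norm_sub_le _ _).trans ?_
  rw [mul_add]
  exact add_le_add h2 h3

theorem Regular.norm_npgDir_le (h : Regular M X Θ G₁ G₂ μ lam θ) (g : Signal) :
    ‖npgDir M X g θ‖ ≤ 5 * G₁ / μ * mixTime M X Θ := by
  refine (h.ergodic.norm_npgDir_le h.μ_pos h.nondeg h.scoreBounds h.mem g).trans ?_
  have h1 : (M.mixTimeOf (X.π θ) : ℝ) ≤ mixTime M X Θ := by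
    exact_mod_cast h.ergodic.mixTimeOf_le_mixTime X h.mem
  have hG := h.G₁_pos
  have hμ := h.μ_pos
  calc 5 * (M.mixTimeOf (X.π θ) : ℝ) * G₁ / μ = 5 * G₁ / μ * M.mixTimeOf (X.π θ) := by ring
    _ ≤ _ := by gcongr

theorem Regular.one_le_mixTime (h : Regular M X Θ G₁ G₂ μ lam θ) :
    (1 : ℝ) ≤ mixTime M X Θ := by
  exact_mod_cast (h.ergodic.mixTimeOf_spec (X.π θ)).1.trans
    (h.ergodic.mixTimeOf_le_mixTime X h.mem)

/-- The Fisher part costs G₁² ‖ω^*‖. In the temporal difference, the signal and η give 2 + y and the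
feature term gives 2(2/λ + y), where y = ‖ξ − ξ^*‖; hence the 3 y. -/
theorem Regular.norm_drift_le (h : Regular M X Θ G₁ G₂ μ lam θ) (g : Signal) {cγ : ℝ}
    (hc : 0 < cγ) (ξ : CriticVec m) (z : S × A × S) :
    ‖drift M X g θ ξ z‖ ≤ (5 * G₁ ^ 3 / μ + G₁ * (2 + 4 / lam)) * mixTime M X Θ +
      3 * G₁ * ‖ξ - criticOpt M X cγ g θ‖ := by
  set ξs := criticOpt M X cγ g θ
  obtain ⟨hη, hζ⟩ := criticOpt_spec h.ergodic h.lam_pos h.criticPos h.mem hc g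
  have hG := h.G₁_pos
  have hμ := h.μ_pos
  have hl := h.lam_pos
  have hτ := h.one_le_mixTime
  have hs := h.scoreBounds.bound θ h.mem z.1 z.2.1
  have h1 : ‖Matrix.toEuclideanLin (fisherSample X θ z) (npgDir M X g θ)‖ ≤
      5 * G₁ ^ 3 / μ * mixTime M X Θ := by
    rw [fisherSample_apply, norm_smul]
    have h2 := norm_inner_le_norm (𝕜 := ℝ) (score X θ z.1 z.2.1) (npgDir M X g θ)
    calc _ ≤ (‖score X θ z.1 z.2.1‖ * ‖npgDir M X g θ‖) *
          ‖score X θ z.1 z.2.1‖ := by gcongr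
      _ ≤ (G₁ * (5 * G₁ / μ * mixTime M X Θ)) * G₁ := by
          gcongr
          exact h.norm_npgDir_le g
      _ = _ := by ring
  set y := ‖ξ - ξs‖
  have hy : 0 ≤ y := norm_nonneg _
  have h2 : ‖gradSample M X g θ ξ z‖ ≤ (2 + 4 / lam + 3 * y) * G₁ := by
    rw [gradSample, norm_smul]
    refine mul_le_mul ?_ hs (norm_nonneg _) (by positivity)
    have e1 := M.abs_signal_le g z.1 z.2.1
    have e2 : |ξ (Sum.inl ())| ≤ 1 + y := by
      have e3 : |(ξ - ξs) (Sum.inl ())| ≤ y := PiLp.norm_apply_le (ξ - ξs) (Sum.inl ())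
      have e4 : |ξs (Sum.inl ())| ≤ 1 := by rw [hη]; exact h.ergodic.abs_J_le g _
      have e5 : ξ (Sum.inl ()) = ξs (Sum.inl ()) + (ξ - ξs) (Sum.inl ()) := by simp
      rw [e5]
      exact (abs_add_le _ _).trans (add_le_add e4 e3)
    have e3 : ‖zetaPart ξ‖ ≤ 2 / lam + y := by
      have e4 : zetaPart ξ = zetaPart ξs + zetaPart (ξ - ξs) := by rw [zetaPart_sub]; abel
      rw [e4]
      exact (norm_add_le _ _).trans (add_le_add hζ (norm_zetaPart_le _))
    have e4 : ‖X.φ g z.2.2 - X.φ g z.1‖ ≤ 2 :=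
      (norm_sub_le _ _).trans (by linarith [X.φ_norm_le g z.2.2, X.φ_norm_le g z.1])
    have e5 : |inner ℝ (zetaPart ξ) (X.φ g z.2.2 - X.φ g z.1)| ≤ (2 / lam + y) * 2 :=
      (norm_inner_le_norm (𝕜 := ℝ) _ _).trans
        (mul_le_mul e3 e4 (norm_nonneg _) (by positivity))
    have e6 : (2 / lam + y) * 2 = 4 / lam + 2 * y := by ring
    rw [e6] at e5
    rw [Real.norm_eq_abs]
    refine (abs_add_le _ _).trans ?_
    have := abs_sub (M.signal g z.1 z.2.1) (ξ (Sum.inl ()))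
    linarith
  refine (norm_sub_le _ _).trans ((add_le_add h1 h2).trans ?_)
  have h3 : G₁ * (2 + 4 / lam) ≤ G₁ * (2 + 4 / lam) * mixTime M X Θ :=
    le_mul_of_one_le_right (by positivity) hτ
  linarith

end Drift

/-! ### Expectation under finitely supported laws -/

section Expectation

variable {α β E F : Type*} [NormedAddCommGroup E] [NormedSpace ℝ E] [NormedAddCommGroup F]
  [NormedSpace ℝ F]

/-- A probability mass function with finite support. -/
class FinSupp (p : PMF α) : Prop where
  finite : p.support.Finite

instance [Finite α] (p : PMF α) : FinSupp p := ⟨Set.toFinite _⟩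

instance (a : α) : FinSupp (PMF.pure a) := ⟨by rw [PMF.support_pure]; exact Set.finite_singleton a⟩

instance (p : PMF α) (q : α → PMF β) [hp : FinSupp p] [hq : ∀ a, FinSupp (q a)] :
    FinSupp (p.bind q) :=
  ⟨by rw [PMF.support_bind]; exact hp.finite.biUnion fun a _ => (hq a).finite⟩

instance (p : PMF α) (f : α → β) [hp : FinSupp p] : FinSupp (p.map f) :=
  ⟨by rw [PMF.support_map]; exact hp.finite.image f⟩

/-- The expectation of `f` under `p`. -/
def ex (p : PMF α) (f : α → E) : E := ∑' a, (p a).toReal • f a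

theorem ex_eq_sum (p : PMF α) (f : α → E) {t : Finset α} (ht : p.support ⊆ t) :
    ex p f = ∑ a ∈ t, (p a).toReal • f a := by
  refine tsum_eq_sum fun a ha => ?_
  have : p a = 0 := by
    rw [PMF.apply_eq_zero_iff]; exact fun h => ha (ht h)
  rw [this, ENNReal.toReal_zero, zero_smul]

theorem ex_fintype [Fintype α] (p : PMF α) (f : α → E) : ex p f = ∑ a, (p a).toReal • f a :=
  ex_eq_sum p f (by simp)

theorem sum_toReal_eq_one (p : PMF α) {t : Finset α} (ht : p.support ⊆ t) :
    ∑ a ∈ t, (p a).toReal = 1 := by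
  have h : ∑' a, p a = ∑ a ∈ t, p a := tsum_eq_sum fun a ha => by
    rw [PMF.apply_eq_zero_iff]; exact fun h => ha (ht h)
  rw [← ENNReal.toReal_sum fun a _ => p.apply_ne_top a, ← h, p.tsum_coe, ENNReal.toReal_one]

theorem FinSupp.exists_finset (p : PMF α) [hp : FinSupp p] :
    ∃ t : Finset α, ∀ a, a ∈ t ↔ a ∈ p.support :=
  ⟨hp.finite.toFinset, fun a => by simp⟩

theorem ex_congr (p : PMF α) {f g : α → E} (h : ∀ a ∈ p.support, f a = g a) : ex p f = ex p g := by
  refine tsum_congr fun a => ?_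
  by_cases ha : a ∈ p.support
  · rw [h a ha]
  · rw [← PMF.apply_eq_zero_iff] at ha
    rw [ha, ENNReal.toReal_zero, zero_smul, zero_smul]

variable (p : PMF α) [FinSupp p]

theorem ex_const (c : E) : ex p (fun _ => c) = c := by
  obtain ⟨t, ht⟩ := FinSupp.exists_finset p
  rw [ex_eq_sum p _ fun a ha => (ht a).2 ha, ← Finset.sum_smul,
    sum_toReal_eq_one p fun a ha => (ht a).2 ha, one_smul]

theorem ex_add (f g : α → E) : ex p (fun a => f a + g a) = ex p f + ex p g := by
  obtain ⟨t, ht⟩ := FinSupp.exists_finset p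
  simp only [fun f : α → E => ex_eq_sum p f fun a ha => (ht a).2 ha, smul_add,
    Finset.sum_add_distrib]

theorem ex_sub (f g : α → E) : ex p (fun a => f a - g a) = ex p f - ex p g := by
  obtain ⟨t, ht⟩ := FinSupp.exists_finset p
  simp only [fun f : α → E => ex_eq_sum p f fun a ha => (ht a).2 ha, smul_sub,
    Finset.sum_sub_distrib]

theorem ex_smul (c : ℝ) (f : α → E) : ex p (fun a => c • f a) = c • ex p f := by
  obtain ⟨t, ht⟩ := FinSupp.exists_finset p
  simp only [fun f : α → E => ex_eq_sum p f fun a ha => (ht a).2 ha, Finset.smul_sum]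
  exact Finset.sum_congr rfl fun a _ => smul_comm _ _ _

theorem ex_mul (c : ℝ) (f : α → ℝ) : ex p (fun a => c * f a) = c * ex p f := ex_smul p c f

theorem map_ex (T : E →ₗ[ℝ] F) (f : α → E) : T (ex p f) = ex p fun a => T (f a) := by
  obtain ⟨t, ht⟩ := FinSupp.exists_finset p
  rw [ex_eq_sum p _ fun a ha => (ht a).2 ha, ex_eq_sum p _ fun a ha => (ht a).2 ha, map_sum]
  exact Finset.sum_congr rfl fun a _ => map_smul _ _ _

theorem ex_mono {f g : α → ℝ} (h : ∀ a ∈ p.support, f a ≤ g a) : ex p f ≤ ex p g := by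
  obtain ⟨t, ht⟩ := FinSupp.exists_finset p
  rw [ex_eq_sum p _ fun a ha => (ht a).2 ha, ex_eq_sum p _ fun a ha => (ht a).2 ha]
  exact Finset.sum_le_sum fun a ha =>
    mul_le_mul_of_nonneg_left (h a ((ht a).1 ha)) ENNReal.toReal_nonneg

theorem ex_nonneg {f : α → ℝ} (h : ∀ a, 0 ≤ f a) : 0 ≤ ex p f :=
  tsum_nonneg fun a => mul_nonneg ENNReal.toReal_nonneg (h a)

theorem norm_ex_le (f : α → E) : ‖ex p f‖ ≤ ex p fun a => ‖f a‖ := by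
  obtain ⟨t, ht⟩ := FinSupp.exists_finset p
  rw [ex_eq_sum p _ fun a ha => (ht a).2 ha, ex_eq_sum p _ fun a ha => (ht a).2 ha]
  refine (norm_sum_le _ _).trans (Finset.sum_le_sum fun a _ => ?_)
  rw [norm_smul, Real.norm_of_nonneg ENNReal.toReal_nonneg, smul_eq_mul]

theorem ex_sq_le (f : α → ℝ) : ex p f ^ 2 ≤ ex p fun a => f a ^ 2 := by
  obtain ⟨t, ht⟩ := FinSupp.exists_finset p
  rw [ex_eq_sum p _ fun a ha => (ht a).2 ha, ex_eq_sum p _ fun a ha => (ht a).2 ha]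
  exact (even_two.convexOn_pow (𝕜 := ℝ)).map_sum_le (fun a _ => ENNReal.toReal_nonneg)
    (sum_toReal_eq_one p fun a ha => (ht a).2 ha) (fun _ _ => Set.mem_univ _)

theorem norm_ex_sq_le (f : α → E) : ‖ex p f‖ ^ 2 ≤ ex p fun a => ‖f a‖ ^ 2 :=
  (pow_le_pow_left₀ (norm_nonneg _) (norm_ex_le p f) 2).trans (ex_sq_le p _)

theorem ex_bind (q : α → PMF β) [hq : ∀ a, FinSupp (q a)] (f : β → E) :
    ex (p.bind q) f = ex p fun a => ex (q a) f := by
  obtain ⟨t, ht⟩ := FinSupp.exists_finset p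
  obtain ⟨u, hu⟩ := FinSupp.exists_finset (p.bind q)
  rw [ex_eq_sum (p.bind q) f fun b hb => (hu b).2 hb, ex_eq_sum p _ fun a ha => (ht a).2 ha]
  have h1 : ∀ a ∈ t, (p a).toReal • ex (q a) f =
      ∑ b ∈ u, ((p a).toReal * (q a b).toReal) • f b := by
    intro a ha
    rw [ex_eq_sum (q a) f (t := u) fun b hb => (hu b).2 ?_, Finset.smul_sum]
    · simp only [smul_smul]
    · rw [PMF.support_bind]
      exact Set.mem_biUnion ((ht a).1 ha) hb
  rw [Finset.sum_congr rfl h1, Finset.sum_comm]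
  refine Finset.sum_congr rfl fun b _ => ?_
  rw [← Finset.sum_smul, PMF.bind_apply, tsum_eq_sum (s := t) fun a ha => ?_,
    ENNReal.toReal_sum fun a _ => ENNReal.mul_ne_top (p.apply_ne_top a) ((q a).apply_ne_top b)]
  · simp only [ENNReal.toReal_mul]
  · have : p a = 0 := by rw [PMF.apply_eq_zero_iff]; exact fun h => ha ((ht a).2 h)
    rw [this, zero_mul]

theorem ex_pure (a : α) (f : α → E) : ex (PMF.pure a) f = f a := by
  classical
  rw [ex_eq_sum _ f (t := {a}) (by simp)]
  simp

theorem ex_map (g : α → β) (f : β → E) : ex (p.map g) f = ex p fun a => f (g a) := by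
  have h : p.map g = p.bind fun a => PMF.pure (g a) := rfl
  rw [h, ex_bind]
  simp only [ex_pure]

end Expectation

/-! ### Weighted sums along a trajectory -/

section Trajectory

variable {S A : Type*} [Fintype S] [DecidableEq S] [Fintype A] {E : Type*}
  [NormedAddCommGroup E] [NormedSpace ℝ E] (M : CMDP S A) (π : S → PMF A)

instance (n : ℕ) (s : S) : FinSupp (trajLaw M π n s) := by
  induction n generalizing s with
  | zero => rw [trajLaw]; infer_instance
  | succ n ih => rw [trajLaw]; infer_instance

/-- The expectation of `f(s, a, s')` for `a ∼ π(·|s)`, `s' ∼ P(·|s, a)`. -/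
def stepExp (f : S × A × S → E) (s : S) : E :=
  ex (π s) fun a => ex (M.P s a) fun s' => f (s, a, s')

/-- The expectation of `f(z^t)` along the chain started in `s`. -/
def meanAt (f : S × A × S → E) (t : ℕ) (s : S) : E :=
  ∑ s', (M.transMat π ^ t) s s' • stepExp M π f s'

theorem ex_trajLaw_succ (n : ℕ) (s : S) (f : List (S × A × S) → E) :
    ex (trajLaw M π (n + 1) s) f =
      stepExp M π (fun z => ex (trajLaw M π n z.2.2) fun l => f (z :: l)) s := by
  simp only [trajLaw, ex_bind, ex_map, stepExp]

theorem stepExp_add (f g : S × A × S → E) (s : S) :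
    stepExp M π (fun z => f z + g z) s = stepExp M π f s + stepExp M π g s := by
  simp only [stepExp, ex_add]

theorem stepExp_sub (f g : S × A × S → E) (s : S) :
    stepExp M π (fun z => f z - g z) s = stepExp M π f s - stepExp M π g s := by
  simp only [stepExp, ex_sub]

theorem stepExp_smul (c : ℝ) (f : S × A × S → E) (s : S) :
    stepExp M π (fun z => c • f z) s = c • stepExp M π f s := by
  simp only [stepExp, ex_smul]

theorem stepExp_const (c : E) (s : S) : stepExp M π (fun _ => c) s = c := by
  simp only [stepExp, ex_const]

theorem stepExp_mono {f g : S × A × S → ℝ} (h : ∀ z, f z ≤ g z) (s : S) :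
    stepExp M π f s ≤ stepExp M π g s :=
  ex_mono _ fun _ _ => ex_mono _ fun _ _ => h _

theorem norm_stepExp_le {f : S × A × S → E} {b : ℝ} (h : ∀ z, ‖f z‖ ≤ b) (s : S) :
    ‖stepExp M π f s‖ ≤ b := by
  refine (norm_ex_le _ _).trans ((ex_mono _ fun a _ => ?_).trans_eq (ex_const (π s) b))
  exact (norm_ex_le _ _).trans ((ex_mono _ fun s' _ => h _).trans_eq (ex_const _ b))

theorem stepExp_next (w : S → E) (s : S) :
    stepExp M π (fun z => w z.2.2) s = ∑ s', M.transMat π s s' • w s' := by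
  simp only [stepExp, ex_fintype, CMDP.transMat, Matrix.of_apply, Finset.smul_sum, smul_smul,
    Finset.sum_smul]
  exact Finset.sum_comm

theorem sum_stat_smul_stepExp (f : S × A × S → E) :
    ∑ s, M.stat π s • stepExp M π f s = M.statExp π f := by
  simp only [stepExp, ex_fintype, CMDP.statExp, Finset.smul_sum, smul_smul, mul_assoc]

theorem meanAt_zero (f : S × A × S → E) (s : S) : meanAt M π f 0 s = stepExp M π f s := by
  simp [meanAt, Matrix.one_apply]

theorem stepExp_meanAt (f : S × A × S → E) (t : ℕ) (s : S) :
    stepExp M π (fun z => meanAt M π f t z.2.2) s = meanAt M π f (t + 1) s := by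
  rw [stepExp_next]
  simp only [meanAt, Finset.smul_sum, smul_smul, pow_succ', Matrix.mul_apply, Finset.sum_smul]
  exact Finset.sum_comm

theorem norm_meanAt_sub_le {f : S × A × S → E} {c : E} {b : ℝ} (h : ∀ z, ‖f z - c‖ ≤ b)
    (t : ℕ) (s : S) : ‖meanAt M π f t s - M.statExp π f‖ ≤ b * M.mixDist π t s := by
  rw [← sum_stat_smul_stepExp]
  refine M.norm_sum_pow_smul_sub_le π (c := c) (fun s => ?_) t s
  rw [← stepExp_const M π c s, ← stepExp_sub]
  exact norm_stepExp_le M π h s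

theorem meanAt_nonneg {f : S × A × S → ℝ} (h : ∀ z, 0 ≤ f z) (t : ℕ) (s : S) :
    0 ≤ meanAt M π f t s :=
  Finset.sum_nonneg fun s' _ => mul_nonneg (M.pow_nonneg π t s s')
    ((stepExp_const M π (0 : ℝ) s').symm.le.trans (stepExp_mono M π h s'))

theorem meanAt_mono {f g : S × A × S → ℝ} (h : ∀ z, f z ≤ g z) (t : ℕ) (s : S) :
    meanAt M π f t s ≤ meanAt M π g t s :=
  Finset.sum_le_sum fun s' _ => mul_le_mul_of_nonneg_left (stepExp_mono M π h s')
    (M.pow_nonneg π t s s')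

theorem map_meanAt {F : Type*} [NormedAddCommGroup F] [NormedSpace ℝ F] (T : E →ₗ[ℝ] F)
    (f : S × A × S → E) (t : ℕ) (s : S) :
    T (meanAt M π f t s) = meanAt M π (fun z => T (f z)) t s := by
  simp only [meanAt, map_sum, map_smul, stepExp, map_ex]

/-- The weighted sum `∑_t ε_t f(z^t)` along a list. -/
def wsum {Z : Type*} (ε : ℕ → ℝ) (f : Z → E) : List Z → E
  | [] => 0
  | z :: l => ε 0 • f z + wsum (fun t => ε (t + 1)) f l

theorem wsum_sub {Z : Type*} (ε : ℕ → ℝ) (f g : Z → E) (l : List Z) :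
    wsum ε (fun z => f z - g z) l = wsum ε f l - wsum ε g l := by
  induction l generalizing ε with
  | nil => simp [wsum]
  | cons z l ih => simp only [wsum, ih, smul_sub]; abel

theorem wsum_coef_add {Z : Type*} (ε δ : ℕ → ℝ) (f : Z → E) (l : List Z) :
    wsum (fun t => ε t + δ t) f l = wsum ε f l + wsum δ f l := by
  induction l generalizing ε δ with
  | nil => simp [wsum]
  | cons z l ih =>
    simp only [wsum, add_smul, ih (fun t => ε (t + 1)) fun t => δ (t + 1)]; abel

theorem wsum_coef_smul {Z : Type*} (c : ℝ) (ε : ℕ → ℝ) (f : Z → E) (l : List Z) :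
    wsum (fun t => c * ε t) f l = c • wsum ε f l := by
  induction l generalizing ε with
  | nil => simp [wsum]
  | cons z l ih => simp only [wsum, smul_add, smul_smul, ih fun t => ε (t + 1)]

theorem wsum_const {Z : Type*} (ε : ℕ → ℝ) (c : E) (l : List Z) :
    wsum ε (fun _ => c) l = (∑ t ∈ Finset.range l.length, ε t) • c := by
  induction l generalizing ε with
  | nil => simp [wsum]
  | cons z l ih =>
    simp only [wsum, ih, List.length_cons, Finset.sum_range_succ', add_smul, add_comm]

theorem wsum_indicator {Z : Type*} (k : ℕ) (f : Z → E) (l : List Z) :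
    wsum (fun t => if t < k then 1 else 0) f l = ((l.take k).map f).sum := by
  induction l generalizing k with
  | nil => simp [wsum]
  | cons z l ih =>
    cases k with
    | zero =>
      have : ∀ l : List Z, wsum (fun _ => (0 : ℝ)) f l = 0 := by
        intro l
        induction l with
        | nil => rfl
        | cons z l ih => simp [wsum, ih]
      simp [this]
    | succ k => simp [wsum, ih]

theorem norm_wsum_le {Z : Type*} {ε : ℕ → ℝ} (hε : ∀ t, |ε t| ≤ 1) (f : Z → E) (l : List Z) :
    ‖wsum ε f l‖ ≤ (l.map fun z => ‖f z‖).sum := by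
  induction l generalizing ε with
  | nil => simp [wsum]
  | cons z l ih =>
    simp only [wsum, List.map_cons, List.sum_cons]
    refine (norm_add_le _ _).trans (add_le_add ?_ (ih fun t => hε (t + 1)))
    rw [norm_smul]
    exact mul_le_of_le_one_left (norm_nonneg _) (hε 0)

theorem sq_list_sum_le {Z : Type*} (f : Z → ℝ) (l : List Z) :
    (l.map f).sum ^ 2 ≤ l.length * (l.map fun z => f z ^ 2).sum := by
  induction l with
  | nil => simp
  | cons z l ih =>
    simp only [List.map_cons, List.sum_cons, List.length_cons, Nat.cast_succ]
    have h1 : 2 * (f z * (l.map f).sum) ≤ l.length * f z ^ 2 + (l.map fun z => f z ^ 2).sum := by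
      rcases Nat.eq_zero_or_pos l.length with h0 | h0
      · rw [List.length_eq_zero_iff.1 h0]; simp
      · have hn : (0 : ℝ) < l.length := by exact_mod_cast h0
        have h2 : 0 ≤ (l.length * f z - (l.map f).sum) ^ 2 := sq_nonneg _
        refine le_of_mul_le_mul_left ?_ hn
        nlinarith
    nlinarith

theorem norm_wsum_sq_le {Z : Type*} {ε : ℕ → ℝ} (hε : ∀ t, |ε t| ≤ 1) (f : Z → E)
    (l : List Z) : ‖wsum ε f l‖ ^ 2 ≤ l.length * (l.map fun z => ‖f z‖ ^ 2).sum :=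
  (pow_le_pow_left₀ (norm_nonneg _) (norm_wsum_le hε f l) 2).trans (sq_list_sum_le _ l)

theorem length_of_mem_trajLaw {n : ℕ} {s : S} {l : List (S × A × S)}
    (hl : l ∈ (trajLaw M π n s).support) : l.length = n := by
  induction n generalizing s l with
  | zero => simp [trajLaw] at hl; simp [hl]
  | succ n ih =>
    simp only [trajLaw, PMF.mem_support_bind_iff, PMF.mem_support_map_iff] at hl
    obtain ⟨a, -, s', -, l', hl', rfl⟩ := hl
    simp [ih hl']

theorem ex_wsum (n : ℕ) (s : S) (ε : ℕ → ℝ) (f : S × A × S → E) :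
    ex (trajLaw M π n s) (wsum ε f) = ∑ t ∈ Finset.range n, ε t • meanAt M π f t s := by
  induction n generalizing s ε with
  | zero => simp [trajLaw, ex_pure, wsum]
  | succ n ih =>
    rw [ex_trajLaw_succ]
    simp only [wsum, ex_add, ex_const, ih, stepExp_add, stepExp_smul]
    rw [Finset.sum_range_succ', add_comm, meanAt_zero]
    congr 1
    simp only [← stepExp_meanAt]
    have : ∀ (r : Finset ℕ) (F : ℕ → S × A × S → E),
        stepExp M π (fun z => ∑ t ∈ r, F t z) s = ∑ t ∈ r, stepExp M π (F t) s := by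
      classical
      intro r F
      induction r using Finset.induction_on with
      | empty => simpa using stepExp_const M π (0 : E) s
      | insert t r ht ih => simp only [Finset.sum_insert ht, stepExp_add, ih]
    rw [this]
    simp only [stepExp_smul]

end Trajectory

/-! ### Second moment of centred weighted sums -/

section SecondMoment

variable {S A : Type*} [Fintype S] [DecidableEq S] [Fintype A] {E : Type*}
  [NormedAddCommGroup E] [InnerProductSpace ℝ E] {M : CMDP S A}

/-- Induction on the length, splitting off the first sample. Its square costs at most 4b²; in the
cross term the conditional mean of the rest is at most (8/3) τ b, by summability of the mixing
distances, whence 4 + 32/3 = 44/3. Each cost carries a factor |ε_0|, so the bound scales with the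
sum of the |ε_t| and not with n. -/
theorem CMDP.Ergodic.ex_norm_wsum_sq_le (hM : M.Ergodic) (π : S → PMF A) {f : S × A × S → E}
    {c : E} {b : ℝ} (hb : 0 ≤ b) (h : ∀ z, ‖f z - c‖ ≤ b) (h0 : M.statExp π f = 0)
    {ε : ℕ → ℝ} (hε : ∀ t, |ε t| ≤ 1) (n : ℕ) (s : S) :
    ex (trajLaw M π n s) (fun l => ‖wsum ε f l‖ ^ 2) ≤
      44 / 3 * M.mixTimeOf π * b ^ 2 * ∑ t ∈ Finset.range n, |ε t| := by
  have hf : ∀ z, ‖f z‖ ≤ 2 * b := by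
    intro z
    have h1 : ‖c‖ ≤ b := by
      have h2 : M.statExp π (fun z => f z - c) = -c := by
        rw [M.statExp_sub, h0, M.statExp_const, zero_sub]
      rw [← norm_neg, ← h2]
      exact M.norm_statExp_le π h
    calc ‖f z‖ = ‖(f z - c) + c‖ := by rw [sub_add_cancel]
      _ ≤ _ := (norm_add_le _ _).trans (by linarith [h z])
  have hτ : (1 : ℝ) ≤ M.mixTimeOf π := by exact_mod_cast (hM.mixTimeOf_spec π).1
  induction n generalizing s ε with
  | zero => simp [trajLaw, ex_pure, wsum]
  | succ n ih =>
    rw [ex_trajLaw_succ, Finset.sum_range_succ', mul_add]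
    set V := 44 / 3 * M.mixTimeOf π * b ^ 2 with hV
    have key : ∀ z : S × A × S, ex (trajLaw M π n z.2.2) (fun l => ‖wsum ε f (z :: l)‖ ^ 2) ≤
        V * ∑ t ∈ Finset.range n, |ε (t + 1)| + V * |ε 0| := by
      intro z
      have e1 : ∀ l, ‖wsum ε f (z :: l)‖ ^ 2 = ‖ε 0 • f z‖ ^ 2 +
          2 * inner ℝ (ε 0 • f z) (wsum (fun t => ε (t + 1)) f l) +
          ‖wsum (fun t => ε (t + 1)) f l‖ ^ 2 := fun l => norm_add_sq_real _ _
      simp only [e1, ex_add, ex_const, ex_mul]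
      have e2 : ex (trajLaw M π n z.2.2)
          (fun l => inner ℝ (ε 0 • f z) (wsum (fun t => ε (t + 1)) f l)) =
          inner ℝ (ε 0 • f z) (ex (trajLaw M π n z.2.2) (wsum (fun t => ε (t + 1)) f)) :=
        (map_ex _ (innerSL ℝ (ε 0 • f z)).toLinearMap _).symm
      have e3 : ‖ex (trajLaw M π n z.2.2) (wsum (fun t => ε (t + 1)) f)‖ ≤
          8 / 3 * M.mixTimeOf π * b := by
        rw [ex_wsum]
        calc _ ≤ ∑ t ∈ Finset.range n, b * M.mixDist π t z.2.2 := by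
              refine (norm_sum_le _ _).trans (Finset.sum_le_sum fun t _ => ?_)
              rw [norm_smul]
              have := norm_meanAt_sub_le M π h t z.2.2
              rw [h0, sub_zero] at this
              exact (mul_le_of_le_one_left (norm_nonneg _) (hε _)).trans this
          _ ≤ _ := by
              rw [← Finset.mul_sum, mul_comm]
              exact mul_le_mul_of_nonneg_right (hM.sum_mixDist_le π n z.2.2) hb
      have e4 : ‖ε 0 • f z‖ ≤ |ε 0| * (2 * b) := by
        rw [norm_smul]; exact mul_le_mul_of_nonneg_left (hf z) (abs_nonneg _)
      have e5 : ‖ε 0 • f z‖ ^ 2 ≤ |ε 0| * (4 * b ^ 2) := by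
        calc _ ≤ (|ε 0| * (2 * b)) ^ 2 := pow_le_pow_left₀ (norm_nonneg _) e4 2
          _ = |ε 0| * |ε 0| * (4 * b ^ 2) := by ring
          _ ≤ 1 * |ε 0| * (4 * b ^ 2) := by gcongr; exact hε 0
          _ = _ := by ring
      have e6 : inner ℝ (ε 0 • f z) (ex (trajLaw M π n z.2.2) (wsum (fun t => ε (t + 1)) f)) ≤
          |ε 0| * (2 * b) * (8 / 3 * M.mixTimeOf π * b) :=
        (real_inner_le_norm _ _).trans (mul_le_mul e4 e3 (norm_nonneg _) (by positivity))
      have e7 := ih (fun t => hε (t + 1)) z.2.2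
      rw [e2]
      have e8 : |ε 0| * (4 * b ^ 2) ≤ |ε 0| * (4 * b ^ 2) * M.mixTimeOf π :=
        le_mul_of_one_le_right (by positivity) hτ
      have e9 : V * |ε 0| = |ε 0| * (4 * b ^ 2) * M.mixTimeOf π +
          2 * (|ε 0| * (2 * b) * (8 / 3 * M.mixTimeOf π * b)) := by rw [hV]; ring
      linarith
    exact (stepExp_mono M π key s).trans_eq (stepExp_const M π _ s)

end SecondMoment

/-! ### Truncated levels and MLMC coefficients -/

section Level

/-- The level law with all levels beyond the truncation identified. -/
def truncLevel (Tmax : ℕ) : PMF ℕ := levelLaw.map fun q => min q (Nat.log 2 Tmax + 1)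

instance (Tmax : ℕ) : FinSupp (truncLevel Tmax) := by
  refine ⟨(Set.finite_Iic (Nat.log 2 Tmax + 1)).subset ?_⟩
  intro q hq
  rw [truncLevel, PMF.mem_support_map_iff] at hq
  obtain ⟨a, -, rfl⟩ := hq
  exact Nat.min_le_right _ _

theorem truncLevel_support (Tmax : ℕ) :
    (truncLevel Tmax).support ⊆ Finset.Icc 1 (Nat.log 2 Tmax + 1) := by
  intro q hq
  rw [truncLevel, PMF.mem_support_map_iff] at hq
  obtain ⟨a, ha, rfl⟩ := hq
  have h0 : a ≠ 0 := by
    rintro rfl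
    exact ((PMF.mem_support_iff _ _).1 ha) rfl
  rw [Finset.coe_Icc]
  exact ⟨le_min (Nat.one_le_iff_ne_zero.2 h0) (by omega), min_le_right _ _⟩

theorem truncLevel_apply {Tmax q : ℕ} (h1 : 1 ≤ q) (h2 : q ≤ Nat.log 2 Tmax) :
    (truncLevel Tmax q).toReal = (2 ^ q)⁻¹ := by
  have : truncLevel Tmax q = levelLaw q := by
    rw [truncLevel, PMF.map_apply, tsum_eq_single q]
    · rw [if_pos (by omega)]
    · intro a ha
      rw [if_neg (by omega)]
  have h3 : levelLaw q = (2 : ℝ≥0∞)⁻¹ ^ q := by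
    change (if q = 0 then 0 else (2 : ℝ≥0∞)⁻¹ ^ q) = _
    rw [if_neg (by omega)]
  rw [this, h3]
  simp

theorem sum_Icc_inv_two_pow (J : ℕ) :
    ∑ q ∈ Finset.Icc 1 J, ((2 : ℝ) ^ q)⁻¹ = 1 - (2 ^ J)⁻¹ := by
  induction J with
  | zero => simp
  | succ J ih =>
    rw [Finset.sum_Icc_succ_top (by omega), ih, pow_succ, mul_inv]
    ring

theorem truncLevel_apply_top (Tmax : ℕ) :
    (truncLevel Tmax (Nat.log 2 Tmax + 1)).toReal = (2 ^ Nat.log 2 Tmax)⁻¹ := by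
  have h := sum_toReal_eq_one (truncLevel Tmax) (truncLevel_support Tmax)
  rw [Finset.sum_Icc_succ_top (by omega), Finset.sum_congr rfl fun q hq =>
    truncLevel_apply (Finset.mem_Icc.1 hq).1 (Finset.mem_Icc.1 hq).2, sum_Icc_inv_two_pow] at h
  linarith

theorem ex_truncLevel {E : Type*} [NormedAddCommGroup E] [NormedSpace ℝ E] (Tmax : ℕ)
    (f : ℕ → E) :
    ex (truncLevel Tmax) f = ∑ q ∈ Finset.Icc 1 (Nat.log 2 Tmax), ((2 : ℝ) ^ q)⁻¹ • f q +
      ((2 : ℝ) ^ Nat.log 2 Tmax)⁻¹ • f (Nat.log 2 Tmax + 1) := by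
  rw [ex_eq_sum _ f (truncLevel_support Tmax), Finset.sum_Icc_succ_top (by omega),
    truncLevel_apply_top]
  congr 1
  exact Finset.sum_congr rfl fun q hq => by
    rw [truncLevel_apply (Finset.mem_Icc.1 hq).1 (Finset.mem_Icc.1 hq).2]

theorem two_pow_le_iff {Tmax : ℕ} (hT : Tmax ≠ 0) (q : ℕ) :
    2 ^ q ≤ Tmax ↔ q ≤ Nat.log 2 Tmax := by
  rw [Nat.le_log_iff_pow_le (by norm_num) hT]

theorem trajLength_of_le {Tmax q : ℕ} (hT : Tmax ≠ 0) (h : q ≤ Nat.log 2 Tmax) :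
    trajLength Tmax q = 2 ^ q := if_pos ((two_pow_le_iff hT q).2 h)

theorem trajLength_of_lt {Tmax q : ℕ} (hT : Tmax ≠ 0) (h : Nat.log 2 Tmax < q) :
    trajLength Tmax q = 1 := if_neg (by rw [two_pow_le_iff hT]; omega)

/-- The coefficient of `f(z^t)` in the multi-level combination at level `q`. -/
def levelCoef (Tmax q t : ℕ) : ℝ :=
  (if t < 1 then 1 else 0) +
    if 2 ^ q ≤ Tmax then (if t < 2 ^ q then 1 else 0) + (-2) * (if t < 2 ^ (q - 1) then 1 else 0)
    else 0

/-- Multiplied by 2^q, the averages at levels q and q − 1 become sums with weights 1 and 2. At a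
fixed level the estimate is thus a sum along the path with coefficients in [−1, 1]. -/
theorem mlmc_eq_wsum {Z E : Type*} [NormedAddCommGroup E] [NormedSpace ℝ E] (Tmax : ℕ)
    (f : Z → E) {q : ℕ} (hq : 1 ≤ q) (l : List Z) :
    mlmc Tmax f (q, l) = wsum (levelCoef Tmax q) f l := by
  obtain ⟨j, rfl⟩ : ∃ j, q = j + 1 := ⟨q - 1, by omega⟩
  have h0 : levelAvg f l 0 = wsum (fun t => if t < 1 then 1 else 0) f l := by
    rw [wsum_indicator, levelAvg]; simp
  have hl : wsum (levelCoef Tmax (j + 1)) f l =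
      wsum (fun t => if t < 1 then 1 else 0) f l +
      wsum (fun t => if 2 ^ (j + 1) ≤ Tmax then (if t < 2 ^ (j + 1) then 1 else 0) +
        (-2) * (if t < 2 ^ j then 1 else 0) else 0) f l := wsum_coef_add _ _ f l
  rw [mlmc, hl, ← h0]
  congr 1
  by_cases h : 2 ^ (j + 1) ≤ Tmax
  · simp only [h, if_true]
    rw [wsum_coef_add (fun t => if t < 2 ^ (j + 1) then 1 else 0)
      (fun t => (-2) * (if t < 2 ^ j then 1 else 0)),
      wsum_coef_smul (-2) (fun t => if t < 2 ^ j then 1 else 0), wsum_indicator, wsum_indicator,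
      levelAvg, levelAvg, smul_sub, smul_smul, smul_smul, Nat.add_sub_cancel,
      mul_inv_cancel₀ (by positivity), one_smul, neg_smul, sub_eq_add_neg]
    have : (2 : ℝ) ^ (j + 1) * (2 ^ j)⁻¹ = 2 := by rw [pow_succ]; field_simp
    rw [this]
  · simp only [h, if_false]
    have := wsum_coef_smul 0 (fun _ => (0 : ℝ)) f l
    simpa using this.symm

theorem abs_levelCoef_le (Tmax : ℕ) {q : ℕ} (hq : 1 ≤ q) (t : ℕ) : |levelCoef Tmax q t| ≤ 1 := by
  obtain ⟨j, rfl⟩ : ∃ j, q = j + 1 := ⟨q - 1, by omega⟩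
  have h1 : 1 ≤ 2 ^ j := Nat.one_le_two_pow
  have h2 : 2 ^ (j + 1) = 2 * 2 ^ j := pow_succ' 2 j
  simp only [levelCoef, Nat.add_sub_cancel]
  split_ifs <;> first | omega | norm_num

theorem sum_indicator_range {k n : ℕ} (h : k ≤ n) :
    ∑ t ∈ Finset.range n, (if t < k then (1 : ℝ) else 0) = k := by
  rw [← Finset.sum_filter]
  have : (Finset.range n).filter (· < k) = Finset.range k := by
    ext t; simp; omega
  rw [this]; simp

theorem sum_levelCoef {Tmax q : ℕ} (hq : 1 ≤ q) :
    ∑ t ∈ Finset.range (trajLength Tmax q), levelCoef Tmax q t = 1 := by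
  obtain ⟨j, rfl⟩ : ∃ j, q = j + 1 := ⟨q - 1, by omega⟩
  have h1 : 1 ≤ 2 ^ j := Nat.one_le_two_pow
  have h2 : 2 ^ (j + 1) = 2 * 2 ^ j := pow_succ' 2 j
  simp only [levelCoef, Nat.add_sub_cancel, trajLength]
  by_cases h : 2 ^ (j + 1) ≤ Tmax
  · simp only [h, if_true, Finset.sum_add_distrib, ← Finset.mul_sum]
    rw [sum_indicator_range (by omega), sum_indicator_range le_rfl,
      sum_indicator_range (by omega)]
    push_cast
    ring
  · simp [h]

/-- The coefficient at t = 0 is 1 + 1 − 2 = 0. The unit saved here pays for the truncated level when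
the variance is summed over levels. -/
theorem sum_abs_levelCoef_le {Tmax q : ℕ} (hq : 1 ≤ q) (h : 2 ^ q ≤ Tmax) :
    ∑ t ∈ Finset.range (trajLength Tmax q), |levelCoef Tmax q t| ≤ 2 ^ q - 1 := by
  have h0 : 1 ≤ 2 ^ q := Nat.one_le_two_pow
  have h1 : trajLength Tmax q = (2 ^ q - 1) + 1 := by rw [trajLength, if_pos h]; omega
  rw [h1, Finset.sum_range_succ']
  have h2 : levelCoef Tmax q 0 = 0 := by simp [levelCoef, h]; norm_num
  rw [h2, abs_zero, add_zero]
  refine (Finset.sum_le_sum fun t _ => abs_levelCoef_le Tmax hq (t + 1)).trans ?_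
  simp [Nat.cast_sub h0]

end Level

/-! ### Mean of the MLMC estimate -/

section BatchLaw

variable {S A : Type*} [Fintype S] [DecidableEq S] [Fintype A] {E : Type*}
  [NormedAddCommGroup E] [NormedSpace ℝ E] (M : CMDP S A) (π : S → PMF A)

/-- The law of a batch with its level truncated. -/
def truncBatch (Tmax : ℕ) (s : S) : PMF (Batch S A) :=
  (truncLevel Tmax).bind fun q => (trajLaw M π (trajLength Tmax q) s).map fun l => (q, l)

instance (Tmax : ℕ) (s : S) : FinSupp (truncBatch M π Tmax s) := by
  rw [truncBatch]; infer_instance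

/-- The expected value of the multi-level combination. -/
def mlmcMean (Tmax : ℕ) (f : S × A × S → E) (s : S) : E :=
  ((2 : ℝ) ^ Nat.log 2 Tmax)⁻¹ • ∑ t ∈ Finset.range (2 ^ Nat.log 2 Tmax), meanAt M π f t s

theorem ex_truncBatch (Tmax : ℕ) (s : S) (f : Batch S A → E) :
    ex (truncBatch M π Tmax s) f =
      ex (truncLevel Tmax) fun q => ex (trajLaw M π (trajLength Tmax q) s) fun l => f (q, l) := by
  simp only [truncBatch, ex_bind, ex_map]

theorem sum_indicator_smul {k n : ℕ} (h : k ≤ n) (F : ℕ → E) :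
    ∑ t ∈ Finset.range n, (if t < k then (1 : ℝ) else 0) • F t = ∑ t ∈ Finset.range k, F t := by
  simp only [ite_smul, one_smul, zero_smul]
  rw [← Finset.sum_filter]
  congr 1
  ext t; simp; omega

/-- With a_j the expected average over 2^j samples, level q has probability 2^{-q} and contributes
a_q − a_{q−1} besides its share of a_0. The shares of a_0 add up to a_0, and the differences
telescope to a_J − a_0. -/
theorem ex_mlmc {Tmax : ℕ} (hT : Tmax ≠ 0) (f : S × A × S → E) (s : S) :
    ex (truncBatch M π Tmax s) (mlmc Tmax f) = mlmcMean M π Tmax f s := by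
  set J := Nat.log 2 Tmax with hJ
  set F := fun t => meanAt M π f t s with hF
  set a : ℕ → E := fun j => ((2 : ℝ) ^ j)⁻¹ • ∑ t ∈ Finset.range (2 ^ j), F t with ha
  have hlev : ∀ q, 1 ≤ q → ex (trajLaw M π (trajLength Tmax q) s) (fun l => mlmc Tmax f (q, l)) =
      ∑ t ∈ Finset.range (trajLength Tmax q), levelCoef Tmax q t • F t := by
    intro q hq
    simp only [mlmc_eq_wsum Tmax f hq]
    exact ex_wsum M π _ s _ f
  have h1 : ∀ q ∈ Finset.Icc 1 J, ((2 : ℝ) ^ q)⁻¹ •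
      ex (trajLaw M π (trajLength Tmax q) s) (fun l => mlmc Tmax f (q, l)) =
      ((2 : ℝ) ^ q)⁻¹ • a 0 + (a q - a (q - 1)) := by
    intro q hq
    obtain ⟨hq1, hq2⟩ := Finset.mem_Icc.1 hq
    rw [hlev q hq1, trajLength_of_le hT hq2]
    obtain ⟨j, rfl⟩ : ∃ j, q = j + 1 := ⟨q - 1, by omega⟩
    have e1 : 1 ≤ 2 ^ j := Nat.one_le_two_pow
    have e2 : 2 ^ (j + 1) = 2 * 2 ^ j := pow_succ' 2 j
    simp only [levelCoef, (two_pow_le_iff hT (j + 1)).2 hq2, if_true, Nat.add_sub_cancel,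
      add_smul, Finset.sum_add_distrib, mul_smul, ← Finset.smul_sum]
    rw [sum_indicator_smul (by omega), sum_indicator_smul le_rfl, sum_indicator_smul (by omega),
      smul_add, smul_add, smul_smul, sub_eq_add_neg]
    have e3 : ((2 : ℝ) ^ (j + 1))⁻¹ * (-2) = -((2 : ℝ) ^ j)⁻¹ := by
      rw [pow_succ]; field_simp
    rw [e3, neg_smul]
    simp [ha]
  have h2 : ((2 : ℝ) ^ J)⁻¹ •
      ex (trajLaw M π (trajLength Tmax (J + 1)) s) (fun l => mlmc Tmax f (J + 1, l)) =
      ((2 : ℝ) ^ J)⁻¹ • a 0 := by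
    rw [hlev _ (by omega), trajLength_of_lt hT (Nat.lt_succ_self _)]
    have : ¬ 2 ^ (J + 1) ≤ Tmax := by rw [two_pow_le_iff hT]; omega
    simp [levelCoef, this, ha]
  have h3 : ∀ n, ∑ q ∈ Finset.Icc 1 n, (a q - a (q - 1)) = a n - a 0 := by
    intro n
    induction n with
    | zero => simp
    | succ n ih => rw [Finset.sum_Icc_succ_top (by omega), ih, Nat.add_sub_cancel]; abel
  rw [ex_truncBatch, ex_truncLevel, Finset.sum_congr rfl h1, h2, Finset.sum_add_distrib, h3,
    ← Finset.sum_smul, sum_Icc_inv_two_pow, sub_smul, one_smul]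
  change _ = a J
  abel

theorem CMDP.Ergodic.norm_mlmcMean_sub_le {M : CMDP S A} (hM : M.Ergodic) (π : S → PMF A)
    {f : S × A × S → E} {c : E} {b : ℝ} (hb : 0 ≤ b) (h : ∀ z, ‖f z - c‖ ≤ b)
    (Tmax : ℕ) (s : S) :
    ‖mlmcMean M π Tmax f s - M.statExp π f‖ ≤
      ((2 : ℝ) ^ Nat.log 2 Tmax)⁻¹ * (b * (8 / 3 * M.mixTimeOf π)) := by
  set J := Nat.log 2 Tmax
  have h1 : mlmcMean M π Tmax f s - M.statExp π f =
      ((2 : ℝ) ^ J)⁻¹ • ∑ t ∈ Finset.range (2 ^ J), (meanAt M π f t s - M.statExp π f) := by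
    rw [Finset.sum_sub_distrib, smul_sub, Finset.sum_const, Finset.card_range,
      ← Nat.cast_smul_eq_nsmul ℝ, smul_smul]
    push_cast
    rw [inv_mul_cancel₀ (by positivity), one_smul]
    rfl
  rw [h1, norm_smul, norm_inv, Real.norm_of_nonneg (by positivity : (0 : ℝ) ≤ 2 ^ J)]
  gcongr
  refine (norm_sum_le _ _).trans
    ((Finset.sum_le_sum fun t _ => norm_meanAt_sub_le M π h t s).trans ?_)
  rw [← Finset.mul_sum]
  exact mul_le_mul_of_nonneg_left (hM.sum_mixDist_le π _ s) hb

theorem norm_mlmcMean_le {f : S × A × S → E} {b : ℝ} (h : ∀ z, ‖f z‖ ≤ b) (Tmax : ℕ) (s : S) :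
    ‖mlmcMean M π Tmax f s‖ ≤ b := by
  set J := Nat.log 2 Tmax
  have h1 : ∀ t, ‖meanAt M π f t s‖ ≤ b := by
    intro t
    refine (norm_sum_le _ _).trans ?_
    calc _ ≤ ∑ s', (M.transMat π ^ t) s s' * b := Finset.sum_le_sum fun s' _ => by
          rw [norm_smul, Real.norm_of_nonneg (M.pow_nonneg π t s s')]
          exact mul_le_mul_of_nonneg_left (norm_stepExp_le M π h s') (M.pow_nonneg π t s s')
      _ = b := by rw [← Finset.sum_mul, M.pow_sum, one_mul]
  rw [mlmcMean, norm_smul, norm_inv, Real.norm_of_nonneg (by positivity : (0 : ℝ) ≤ 2 ^ J),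
    inv_mul_le_iff₀ (by positivity)]
  refine (norm_sum_le _ _).trans ((Finset.sum_le_sum fun t _ => h1 t).trans ?_)
  simp [J]

end BatchLaw

/-! ### Second moments of the MLMC estimate -/

section BatchMoment

variable {S A : Type*} [Fintype S] [DecidableEq S] [Fintype A] {E : Type*}
  [NormedAddCommGroup E] [InnerProductSpace ℝ E] {M : CMDP S A}

/-- The coefficients of each level sum to one, so centring the estimate amounts to centring f. Level
q then costs V(2^q − 1) with probability 2^{-q}, and the levels add up to V(J − 1 + 2·2^{-J}) ≤ VJ.
-/
theorem CMDP.Ergodic.ex_norm_mlmc_sub_sq_le (hM : M.Ergodic) (π : S → PMF A)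
    {f : S × A × S → E} {c : E} {b : ℝ} (hb : 0 ≤ b) (h : ∀ z, ‖f z - c‖ ≤ b) {Tmax : ℕ}
    (hT : 2 ≤ Tmax) (s : S) :
    ex (truncBatch M π Tmax s) (fun x => ‖mlmc Tmax f x - M.statExp π f‖ ^ 2) ≤
      Nat.log 2 Tmax * (44 / 3 * M.mixTimeOf π * b ^ 2) := by
  have hT0 : Tmax ≠ 0 := by omega
  set J := Nat.log 2 Tmax
  have hJ : 1 ≤ J := Nat.log_pos (by norm_num) hT
  set fb := M.statExp π f
  set V := 44 / 3 * (M.mixTimeOf π : ℝ) * b ^ 2 with hVdef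
  have hV : 0 ≤ V := by positivity
  have hcent : ∀ z, ‖(f z - fb) - (c - fb)‖ ≤ b := fun z => by rw [sub_sub_sub_cancel_right]; exact h z
  have hzero : M.statExp π (fun z => f z - fb) = 0 := by
    rw [M.statExp_sub, M.statExp_const, sub_self]
  have hq : ∀ q, 1 ≤ q →
      ex (trajLaw M π (trajLength Tmax q) s) (fun l => ‖mlmc Tmax f (q, l) - fb‖ ^ 2) ≤
        V * ∑ t ∈ Finset.range (trajLength Tmax q), |levelCoef Tmax q t| := by
    intro q hq
    have e1 : ex (trajLaw M π (trajLength Tmax q) s) (fun l => ‖mlmc Tmax f (q, l) - fb‖ ^ 2) =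
        ex (trajLaw M π (trajLength Tmax q) s)
          (fun l => ‖wsum (levelCoef Tmax q) (fun z => f z - fb) l‖ ^ 2) := by
      refine ex_congr _ fun l hl => ?_
      rw [wsum_sub, wsum_const, length_of_mem_trajLaw M π hl, sum_levelCoef hq, one_smul,
        mlmc_eq_wsum Tmax f hq]
    rw [e1]
    exact hM.ex_norm_wsum_sq_le π hb hcent hzero (abs_levelCoef_le Tmax hq) _ s
  rw [ex_truncBatch, ex_truncLevel]
  have h1 : ∀ q ∈ Finset.Icc 1 J, ((2 : ℝ) ^ q)⁻¹ •
      ex (trajLaw M π (trajLength Tmax q) s) (fun l => ‖mlmc Tmax f (q, l) - fb‖ ^ 2) ≤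
      V * (1 - ((2 : ℝ) ^ q)⁻¹) := by
    intro q hq'
    obtain ⟨hq1, hq2⟩ := Finset.mem_Icc.1 hq'
    have e2 := (hq q hq1).trans (mul_le_mul_of_nonneg_left
      (sum_abs_levelCoef_le hq1 ((two_pow_le_iff hT0 q).2 hq2)) hV)
    calc _ ≤ ((2 : ℝ) ^ q)⁻¹ * (V * (2 ^ q - 1)) := by
          rw [smul_eq_mul]; gcongr
      _ = _ := by field_simp
  have h2 : ((2 : ℝ) ^ J)⁻¹ •
      ex (trajLaw M π (trajLength Tmax (J + 1)) s)
        (fun l => ‖mlmc Tmax f (J + 1, l) - fb‖ ^ 2) ≤ ((2 : ℝ) ^ J)⁻¹ * V := by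
    rw [smul_eq_mul]
    gcongr
    refine (hq _ (by omega)).trans ?_
    rw [trajLength_of_lt hT0 (Nat.lt_succ_self _)]
    simpa using mul_le_mul_of_nonneg_left (abs_levelCoef_le Tmax (q := J + 1) (by omega) 0) hV
  refine (add_le_add (Finset.sum_le_sum h1) h2).trans ?_
  rw [← Finset.mul_sum, Finset.sum_sub_distrib, sum_Icc_inv_two_pow]
  simp only [Finset.sum_const, Nat.card_Icc, Nat.add_sub_cancel, nsmul_eq_mul, mul_one]
  have h3 : ((2 : ℝ) ^ J)⁻¹ ≤ 2⁻¹ := by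
    gcongr
    calc (2 : ℝ) = 2 ^ 1 := by norm_num
      _ ≤ 2 ^ J := by gcongr; norm_num
  nlinarith

/-- Cauchy–Schwarz along the path, without mixing. The price 2^J is acceptable only when
trajectories are short; in return the bound keeps the mean of ‖f‖² over the very window whose
average is the MLMC mean. -/
theorem ex_norm_mlmc_sq_le (π : S → PMF A) (f : S × A × S → E) {Tmax : ℕ}
    (hT : 2 ≤ Tmax) (s : S) :
    ex (truncBatch M π Tmax s) (fun x => ‖mlmc Tmax f x‖ ^ 2) ≤
      3 / 2 * Nat.log 2 Tmax * 2 ^ Nat.log 2 Tmax *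
        mlmcMean M π Tmax (fun z => ‖f z‖ ^ 2) s := by
  have hT0 : Tmax ≠ 0 := by omega
  set J := Nat.log 2 Tmax with hJdef
  have hJ : 1 ≤ J := Nat.log_pos (by norm_num) hT
  set σ := fun n => ∑ t ∈ Finset.range n, meanAt M π (fun z => ‖f z‖ ^ 2) t s with hσ
  have hmean : 2 ^ J * mlmcMean M π Tmax (fun z => ‖f z‖ ^ 2) s = σ (2 ^ J) := by
    rw [mlmcMean, smul_eq_mul, ← mul_assoc, mul_inv_cancel₀ (by positivity), one_mul]
  have hmono : ∀ {n k}, n ≤ k → σ n ≤ σ k := fun h =>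
    Finset.sum_le_sum_of_subset_of_nonneg (Finset.range_mono h)
      fun t _ _ => meanAt_nonneg M π (fun z => sq_nonneg _) t s
  have hσ0 : 0 ≤ σ (2 ^ J) := by simpa [hσ] using hmono (Nat.zero_le (2 ^ J))
  have hq : ∀ q, 1 ≤ q →
      ex (trajLaw M π (trajLength Tmax q) s) (fun l => ‖mlmc Tmax f (q, l)‖ ^ 2) ≤
        trajLength Tmax q * σ (trajLength Tmax q) := by
    intro q hq
    have e1 : ex (trajLaw M π (trajLength Tmax q) s)
        (fun l => (l.map fun z => ‖f z‖ ^ 2).sum) = σ (trajLength Tmax q) := by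
      have e2 := ex_wsum M π (trajLength Tmax q) s (fun _ => 1) fun z => ‖f z‖ ^ 2
      simp only [one_smul] at e2
      refine Eq.trans ?_ e2
      congr 1
      funext l
      have : ∀ l : List (S × A × S), (l.map fun z => ‖f z‖ ^ 2).sum =
          wsum (fun _ => 1) (fun z => ‖f z‖ ^ 2) l := by
        intro l
        induction l with
        | nil => rfl
        | cons z l ih => simp [wsum, ih]
      exact this l
    rw [← e1, ← ex_mul]
    refine ex_mono _ fun l hl => ?_
    rw [mlmc_eq_wsum Tmax f hq, ← length_of_mem_trajLaw M π hl]
    exact norm_wsum_sq_le (abs_levelCoef_le Tmax hq) f l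
  rw [ex_truncBatch, ex_truncLevel]
  have h1 : ∀ q ∈ Finset.Icc 1 J, ((2 : ℝ) ^ q)⁻¹ •
      ex (trajLaw M π (trajLength Tmax q) s) (fun l => ‖mlmc Tmax f (q, l)‖ ^ 2) ≤
      σ (2 ^ J) := by
    intro q hq'
    obtain ⟨hq1, hq2⟩ := Finset.mem_Icc.1 hq'
    have e2 := hq q hq1
    rw [trajLength_of_le hT0 hq2] at e2 ⊢
    rw [smul_eq_mul, inv_mul_le_iff₀ (by positivity)]
    refine e2.trans ?_
    push_cast
    gcongr
    exact hmono (Nat.pow_le_pow_right (by norm_num) hq2)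
  have h2 : ((2 : ℝ) ^ J)⁻¹ •
      ex (trajLaw M π (trajLength Tmax (J + 1)) s)
        (fun l => ‖mlmc Tmax f (J + 1, l)‖ ^ 2) ≤ 2⁻¹ * σ (2 ^ J) := by
    rw [smul_eq_mul]
    have e2 := hq (J + 1) (by omega)
    rw [trajLength_of_lt hT0 (Nat.lt_succ_self _)] at e2 ⊢
    rw [Nat.cast_one, one_mul] at e2
    have h3 : (2 : ℝ) ≤ 2 ^ J := by
      calc (2 : ℝ) = 2 ^ 1 := by norm_num
        _ ≤ 2 ^ J := by gcongr; norm_num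
    exact mul_le_mul (by gcongr) (e2.trans (hmono Nat.one_le_two_pow))
      (ex_nonneg _ fun _ => sq_nonneg _) (by norm_num)
  refine (add_le_add (Finset.sum_le_sum h1) h2).trans ?_
  simp only [Finset.sum_const, Nat.card_Icc, Nat.add_sub_cancel, nsmul_eq_mul]
  rw [mul_assoc, hmean]
  have h4 : (1 : ℝ) ≤ J := by exact_mod_cast hJ
  nlinarith

end BatchMoment

/-! ### Additivity of the MLMC combination -/

section MlmcLinear

variable {Z E : Type*} [AddCommGroup E] [Module ℝ E]

theorem levelAvg_add (f g : Z → E) (l : List Z) (j : ℕ) :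
    levelAvg (fun z => f z + g z) l j = levelAvg f l j + levelAvg g l j := by
  rw [levelAvg, levelAvg, levelAvg, List.sum_map_add, smul_add]

theorem mlmc_add (Tmax : ℕ) (f g : Z → E) (b : ℕ × List Z) :
    mlmc Tmax (fun z => f z + g z) b = mlmc Tmax f b + mlmc Tmax g b := by
  simp only [mlmc, levelAvg_add]
  split_ifs
  · simp only [smul_sub, smul_add]; abel
  · abel

end MlmcLinear

/-! ### Consecutive batches -/

section Loop

variable {S A : Type*} [Fintype S] [DecidableEq S] [Fintype A] (M : CMDP S A) (π : S → PMF A)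

/-- The law of `n` consecutive batches with truncated levels. -/
def truncLoop (Tmax : ℕ) : ℕ → S → PMF (List (Batch S A))
  | 0, _ => PMF.pure []
  | n + 1, s => (truncBatch M π Tmax s).bind fun b =>
      (truncLoop Tmax n (endState s b)).map fun l => b :: l

instance (Tmax n : ℕ) (s : S) : FinSupp (truncLoop M π Tmax n s) := by
  induction n generalizing s with
  | zero => rw [truncLoop]; infer_instance
  | succ n ih => rw [truncLoop]; infer_instance

theorem ex_truncLoop_cons {E : Type*} [NormedAddCommGroup E] [NormedSpace ℝ E] (Tmax n : ℕ)
    (s : S) (f : List (Batch S A) → E) :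
    ex (truncLoop M π Tmax (n + 1) s) f = ex (truncBatch M π Tmax s) fun b =>
      ex (truncLoop M π Tmax n (endState s b)) fun l => f (b :: l) := by
  simp only [truncLoop, ex_bind, ex_map]

/-- The law is defined by its first batch, whereas the actor recursion is analysed through its last
one. -/
theorem ex_truncLoop_succ {E : Type*} [NormedAddCommGroup E] [NormedSpace ℝ E] (Tmax n : ℕ)
    (s : S) (f : List (Batch S A) → E) :
    ex (truncLoop M π Tmax (n + 1) s) f = ex (truncLoop M π Tmax n s) fun l =>
      ex (truncBatch M π Tmax (l.foldl endState s)) fun b => f (l ++ [b]) := by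
  induction n generalizing s f with
  | zero => simp [truncLoop, ex_bind, ex_map, ex_pure]
  | succ n ih =>
    rw [ex_truncLoop_cons, ex_truncLoop_cons]
    simp only [ih, List.foldl_cons, List.cons_append]

end Loop

/-! ### One actor step, second moments and the noiseless recursion -/

section Step

variable {S A : Type*} [Fintype S] [DecidableEq S] [Fintype A] {d m : ℕ}
  {M : CMDP S A} {X : Approximator S A d m} {Θ : Set (Param d)} {G₁ G₂ μ lam : ℝ} {θ : Param d}

/-- One actor step. -/
def actorStep (M : CMDP S A) (X : Approximator S A d m) (p : AlgParams d) (g : Signal)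
    (θ : Param d) (ξ : CriticVec m) (ω : Param d) (b : Batch S A) : Param d :=
  ω - p.γω • mlmc p.Tmax (fun z =>
    Matrix.toEuclideanLin (fisherSample X θ z) ω - gradSample M X g θ ξ z) b

theorem actorOut_append (M : CMDP S A) (X : Approximator S A d m) (p : AlgParams d)
    (g : Signal) (θ : Param d) (ξ : CriticVec m) (l : List (Batch S A)) (b : Batch S A) :
    actorOut M X p g θ ξ (l ++ [b]) = actorStep M X p g θ ξ (actorOut M X p g θ ξ l) b := by
  rw [actorOut, List.foldl_append]; rfl

/-- Shifting by ω^* separates the step into a part linear in the error and a forcing that does not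
depend on the iterate. -/
theorem actorStep_sub (M : CMDP S A) (X : Approximator S A d m) (p : AlgParams d)
    (g : Signal) (θ : Param d) (ξ : CriticVec m) (ω : Param d) (b : Batch S A) :
    actorStep M X p g θ ξ ω b - npgDir M X g θ = (ω - npgDir M X g θ) - p.γω •
      (mlmc p.Tmax (fun z => Matrix.toEuclideanLin (fisherSample X θ z) (ω - npgDir M X g θ)) b +
        mlmc p.Tmax (drift M X g θ ξ) b) := by
  rw [← mlmc_add, actorStep]
  have : (fun z => Matrix.toEuclideanLin (fisherSample X θ z) ω - gradSample M X g θ ξ z) =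
      fun z => Matrix.toEuclideanLin (fisherSample X θ z) (ω - npgDir M X g θ) +
        drift M X g θ ξ z := by
    funext z
    rw [drift, map_sub]
    abel
  rw [this]
  abel

/-- The spectrum of u uᵀ lies in [0, G₁²], so its distance to the midpoint G₁²/2 is at most half the
length. -/
theorem Regular.norm_fisherSample_sub_le (h : Regular M X Θ G₁ G₂ μ lam θ) (x : Param d)
    (z : S × A × S) :
    ‖Matrix.toEuclideanLin (fisherSample X θ z) x - (G₁ ^ 2 / 2) • x‖ ≤ G₁ ^ 2 / 2 * ‖x‖ := by
  refine (abs_le_of_sq_le_sq' ?_ (by positivity)).2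
  set u := score X θ z.1 z.2.1 with hu
  have h1 : ‖u‖ ^ 2 ≤ G₁ ^ 2 := pow_le_pow_left₀ (norm_nonneg _) (h.scoreBounds.bound θ h.mem _ _) 2
  rw [fisherSample_apply, norm_sub_sq_real, norm_smul, norm_smul, real_inner_smul_left,
    real_inner_smul_right, ← hu]
  have h2 : ‖inner ℝ u x‖ ^ 2 = inner ℝ u x ^ 2 := by rw [Real.norm_eq_abs, sq_abs]
  have h3 : ‖G₁ ^ 2 / 2‖ = G₁ ^ 2 / 2 := Real.norm_of_nonneg (by positivity)
  rw [mul_pow, h2, h3]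
  nlinarith [mul_nonneg (sq_nonneg (inner ℝ u x)) (sub_nonneg.2 h1)]

theorem Regular.le_mixTime (h : Regular M X Θ G₁ G₂ μ lam θ) :
    (M.mixTimeOf (X.π θ) : ℝ) ≤ mixTime M X Θ := by
  exact_mod_cast h.ergodic.mixTimeOf_le_mixTime X h.mem

theorem Regular.norm_mlmcMean_fisher_sub_le (h : Regular M X Θ G₁ G₂ μ lam θ) (Tmax : ℕ)
    (x : Param d) (s : S) :
    ‖mlmcMean M (X.π θ) Tmax (fun z => Matrix.toEuclideanLin (fisherSample X θ z) x) s -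
      Matrix.toEuclideanLin (fisher M X θ) x‖ ≤
      4 / 3 * G₁ ^ 2 * mixTime M X Θ * (2 ^ Nat.log 2 Tmax)⁻¹ * ‖x‖ := by
  rw [fisher_apply]
  refine (h.ergodic.norm_mlmcMean_sub_le (X.π θ) (by positivity)
    (h.norm_fisherSample_sub_le x) Tmax s).trans ?_
  have := h.le_mixTime
  calc _ ≤ ((2 : ℝ) ^ Nat.log 2 Tmax)⁻¹ * (G₁ ^ 2 / 2 * ‖x‖ * (8 / 3 * mixTime M X Θ)) := by
        gcongr
    _ = _ := by ring

/-- The mean and the fluctuation contribute 2 and 2·(44/3)/4 = 22/3, which add up to 28/3. -/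
theorem Regular.ex_norm_mlmc_fisher_sq_le (h : Regular M X Θ G₁ G₂ μ lam θ) {Tmax : ℕ}
    (hT : 2 ≤ Tmax) (x : Param d) (s : S) :
    ex (truncBatch M (X.π θ) Tmax s) (fun b => ‖mlmc Tmax
      (fun z => Matrix.toEuclideanLin (fisherSample X θ z) x) b‖ ^ 2) ≤
      28 / 3 * Nat.log 2 Tmax * mixTime M X Θ * G₁ ^ 4 * ‖x‖ ^ 2 := by
  have hJ : (1 : ℝ) ≤ Nat.log 2 Tmax := by exact_mod_cast Nat.log_pos (by norm_num) hT
  have hτ := h.one_le_mixTime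
  set f := fun z => Matrix.toEuclideanLin (fisherSample X θ z) x
  have h1 := h.ergodic.ex_norm_mlmc_sub_sq_le (X.π θ) (by positivity)
    (h.norm_fisherSample_sub_le x) hT s
  have h2 : ‖M.statExp (X.π θ) f‖ ^ 2 ≤ (G₁ ^ 2 * ‖x‖) ^ 2 := by
    rw [← fisher_apply]
    exact pow_le_pow_left₀ (norm_nonneg _) (norm_fisher_le M h.scoreBounds h.mem x) 2
  have h3 : ex (truncBatch M (X.π θ) Tmax s) (fun b => ‖mlmc Tmax f b‖ ^ 2) ≤
      ex (truncBatch M (X.π θ) Tmax s)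
        (fun b => 2 * ‖M.statExp (X.π θ) f‖ ^ 2 +
          2 * ‖mlmc Tmax f b - M.statExp (X.π θ) f‖ ^ 2) := by
    refine ex_mono _ fun b _ => ?_
    have e1 : ‖mlmc Tmax f b‖ ≤
        ‖M.statExp (X.π θ) f‖ + ‖mlmc Tmax f b - M.statExp (X.π θ) f‖ := by
      have := norm_add_le (M.statExp (X.π θ) f) (mlmc Tmax f b - M.statExp (X.π θ) f)
      rwa [add_sub_cancel] at this
    have e2 := pow_le_pow_left₀ (norm_nonneg _) e1 2
    nlinarith [sq_nonneg (‖M.statExp (X.π θ) f‖ - ‖mlmc Tmax f b - M.statExp (X.π θ) f‖)]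
  rw [ex_add, ex_const, ex_mul] at h3
  have h4 : (Nat.log 2 Tmax : ℝ) * (44 / 3 * M.mixTimeOf (X.π θ) * (G₁ ^ 2 / 2 * ‖x‖) ^ 2) ≤
      11 / 3 * (Nat.log 2 Tmax * mixTime M X Θ * G₁ ^ 4 * ‖x‖ ^ 2) := by
    calc _ ≤ (Nat.log 2 Tmax : ℝ) * (44 / 3 * mixTime M X Θ * (G₁ ^ 2 / 2 * ‖x‖) ^ 2) := by
          gcongr
          exact_mod_cast h.le_mixTime
      _ = _ := by ring
  have h5 : (G₁ ^ 2 * ‖x‖) ^ 2 ≤ Nat.log 2 Tmax * mixTime M X Θ * G₁ ^ 4 * ‖x‖ ^ 2 := by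
    calc _ = 1 * 1 * G₁ ^ 4 * ‖x‖ ^ 2 := by ring
      _ ≤ _ := by gcongr
  linarith

/-- For a single sample ‖F̂x‖² ≤ G₁²⟨x, F̂x⟩, and averaging over the window keeps this. The noise is
therefore controlled by the quadratic form that drives the descent, even when that form is far from
its stationary value. -/
theorem Regular.ex_norm_mlmc_fisher_sq_le_inner (h : Regular M X Θ G₁ G₂ μ lam θ) {Tmax : ℕ}
    (hT : 2 ≤ Tmax) (x : Param d) (s : S) :
    0 ≤ inner ℝ x (mlmcMean M (X.π θ) Tmax
        (fun z => Matrix.toEuclideanLin (fisherSample X θ z) x) s) ∧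
    ex (truncBatch M (X.π θ) Tmax s) (fun b => ‖mlmc Tmax
      (fun z => Matrix.toEuclideanLin (fisherSample X θ z) x) b‖ ^ 2) ≤
      3 / 2 * Nat.log 2 Tmax * 2 ^ Nat.log 2 Tmax * (G₁ ^ 2 *
        inner ℝ x (mlmcMean M (X.π θ) Tmax
        (fun z => Matrix.toEuclideanLin (fisherSample X θ z) x) s)) := by
  set f := fun z => Matrix.toEuclideanLin (fisherSample X θ z) x with hf
  have h1 : inner ℝ x (mlmcMean M (X.π θ) Tmax f s) =
      mlmcMean M (X.π θ) Tmax (fun z => inner ℝ (score X θ z.1 z.2.1) x ^ 2) s := by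
    simp only [mlmcMean, inner_smul_right, inner_sum, smul_eq_mul]
    congr 1
    refine Finset.sum_congr rfl fun t _ => ?_
    have := map_meanAt M (X.π θ) (innerSL ℝ x).toLinearMap f t s
    simp only [ContinuousLinearMap.coe_coe, innerSL_apply_apply] at this
    rw [this]
    congr 1
    funext z
    rw [hf]
    simp only [fisherSample_apply, inner_smul_right, real_inner_comm, sq]
  have h2 : mlmcMean M (X.π θ) Tmax (fun z => ‖f z‖ ^ 2) s ≤
      G₁ ^ 2 * mlmcMean M (X.π θ) Tmax (fun z => inner ℝ (score X θ z.1 z.2.1) x ^ 2) s := by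
    simp only [mlmcMean, smul_eq_mul]
    refine (mul_le_mul_of_nonneg_left ?_ (by positivity)).trans_eq (mul_left_comm _ _ _)
    rw [Finset.mul_sum]
    refine Finset.sum_le_sum fun t _ => ?_
    have := map_meanAt M (X.π θ) (LinearMap.mulLeft ℝ (G₁ ^ 2))
      (fun z => inner ℝ (score X θ z.1 z.2.1) x ^ 2) t s
    simp only [LinearMap.mulLeft_apply] at this
    rw [this]
    refine meanAt_mono M (X.π θ) (fun z => ?_) t s
    rw [hf]
    simp only [fisherSample_apply]
    rw [norm_smul, mul_pow, Real.norm_eq_abs, sq_abs, mul_comm]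
    exact mul_le_mul_of_nonneg_right
      (pow_le_pow_left₀ (norm_nonneg _) (h.scoreBounds.bound θ h.mem _ _) 2) (sq_nonneg _)
  rw [h1]
  refine ⟨mul_nonneg (by positivity) (Finset.sum_nonneg fun t _ =>
    meanAt_nonneg M _ (fun z => sq_nonneg _) t s), ?_⟩
  refine (ex_norm_mlmc_sq_le (X.π θ) f hT s).trans ?_
  gcongr

/-- Expansion of the second moment after one step. -/
theorem ex_norm_sub_smul_add_sq {α E : Type*} [NormedAddCommGroup E] [InnerProductSpace ℝ E]
    (q : PMF α) [FinSupp q] (x : E) (γ : ℝ) (U W : α → E) :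
    ex q (fun b => ‖x - γ • (U b + W b)‖ ^ 2) =
      ‖x‖ ^ 2 - 2 * γ * (inner ℝ x (ex q U) + inner ℝ x (ex q W)) +
        γ ^ 2 * ex q (fun b => ‖U b + W b‖ ^ 2) := by
  have h1 : ∀ b, ‖x - γ • (U b + W b)‖ ^ 2 =
      ‖x‖ ^ 2 - 2 * γ * (inner ℝ x (U b) + inner ℝ x (W b)) + γ ^ 2 * ‖U b + W b‖ ^ 2 := by
    intro b
    rw [norm_sub_sq_real, norm_smul, mul_pow, Real.norm_eq_abs, sq_abs, real_inner_smul_right,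
      inner_add_right]
    ring
  have h2 : ∀ U : α → E, inner ℝ x (ex q U) = ex q fun b => inner ℝ x (U b) := fun U =>
    map_ex q (innerSL ℝ x).toLinearMap U
  simp only [h1, h2, ex_add, ex_sub, ex_const, ex_mul]

theorem ex_norm_add_sq_le {α E : Type*} [NormedAddCommGroup E]
    (q : PMF α) [FinSupp q] {a : ℝ} (ha : 0 < a) (U W : α → E) :
    ex q (fun b => ‖U b + W b‖ ^ 2) ≤
      (1 + a) * ex q (fun b => ‖U b‖ ^ 2) + (1 + a⁻¹) * ex q (fun b => ‖W b‖ ^ 2) := by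
  rw [← ex_mul, ← ex_mul, ← ex_add]
  refine ex_mono _ fun b _ => ?_
  refine (pow_le_pow_left₀ (norm_nonneg _) (norm_add_le (U b) (W b)) 2).trans ?_
  have h1 : 2 * (‖U b‖ * ‖W b‖) ≤ a * ‖U b‖ ^ 2 + a⁻¹ * ‖W b‖ ^ 2 := by
    have h2 : 0 ≤ a⁻¹ * (a * ‖U b‖ - ‖W b‖) ^ 2 := by positivity
    have h3 : a⁻¹ * (a * ‖U b‖ - ‖W b‖) ^ 2 =
        a * ‖U b‖ ^ 2 + a⁻¹ * ‖W b‖ ^ 2 - 2 * (‖U b‖ * ‖W b‖) := by field_simp; ring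
    linarith
  nlinarith

/-- Contraction of the second moment in one actor step when the trajectories are long compared
to the mixing time. -/
theorem Regular.ex_norm_actorStep_sq_le (h : Regular M X Θ G₁ G₂ μ lam θ) {p : AlgParams d}
    (hT : 2 ≤ p.Tmax) (hγ0 : 0 ≤ p.γω)
    (hγ : 16 * G₁ ^ 4 * mixTime M X Θ * Nat.log 2 p.Tmax * p.γω ≤ μ)
    (hlong : 8 * G₁ ^ 2 * mixTime M X Θ ≤ μ * 2 ^ Nat.log 2 p.Tmax)
    (g : Signal) (ξ : CriticVec m) (ω : Param d) (s : S) {D₁ D₂ : ℝ}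
    (hD₁ : ‖mlmcMean M (X.π θ) p.Tmax (drift M X g θ ξ) s‖ ^ 2 ≤ D₁)
    (hD₂ : ex (truncBatch M (X.π θ) p.Tmax s)
      (fun b => ‖mlmc p.Tmax (drift M X g θ ξ) b‖ ^ 2) ≤ D₂) :
    ex (truncBatch M (X.π θ) p.Tmax s)
      (fun b => ‖actorStep M X p g θ ξ ω b - npgDir M X g θ‖ ^ 2) ≤
      (1 - p.γω * μ) * ‖ω - npgDir M X g θ‖ ^ 2 +
        p.γω * (24 / μ * D₁ + 15 * p.γω * D₂) := by
  have hμ := h.μ_pos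
  set γ := p.γω
  set x := ω - npgDir M X g θ with hx
  set U := mlmc p.Tmax (fun z => Matrix.toEuclideanLin (fisherSample X θ z) x)
  set W := mlmc p.Tmax (drift M X g θ ξ)
  set q := truncBatch M (X.π θ) p.Tmax s
  have hT0 : p.Tmax ≠ 0 := by omega
  simp only [actorStep_sub]
  rw [ex_norm_sub_smul_add_sq, ex_mlmc M (X.π θ) hT0, ex_mlmc M (X.π θ) hT0]
  set mU := mlmcMean M (X.π θ) p.Tmax
    (fun z => Matrix.toEuclideanLin (fisherSample X θ z) x) s with hmU
  set mW := mlmcMean M (X.π θ) p.Tmax (drift M X g θ ξ) s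
  -- The budget in units of μ is 2·(5/6) − 1/24 − 5/8 = 1: descent with the MLMC bias kept below
  -- μ/6, the cross term with the drift, and the quadratic noise.
  have h1 : 5 / 6 * μ * ‖x‖ ^ 2 ≤ inner ℝ x mU := by
    have e1 := h.nondeg.le_inner h.mem x
    have e2 := h.norm_mlmcMean_fisher_sub_le p.Tmax x s
    rw [← hmU] at e2
    have e3 : 4 / 3 * G₁ ^ 2 * mixTime M X Θ * (2 ^ Nat.log 2 p.Tmax)⁻¹ ≤ μ / 6 := by
      rw [← div_eq_mul_inv, div_le_iff₀ (by positivity)]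
      linarith
    have e4 : ‖mU - Matrix.toEuclideanLin (fisher M X θ) x‖ ≤ μ / 6 * ‖x‖ :=
      e2.trans (mul_le_mul_of_nonneg_right e3 (norm_nonneg _))
    have e5 : -(‖x‖ * (μ / 6 * ‖x‖)) ≤
        inner ℝ x (mU - Matrix.toEuclideanLin (fisher M X θ) x) := by
      have := (abs_le.1 (abs_real_inner_le_norm x
        (mU - Matrix.toEuclideanLin (fisher M X θ) x))).1
      have e6 := mul_le_mul_of_nonneg_left e4 (norm_nonneg x)
      linarith
    rw [inner_sub_right] at e5
    nlinarith
  have h2 : -(2 * inner ℝ x mW) ≤ μ / 24 * ‖x‖ ^ 2 + 24 / μ * D₁ := by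
    have e1 := (abs_le.1 (abs_real_inner_le_norm x mW)).1
    have e2 : 0 ≤ 24 / μ * (μ / 24 * ‖x‖ - ‖mW‖) ^ 2 := by positivity
    have e3 : 24 / μ * (μ / 24 * ‖x‖ - ‖mW‖) ^ 2 =
        μ / 24 * ‖x‖ ^ 2 + 24 / μ * ‖mW‖ ^ 2 - 2 * (‖x‖ * ‖mW‖) := by field_simp; ring
    have e4 : 24 / μ * ‖mW‖ ^ 2 ≤ 24 / μ * D₁ := by gcongr
    linarith
  have h3 : γ * ex q (fun b => ‖U b + W b‖ ^ 2) ≤ 5 / 8 * μ * ‖x‖ ^ 2 + 15 * γ * D₂ := by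
    -- With a = 1/14 the linear part costs (15/14)·(7/12) = 5/8 and the drift has the factor 1 + 14
    -- = 15.
    have e1 := ex_norm_add_sq_le q (a := 1 / 14) (by norm_num) U W
    have e2 := h.ex_norm_mlmc_fisher_sq_le hT x s
    have e3 : γ * ex q (fun b => ‖U b‖ ^ 2) ≤ 7 / 12 * μ * ‖x‖ ^ 2 := by
      calc _ ≤ γ * (28 / 3 * Nat.log 2 p.Tmax * mixTime M X Θ * G₁ ^ 4 * ‖x‖ ^ 2) := by
            gcongr
        _ = 7 / 12 * (16 * G₁ ^ 4 * mixTime M X Θ * Nat.log 2 p.Tmax * γ) * ‖x‖ ^ 2 := by ring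
        _ ≤ _ := by gcongr
    have e4 := mul_le_mul_of_nonneg_left e1 hγ0
    have e5 := mul_le_mul_of_nonneg_left hD₂ hγ0
    norm_num at e4
    linarith
  have h4 := mul_le_mul_of_nonneg_left h1 hγ0
  have h5 := mul_le_mul_of_nonneg_left h2 hγ0
  have h6 := mul_le_mul_of_nonneg_left h3 hγ0
  rw [← mul_assoc, ← sq] at h6
  linarith

/-- The second moment after one actor step when the trajectories are short. -/
theorem Regular.ex_norm_actorStep_sq_le_of_short (h : Regular M X Θ G₁ G₂ μ lam θ)
    {p : AlgParams d} (hT : 2 ≤ p.Tmax) (hγ0 : 0 ≤ p.γω)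
    (hγ : 16 * G₁ ^ 4 * mixTime M X Θ * Nat.log 2 p.Tmax * p.γω ≤ μ)
    (hshort : μ * 2 ^ Nat.log 2 p.Tmax ≤ 8 * G₁ ^ 2 * mixTime M X Θ)
    (g : Signal) (ξ : CriticVec m) (ω : Param d) (s : S) {D₁ D₂ κ : ℝ} (hκ : 0 < κ)
    (hD₁ : ‖mlmcMean M (X.π θ) p.Tmax (drift M X g θ ξ) s‖ ^ 2 ≤ D₁)
    (hD₂ : ex (truncBatch M (X.π θ) p.Tmax s)
      (fun b => ‖mlmc p.Tmax (drift M X g θ ξ) b‖ ^ 2) ≤ D₂) :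
    ex (truncBatch M (X.π θ) p.Tmax s)
      (fun b => ‖actorStep M X p g θ ξ ω b - npgDir M X g θ‖ ^ 2) ≤
      (1 + p.γω * κ) * ‖ω - npgDir M X g θ‖ ^ 2 +
        p.γω * (κ⁻¹ * D₁ + 2 * p.γω * D₂) := by
  have hμ := h.μ_pos
  set γ := p.γω
  set x := ω - npgDir M X g θ with hx
  set U := mlmc p.Tmax (fun z => Matrix.toEuclideanLin (fisherSample X θ z) x)
  set W := mlmc p.Tmax (drift M X g θ ξ)
  set q := truncBatch M (X.π θ) p.Tmax s
  have hT0 : p.Tmax ≠ 0 := by omega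
  simp only [actorStep_sub]
  rw [ex_norm_sub_smul_add_sq, ex_mlmc M (X.π θ) hT0, ex_mlmc M (X.π θ) hT0]
  obtain ⟨h1, e2⟩ := h.ex_norm_mlmc_fisher_sq_le_inner hT x s
  set mU := mlmcMean M (X.π θ) p.Tmax
    (fun z => Matrix.toEuclideanLin (fisherSample X θ z) x) s with hmU
  set mW := mlmcMean M (X.π θ) p.Tmax (drift M X g θ ξ) s
  have h2 : -(2 * inner ℝ x mW) ≤ κ * ‖x‖ ^ 2 + κ⁻¹ * D₁ := by
    have e1 := (abs_le.1 (abs_real_inner_le_norm x mW)).1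
    have e2 : 0 ≤ κ⁻¹ * (κ * ‖x‖ - ‖mW‖) ^ 2 := by positivity
    have e3 : κ⁻¹ * (κ * ‖x‖ - ‖mW‖) ^ 2 =
        κ * ‖x‖ ^ 2 + κ⁻¹ * ‖mW‖ ^ 2 - 2 * (‖x‖ * ‖mW‖) := by field_simp; ring
    have e4 : κ⁻¹ * ‖mW‖ ^ 2 ≤ κ⁻¹ * D₁ := by gcongr
    linarith
  have h3 : γ * ex q (fun b => ‖U b + W b‖ ^ 2) ≤ 2 * inner ℝ x mU + 2 * γ * D₂ := by
    have e1 := ex_norm_add_sq_le q (a := 1) (by norm_num) U W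
    -- Shortness replaces μ 2^J by 8 G₁² τ, after which the step size condition applies. The noise
    -- of the linear part is then at most (3/2)⟨x, mU⟩, which the descent 2⟨x, mU⟩ absorbs.
    have e6 : γ * (Nat.log 2 p.Tmax * 2 ^ Nat.log 2 p.Tmax * G₁ ^ 2) ≤ 1 / 2 := by
      refine le_of_mul_le_mul_left ?_ hμ
      calc _ = (γ * Nat.log 2 p.Tmax * G₁ ^ 2) * (μ * 2 ^ Nat.log 2 p.Tmax) := by ring
        _ ≤ (γ * Nat.log 2 p.Tmax * G₁ ^ 2) * (8 * G₁ ^ 2 * mixTime M X Θ) := by gcongr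
        _ = 1 / 2 * (16 * G₁ ^ 4 * mixTime M X Θ * Nat.log 2 p.Tmax * γ) := by ring
        _ ≤ _ := by linarith
    have e3 : γ * ex q (fun b => ‖U b‖ ^ 2) ≤ 3 / 4 * inner ℝ x mU := by
      calc _ ≤ γ * (3 / 2 * Nat.log 2 p.Tmax * 2 ^ Nat.log 2 p.Tmax *
              (G₁ ^ 2 * inner ℝ x mU)) := by gcongr
        _ = 3 / 2 * (γ * (Nat.log 2 p.Tmax * 2 ^ Nat.log 2 p.Tmax * G₁ ^ 2)) *
              inner ℝ x mU := by ring
        _ ≤ 3 / 2 * (1 / 2) * inner ℝ x mU := by gcongr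
        _ = _ := by ring
    have e4 := mul_le_mul_of_nonneg_left e1 hγ0
    have e5 := mul_le_mul_of_nonneg_left hD₂ hγ0
    norm_num at e4
    linarith
  have h5 := mul_le_mul_of_nonneg_left h2 hγ0
  have h6 := mul_le_mul_of_nonneg_left h3 hγ0
  rw [← mul_assoc, ← sq] at h6
  linarith

/-- A one-step bound uniform in the starting state iterates along the chain. The loop starts at ω =
0, so the initial error is ω^*. -/
theorem ex_norm_actorOut_sq_le (p : AlgParams d) (g : Signal) (ξ : CriticVec m) {ρ D : ℝ}
    (hρ : 0 ≤ ρ)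
    (hstep : ∀ s ω, ex (truncBatch M (X.π θ) p.Tmax s)
      (fun b => ‖actorStep M X p g θ ξ ω b - npgDir M X g θ‖ ^ 2) ≤
        ρ * ‖ω - npgDir M X g θ‖ ^ 2 + D) (n : ℕ) (s : S) :
    ex (truncLoop M (X.π θ) p.Tmax n s)
      (fun l => ‖actorOut M X p g θ ξ l - npgDir M X g θ‖ ^ 2) ≤
      ρ ^ n * ‖npgDir M X g θ‖ ^ 2 + D * ∑ i ∈ Finset.range n, ρ ^ i := by
  induction n with
  | zero => simp [truncLoop, ex_pure, actorOut]
  | succ n ih =>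
    rw [ex_truncLoop_succ]
    simp only [actorOut_append]
    refine (ex_mono _ fun l _ => hstep _ _).trans ?_
    rw [ex_add, ex_mul, ex_const, pow_succ', Finset.sum_range_succ']
    have := mul_le_mul_of_nonneg_left ih hρ
    have e : ∑ i ∈ Finset.range n, ρ ^ (i + 1) = ρ * ∑ i ∈ Finset.range n, ρ ^ i := by
      rw [Finset.mul_sum]; exact Finset.sum_congr rfl fun i _ => pow_succ' _ _
    rw [e]
    simp only [pow_zero]
    linarith

/-- The noiseless actor recursion with constant drift `v`, relative to its target. -/
def detIter (M : CMDP S A) (X : Approximator S A d m) (θ : Param d) (γ : ℝ) (y v : Param d) :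
    ℕ → Param d
  | 0 => y
  | n + 1 => detIter M X θ γ y v n -
      γ • (Matrix.toEuclideanLin (fisher M X θ) (detIter M X θ γ y v n) + v)

theorem ex_detIter {α : Type*} (q : PMF α) [FinSupp q] (γ : ℝ) (y : Param d) (v : α → Param d)
    (n : ℕ) : ex q (fun a => detIter M X θ γ y (v a) n) = detIter M X θ γ y (ex q v) n := by
  induction n with
  | zero => exact ex_const q y
  | succ n ih =>
    simp only [detIter, ex_sub, ex_smul, ex_add, ih]
    rw [← ih, map_ex]

/-- By cocoercivity half of the descent 2γ⟨x, Fx⟩ pays for γ²‖Fx‖². The other half leaves (1 −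
γμ)‖x‖², which is at most (1 − γμ/2)²‖x‖². -/
theorem Regular.norm_sub_smul_fisher_le (h : Regular M X Θ G₁ G₂ μ lam θ) {γ : ℝ} (hγ0 : 0 ≤ γ)
    (hγ : γ * G₁ ^ 2 ≤ 1) (hγμ : γ * μ ≤ 1) (x : Param d) :
    ‖x - γ • Matrix.toEuclideanLin (fisher M X θ) x‖ ≤ (1 - γ * μ / 2) * ‖x‖ := by
  refine (abs_le_of_sq_le_sq' ?_ (mul_nonneg (by linarith) (norm_nonneg _))).2
  have h1 := h.nondeg.le_inner h.mem x
  have h2 := norm_fisher_sq_le M h.scoreBounds h.mem x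
  set i := inner ℝ x (Matrix.toEuclideanLin (fisher M X θ) x)
  have hi : 0 ≤ i := (mul_nonneg h.μ_pos.le (sq_nonneg _)).trans h1
  rw [norm_sub_sq_real, norm_smul, mul_pow, Real.norm_eq_abs, sq_abs, real_inner_smul_right]
  have h3 : γ ^ 2 * ‖Matrix.toEuclideanLin (fisher M X θ) x‖ ^ 2 ≤ γ * i := by
    calc _ ≤ γ ^ 2 * (G₁ ^ 2 * i) := by gcongr
      _ = (γ * i) * (γ * G₁ ^ 2) := by ring
      _ ≤ (γ * i) * 1 := by gcongr
      _ = _ := mul_one _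
  have h4 := mul_le_mul_of_nonneg_left h1 hγ0
  nlinarith [mul_nonneg (sq_nonneg (γ * μ / 2)) (sq_nonneg ‖x‖)]

theorem norm_le_geom {E : Type*} [NormedAddCommGroup E] {v : ℕ → E} {ρ D : ℝ} (hρ : 0 ≤ ρ)
    {N : ℕ} (h : ∀ n < N, ‖v (n + 1)‖ ≤ ρ * ‖v n‖ + D) {n : ℕ} (hn : n ≤ N) :
    ‖v n‖ ≤ ρ ^ n * ‖v 0‖ + D * ∑ i ∈ Finset.range n, ρ ^ i := by
  induction n with
  | zero => simp
  | succ n ih =>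
    refine (h n (by omega)).trans ?_
    rw [pow_succ', Finset.sum_range_succ']
    have := mul_le_mul_of_nonneg_left (ih (by omega)) hρ
    have e : ∑ i ∈ Finset.range n, ρ ^ (i + 1) = ρ * ∑ i ∈ Finset.range n, ρ ^ i := by
      rw [Finset.mul_sum]; exact Finset.sum_congr rfl fun i _ => pow_succ' _ _
    rw [e]
    simp only [pow_zero]
    linarith

theorem Regular.norm_detIter_succ_le (h : Regular M X Θ G₁ G₂ μ lam θ) {γ : ℝ} (hγ0 : 0 ≤ γ)
    (hγ : γ * G₁ ^ 2 ≤ 1) (hγμ : γ * μ ≤ 1) (y v : Param d) (n : ℕ) :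
    ‖detIter M X θ γ y v (n + 1)‖ ≤
      (1 - γ * μ / 2) * ‖detIter M X θ γ y v n‖ + γ * ‖v‖ := by
  rw [detIter, smul_add, ← sub_sub]
  refine (norm_sub_le _ _).trans (add_le_add (h.norm_sub_smul_fisher_le hγ0 hγ hγμ _) ?_)
  rw [norm_smul, Real.norm_of_nonneg hγ0]

/-- The mean of the actor iterates follows the noiseless recursion up to the bias of the
multi-level estimates. -/
theorem Regular.norm_ex_actorOut_sub_detIter_le (h : Regular M X Θ G₁ G₂ μ lam θ)
    {p : AlgParams d} (hT : 2 ≤ p.Tmax) (hγ0 : 0 ≤ p.γω) (hγ : p.γω * G₁ ^ 2 ≤ 1)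
    (hγμ : p.γω * μ ≤ 1) (g : Signal) (ξ : CriticVec m) (s : S) {e₁ e₂ R : ℝ} (he₁ : 0 ≤ e₁)
    (hU : ∀ x s, ‖mlmcMean M (X.π θ) p.Tmax
      (fun z => Matrix.toEuclideanLin (fisherSample X θ z) x) s -
        Matrix.toEuclideanLin (fisher M X θ) x‖ ≤ e₁ * ‖x‖)
    (hW : ∀ s, ‖mlmcMean M (X.π θ) p.Tmax (drift M X g θ ξ) s - meanDrift M X g θ ξ‖ ≤ e₂)
    {N : ℕ} (hR : ∀ n < N, ex (truncLoop M (X.π θ) p.Tmax n s)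
      (fun l => ‖actorOut M X p g θ ξ l - npgDir M X g θ‖) ≤ R) :
    ‖ex (truncLoop M (X.π θ) p.Tmax N s) (fun l => actorOut M X p g θ ξ l - npgDir M X g θ) -
      detIter M X θ p.γω (-npgDir M X g θ) (meanDrift M X g θ ξ) N‖ ≤
      p.γω * (e₁ * R + e₂) * ∑ i ∈ Finset.range N, (1 - p.γω * μ / 2) ^ i := by
  have hT0 : p.Tmax ≠ 0 := by omega
  set F := Matrix.toEuclideanLin (fisher M X θ)
  set x := fun l => actorOut M X p g θ ξ l - npgDir M X g θ with hx
  set mn := fun n => ex (truncLoop M (X.π θ) p.Tmax n s) x with hmn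
  set y := detIter M X θ p.γω (-npgDir M X g θ) (meanDrift M X g θ ξ) with hy
  have hstep : ∀ n < N, ‖mn (n + 1) - y (n + 1)‖ ≤
      (1 - p.γω * μ / 2) * ‖mn n - y n‖ + p.γω * (e₁ * R + e₂) := by
    intro n hn
    set q := truncLoop M (X.π θ) p.Tmax n s
    set u := fun l : List (Batch S A) => mlmcMean M (X.π θ) p.Tmax
      (fun z => Matrix.toEuclideanLin (fisherSample X θ z) (x l)) (l.foldl endState s)
    set w := fun l : List (Batch S A) =>
      mlmcMean M (X.π θ) p.Tmax (drift M X g θ ξ) (l.foldl endState s)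
    have e1 : mn (n + 1) = ex q (fun l => x l - p.γω • (u l + w l)) := by
      simp only [hmn]
      rw [ex_truncLoop_succ]
      congr 1
      funext l
      simp only [hx, actorOut_append, actorStep_sub, ex_sub, ex_const, ex_smul, ex_add,
        ex_mlmc M (X.π θ) hT0]
      rfl
    -- The difference of the two recursions contracts under I − γF and is forced only by the MLMC
    -- biases of the linear part and of the drift.
    have e2 : mn (n + 1) - y (n + 1) = ((mn n - y n) - p.γω • F (mn n - y n)) -
        p.γω • ex q (fun l => (u l - F (x l)) + (w l - meanDrift M X g θ ξ)) := by
      rw [e1]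
      simp only [ex_sub, ex_add, ex_smul, ex_const, ← map_ex]
      have : y (n + 1) = y n - p.γω • (F (y n) + meanDrift M X g θ ξ) := rfl
      rw [this]
      change mn n - _ - _ = mn n - y n - p.γω • F (mn n - y n) - p.γω • (ex q u - F (mn n) + _)
      rw [map_sub]
      module
    rw [e2]
    refine (norm_sub_le _ _).trans (add_le_add (h.norm_sub_smul_fisher_le hγ0 hγ hγμ _) ?_)
    rw [norm_smul, Real.norm_of_nonneg hγ0]
    refine mul_le_mul_of_nonneg_left ?_ hγ0
    refine (norm_ex_le _ _).trans ?_
    calc _ ≤ ex q (fun l => e₁ * ‖x l‖ + e₂) := ex_mono _ fun l _ =>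
          (norm_add_le _ _).trans (add_le_add (hU _ _) (hW _))
      _ = e₁ * ex q (fun l => ‖x l‖) + e₂ := by rw [ex_add, ex_mul, ex_const]
      _ ≤ _ := by
          have := mul_le_mul_of_nonneg_left (hR n hn) he₁
          linarith
  have h0 : mn 0 - y 0 = 0 := by
    simp [hmn, hy, hx, truncLoop, ex_pure, actorOut, detIter]
  have hfin := norm_le_geom (v := fun n => mn n - y n) (by linarith) hstep le_rfl
  simp only [h0, norm_zero, mul_zero, zero_add] at hfin
  exact hfin

end Step

/-! ### The actor loop under the prescribed step size -/

section Actor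

variable {S A : Type*} [Fintype S] [DecidableEq S] [Fintype A] {d m : ℕ}

/-- The hypotheses of the actor analysis at a parameter `θ`. -/
structure ActorSetup (M : CMDP S A) (X : Approximator S A d m) (Θ : Set (Param d))
    (G₁ G₂ μ lam : ℝ) (p : AlgParams d) (T : ℕ) (θ : Param d) : Prop
    extends Regular M X Θ G₁ G₂ μ lam θ where
  cγ_pos : 0 < p.cγ
  bdd : ∀ g, BddAbove (criticErrorAt M X p.cγ g '' Θ)
  T_pos : 1 ≤ T
  H_pos : 1 ≤ p.H
  two_le : 2 ≤ p.Tmax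
  γω_eq : p.γω = 2 * Real.log T / (μ * p.H)
  γω_le : p.γω ≤ μ / (4 * (6 * G₁ ^ 4 * mixTime M X Θ * Real.log p.Tmax +
    2 * G₁ ^ 2 * (mixTime M X Θ : ℝ) ^ 2 * Real.log p.Tmax))
  μ_le : μ ≤ G₁ ^ 2

/-- A bound on the square of the drift in units of `τ² + ‖ξ - ξ^*‖²`. -/
def driftConst (G₁ μ lam : ℝ) : ℝ :=
  2 * (5 * G₁ ^ 3 / μ + G₁ * (2 + 4 / lam)) ^ 2 + 18 * G₁ ^ 2

variable {M : CMDP S A} {X : Approximator S A d m} {Θ : Set (Param d)} {G₁ G₂ μ lam : ℝ}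
  {p : AlgParams d} {T : ℕ} {θ : Param d}

theorem epsApp_nonneg (M : CMDP S A) (X : Approximator S A d m) (cγ : ℝ) (Θ : Set (Param d)) :
    0 ≤ epsApp M X cγ Θ := by
  refine le_max_of_le_left (Real.sSup_nonneg ?_)
  rintro _ ⟨θ, -, rfl⟩
  exact Finset.sum_nonneg fun s _ => mul_nonneg ((M.stat_spec _).1 s) (sq_nonneg _)

namespace ActorSetup

theorem log_T_nonneg (h : ActorSetup M X Θ G₁ G₂ μ lam p T θ) : 0 ≤ Real.log T :=
  Real.log_nonneg (by exact_mod_cast h.T_pos)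

theorem level_pos (h : ActorSetup M X Θ G₁ G₂ μ lam p T θ) : (1 : ℝ) ≤ Nat.log 2 p.Tmax := by
  exact_mod_cast Nat.log_pos (by norm_num) h.two_le

theorem level_le (h : ActorSetup M X Θ G₁ G₂ μ lam p T θ) :
    (Nat.log 2 p.Tmax : ℝ) ≤ 3 / 2 * Real.log p.Tmax := by
  have h0 : p.Tmax ≠ 0 := by have := h.two_le; omega
  have h1 : ((2 : ℝ) ^ Nat.log 2 p.Tmax) ≤ p.Tmax := by
    exact_mod_cast Nat.pow_log_le_self 2 h0
  have h2 := Real.log_le_log (by positivity) h1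
  rw [Real.log_pow] at h2
  have h3 := Real.log_two_gt_d9
  have h4 := h.level_pos
  nlinarith

theorem le_two_mul_two_pow_log (n : ℕ) : (n : ℝ) ≤ 2 * 2 ^ Nat.log 2 n := by
  have h1 : n < 2 ^ (Nat.log 2 n + 1) := Nat.lt_pow_succ_log_self (by norm_num) _
  have h2 : (n : ℝ) < 2 ^ (Nat.log 2 n + 1) := by exact_mod_cast h1
  rw [pow_succ] at h2
  linarith

theorem γω_nonneg (h : ActorSetup M X Θ G₁ G₂ μ lam p T θ) : 0 ≤ p.γω := by
  rw [h.γω_eq]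
  have := h.log_T_nonneg
  have := h.μ_pos
  positivity

theorem γω_mul_H (h : ActorSetup M X Θ G₁ G₂ μ lam p T θ) :
    p.γω * μ * p.H = 2 * Real.log T := by
  have h1 := h.μ_pos
  have h2 : (0 : ℝ) < p.H := by exact_mod_cast h.H_pos
  rw [h.γω_eq]
  field_simp

/-- Only the first summand of the step size bound is needed: 4·6 = 16·(3/2), with J ≤ (3/2) log
T_max. -/
theorem γω_small (h : ActorSetup M X Θ G₁ G₂ μ lam p T θ) :
    16 * G₁ ^ 4 * mixTime M X Θ * Nat.log 2 p.Tmax * p.γω ≤ μ := by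
  have hG := h.G₁_pos
  have hτ := h.one_le_mixTime
  have hJ := h.level_pos
  have hJL := h.level_le
  have hγ := h.γω_nonneg
  set τ : ℝ := (mixTime M X Θ : ℝ)
  set L := Real.log p.Tmax
  have hL : 0 < L := by linarith
  have h1 : p.γω * (4 * (6 * G₁ ^ 4 * τ * L + 2 * G₁ ^ 2 * τ ^ 2 * L)) ≤ μ :=
    (le_div_iff₀ (by positivity)).1 h.γω_le
  have h2 : 0 ≤ p.γω * (8 * G₁ ^ 2 * τ ^ 2 * L) := by positivity
  have h3 : 16 * G₁ ^ 4 * τ * Nat.log 2 p.Tmax * p.γω ≤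
      16 * G₁ ^ 4 * τ * (3 / 2 * L) * p.γω := by gcongr
  linarith

theorem γω_mul_sq_le (h : ActorSetup M X Θ G₁ G₂ μ lam p T θ) : p.γω * G₁ ^ 2 ≤ 1 := by
  have hG := h.G₁_pos
  have hτ := h.one_le_mixTime
  have hJ := h.level_pos
  have hγ := h.γω_nonneg
  have h1 := h.γω_small
  have h2 : G₁ ^ 4 * 1 * 1 * p.γω ≤ 16 * G₁ ^ 4 * mixTime M X Θ * Nat.log 2 p.Tmax * p.γω := by
    gcongr
    linarith [pow_pos hG 4]
  have h3 : G₁ ^ 2 * (p.γω * G₁ ^ 2) ≤ G₁ ^ 2 * 1 := by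
    have := h.μ_le
    nlinarith
  exact le_of_mul_le_mul_left h3 (by positivity)

theorem γω_mul_μ_le (h : ActorSetup M X Θ G₁ G₂ μ lam p T θ) : p.γω * μ ≤ 1 :=
  (mul_le_mul_of_nonneg_left h.μ_le h.γω_nonneg).trans h.γω_mul_sq_le

theorem criticErrorAt_le (h : ActorSetup M X Θ G₁ G₂ μ lam p T θ) (g : Signal) :
    criticErrorAt M X p.cγ g θ ≤ epsApp M X p.cγ Θ := by
  have h1 := le_csSup (h.bdd g) ⟨θ, h.mem, rfl⟩
  cases g
  · exact h1.trans (le_max_left _ _)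
  · exact h1.trans (le_max_right _ _)

theorem norm_meanDrift_sq_le (h : ActorSetup M X Θ G₁ G₂ μ lam p T θ) (g : Signal)
    (ξ : CriticVec m) : ‖meanDrift M X g θ ξ‖ ^ 2 ≤
      2 * G₁ ^ 2 * (epsApp M X p.cγ Θ + ‖ξ - criticOpt M X p.cγ g θ‖ ^ 2) := by
  have hG := h.G₁_pos
  have h0 : 0 ≤ criticErrorAt M X p.cγ g θ :=
    Finset.sum_nonneg fun s _ => mul_nonneg ((M.stat_spec _).1 s) (sq_nonneg _)
  have h1 := pow_le_pow_left₀ (norm_nonneg _) (h.norm_meanDrift_le g p.cγ ξ) 2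
  have h2 := h.criticErrorAt_le g
  set y := ‖ξ - criticOpt M X p.cγ g θ‖
  set r := √(criticErrorAt M X p.cγ g θ)
  have h3 : r ^ 2 = criticErrorAt M X p.cγ g θ := Real.sq_sqrt h0
  calc _ ≤ (G₁ * (r + y)) ^ 2 := h1
    _ ≤ 2 * G₁ ^ 2 * (r ^ 2 + y ^ 2) := by nlinarith [mul_nonneg (sq_nonneg G₁) (sq_nonneg (r - y))]
    _ ≤ _ := by rw [h3]; gcongr

/-- A uniform bound on the drift. -/
def driftBound (M : CMDP S A) (X : Approximator S A d m) (Θ : Set (Param d)) (G₁ μ lam : ℝ)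
    (y : ℝ) : ℝ :=
  (5 * G₁ ^ 3 / μ + G₁ * (2 + 4 / lam)) * mixTime M X Θ + 3 * G₁ * y

theorem driftBound_nonneg (h : ActorSetup M X Θ G₁ G₂ μ lam p T θ) {y : ℝ} (hy : 0 ≤ y) :
    0 ≤ driftBound M X Θ G₁ μ lam y := by
  have := h.G₁_pos
  have := h.μ_pos
  have := h.lam_pos
  rw [driftBound]
  positivity

theorem driftBound_sq_le (y : ℝ) :
    driftBound M X Θ G₁ μ lam y ^ 2 ≤
      driftConst G₁ μ lam * ((mixTime M X Θ : ℝ) ^ 2 + y ^ 2) := by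
  rw [driftBound, driftConst]
  set b := 5 * G₁ ^ 3 / μ + G₁ * (2 + 4 / lam)
  set τ : ℝ := (mixTime M X Θ : ℝ)
  nlinarith [sq_nonneg (b * τ - 3 * G₁ * y), mul_nonneg (sq_nonneg b) (sq_nonneg y),
    mul_nonneg (sq_nonneg G₁) (sq_nonneg τ)]

theorem driftConst_nonneg : 0 ≤ driftConst G₁ μ lam := by
  rw [driftConst]; positivity

theorem norm_drift_le_driftBound (h : ActorSetup M X Θ G₁ G₂ μ lam p T θ) (g : Signal)
    (ξ : CriticVec m) (z : S × A × S) : ‖drift M X g θ ξ z‖ ≤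
    driftBound M X Θ G₁ μ lam ‖ξ - criticOpt M X p.cγ g θ‖ :=
  h.norm_drift_le g h.cγ_pos ξ z

/-- Crude bound by the supremum of the drift; it suffices for short trajectories, where the window
average need not be close to the stationary mean. -/
theorem norm_mlmcMean_drift_sq_le (h : ActorSetup M X Θ G₁ G₂ μ lam p T θ) (g : Signal)
    (ξ : CriticVec m) (s : S) :
    ‖mlmcMean M (X.π θ) p.Tmax (drift M X g θ ξ) s‖ ^ 2 ≤
    driftConst G₁ μ lam *
      ((mixTime M X Θ : ℝ) ^ 2 + ‖ξ - criticOpt M X p.cγ g θ‖ ^ 2) :=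
  (pow_le_pow_left₀ (norm_nonneg _) (norm_mlmcMean_le M (X.π θ)
    (h.norm_drift_le_driftBound g ξ) p.Tmax s) 2).trans (driftBound_sq_le _)

theorem norm_mlmcMean_drift_sub_le (h : ActorSetup M X Θ G₁ G₂ μ lam p T θ) (g : Signal)
    (ξ : CriticVec m) (s : S) :
    ‖mlmcMean M (X.π θ) p.Tmax (drift M X g θ ξ) s - meanDrift M X g θ ξ‖ ≤
      8 / 3 * (mixTime M X Θ / 2 ^ Nat.log 2 p.Tmax) *
        driftBound M X Θ G₁ μ lam ‖ξ - criticOpt M X p.cγ g θ‖ := by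
  have hB := h.driftBound_nonneg (norm_nonneg (ξ - criticOpt M X p.cγ g θ))
  refine (h.ergodic.norm_mlmcMean_sub_le (X.π θ) (c := 0) hB (fun z => ?_) p.Tmax s).trans ?_
  · rw [sub_zero]; exact h.norm_drift_le_driftBound g ξ z
  · have := h.le_mixTime
    calc _ ≤ ((2 : ℝ) ^ Nat.log 2 p.Tmax)⁻¹ *
          (driftBound M X Θ G₁ μ lam ‖ξ - criticOpt M X p.cγ g θ‖ *
            (8 / 3 * mixTime M X Θ)) := by gcongr
      _ = _ := by ring

/-- Sharp bound for long trajectories: the stationary drift is governed by the critic error, and the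
remaining mixing bias carries (τ/2^J)². -/
theorem norm_mlmcMean_drift_sq_le_add (h : ActorSetup M X Θ G₁ G₂ μ lam p T θ) (g : Signal)
    (ξ : CriticVec m) (s : S) :
    ‖mlmcMean M (X.π θ) p.Tmax (drift M X g θ ξ) s‖ ^ 2 ≤
    4 * G₁ ^ 2 * (epsApp M X p.cγ Θ + ‖ξ - criticOpt M X p.cγ g θ‖ ^ 2) +
      128 / 9 * (mixTime M X Θ / 2 ^ Nat.log 2 p.Tmax) ^ 2 * (driftConst G₁ μ lam *
        ((mixTime M X Θ : ℝ) ^ 2 + ‖ξ - criticOpt M X p.cγ g θ‖ ^ 2)) := by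
  have h1 := h.norm_mlmcMean_drift_sub_le g ξ s
  have h2 := h.norm_meanDrift_sq_le g ξ
  set y := ‖ξ - criticOpt M X p.cγ g θ‖
  set a := mlmcMean M (X.π θ) p.Tmax (drift M X g θ ξ) s
  set r := (mixTime M X Θ : ℝ) / 2 ^ Nat.log 2 p.Tmax
  have h3 := driftBound_sq_le (M := M) (X := X) (Θ := Θ) (G₁ := G₁) (μ := μ) (lam := lam) y
  set B := driftBound M X Θ G₁ μ lam y
  have h4 : ‖a‖ ≤ ‖meanDrift M X g θ ξ‖ + ‖a - meanDrift M X g θ ξ‖ := by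
    have := norm_add_le (meanDrift M X g θ ξ) (a - meanDrift M X g θ ξ)
    rwa [add_sub_cancel] at this
  have h5 := pow_le_pow_left₀ (norm_nonneg _) h4 2
  have h6 := pow_le_pow_left₀ (norm_nonneg _) h1 2
  have h7 : (8 / 3 * r * B) ^ 2 ≤ 64 / 9 * r ^ 2 * (driftConst G₁ μ lam *
      ((mixTime M X Θ : ℝ) ^ 2 + y ^ 2)) := by
    calc _ = 64 / 9 * r ^ 2 * B ^ 2 := by ring
      _ ≤ _ := by gcongr
  nlinarith [sq_nonneg (‖meanDrift M X g θ ξ‖ - ‖a - meanDrift M X g θ ξ‖)]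

theorem ex_norm_mlmc_drift_sq_le (h : ActorSetup M X Θ G₁ G₂ μ lam p T θ) (g : Signal)
    (ξ : CriticVec m) (s : S) :
    ex (truncBatch M (X.π θ) p.Tmax s)
      (fun b => ‖mlmc p.Tmax (drift M X g θ ξ) b‖ ^ 2) ≤
      32 * Nat.log 2 p.Tmax * mixTime M X Θ * (driftConst G₁ μ lam *
        ((mixTime M X Θ : ℝ) ^ 2 + ‖ξ - criticOpt M X p.cγ g θ‖ ^ 2)) := by
  have hJ := h.level_pos
  have hτ := h.one_le_mixTime
  set y := ‖ξ - criticOpt M X p.cγ g θ‖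
  have hB0 := h.driftBound_nonneg (norm_nonneg (ξ - criticOpt M X p.cγ g θ))
  have hB := driftBound_sq_le (M := M) (X := X) (Θ := Θ) (G₁ := G₁) (μ := μ) (lam := lam) y
  have hd := h.norm_drift_le_driftBound g ξ
  set B := driftBound M X Θ G₁ μ lam y
  have h1 : ex (truncBatch M (X.π θ) p.Tmax s)
      (fun b => ‖mlmc p.Tmax (drift M X g θ ξ) b - meanDrift M X g θ ξ‖ ^ 2) ≤ _ :=
    h.ergodic.ex_norm_mlmc_sub_sq_le (X.π θ) (f := drift M X g θ ξ) (c := 0) hB0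
    (fun z => by rw [sub_zero]; exact hd z) h.two_le s
  have h2 : ‖meanDrift M X g θ ξ‖ ^ 2 ≤ B ^ 2 :=
    pow_le_pow_left₀ (norm_nonneg _) (M.norm_statExp_le (X.π θ) hd) 2
  have h3 := ex_norm_add_sq_le (truncBatch M (X.π θ) p.Tmax s) (a := 1) one_pos
    (fun _ => meanDrift M X g θ ξ)
    (fun b => mlmc p.Tmax (drift M X g θ ξ) b - meanDrift M X g θ ξ)
  simp only [add_sub_cancel, ex_const] at h3
  refine h3.trans ?_
  have h4 : (Nat.log 2 p.Tmax : ℝ) * (44 / 3 * M.mixTimeOf (X.π θ) * B ^ 2) ≤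
      44 / 3 * (Nat.log 2 p.Tmax * mixTime M X Θ * B ^ 2) := by
    calc _ ≤ (Nat.log 2 p.Tmax : ℝ) * (44 / 3 * mixTime M X Θ * B ^ 2) := by
          gcongr
          exact_mod_cast h.le_mixTime
      _ = _ := by ring
  have h5 : B ^ 2 ≤ Nat.log 2 p.Tmax * mixTime M X Θ * B ^ 2 := by
    calc _ = 1 * 1 * B ^ 2 := by ring
      _ ≤ _ := by gcongr
  have h6 : 32 * (Nat.log 2 p.Tmax * mixTime M X Θ * B ^ 2) ≤
      32 * Nat.log 2 p.Tmax * mixTime M X Θ * (driftConst G₁ μ lam *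
        ((mixTime M X Θ : ℝ) ^ 2 + y ^ 2)) := by
    rw [← mul_assoc, ← mul_assoc]
    gcongr
  have h7 := h1.trans h4
  have h8 : (1 + 1 : ℝ) * ‖meanDrift M X g θ ξ‖ ^ 2 + (1 + 1⁻¹) *
      ex (truncBatch M (X.π θ) p.Tmax s)
        (fun b => ‖mlmc p.Tmax (drift M X g θ ξ) b - meanDrift M X g θ ξ‖ ^ 2) ≤
      32 * (Nat.log 2 p.Tmax * mixTime M X Θ * B ^ 2) := by
    norm_num
    linarith [sq_nonneg B]
  exact h8.trans h6

/-- The step size is chosen so that exp(−γμH) = T⁻². -/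
theorem one_sub_pow_le (h : ActorSetup M X Θ G₁ G₂ μ lam p T θ) :
    (1 - p.γω * μ) ^ p.H ≤ 1 / (T : ℝ) ^ 2 := by
  have hT : (0 : ℝ) < T := by exact_mod_cast h.T_pos
  have h1 : 1 - p.γω * μ ≤ Real.exp (-(p.γω * μ)) := by
    have := Real.add_one_le_exp (-(p.γω * μ)); linarith
  refine (pow_le_pow_left₀ (by linarith [h.γω_mul_μ_le]) h1 _).trans_eq ?_
  rw [← Real.exp_nat_mul, mul_neg, mul_comm, h.γω_mul_H, Real.exp_neg, one_div]
  congr 1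
  rw [mul_comm, Real.exp_mul, Real.exp_log hT]
  norm_cast

theorem one_sub_half_pow_le (h : ActorSetup M X Θ G₁ G₂ μ lam p T θ) :
    (1 - p.γω * μ / 2) ^ p.H ≤ 1 / (T : ℝ) := by
  have hT : (0 : ℝ) < T := by exact_mod_cast h.T_pos
  have h1 : 1 - p.γω * μ / 2 ≤ Real.exp (-(p.γω * μ / 2)) := by
    have := Real.add_one_le_exp (-(p.γω * μ / 2)); linarith
  refine (pow_le_pow_left₀ (by linarith [h.γω_mul_μ_le]) h1 _).trans_eq ?_
  have h2 : (p.H : ℝ) * -(p.γω * μ / 2) = -Real.log T := by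
    have := h.γω_mul_H; linarith
  rw [← Real.exp_nat_mul, h2, Real.exp_neg, Real.exp_log hT, one_div]

theorem mul_geom_sum_le {a : ℝ} (ha1 : a ≤ 1) (n : ℕ) :
    a * ∑ i ∈ Finset.range n, (1 - a) ^ i ≤ 1 := by
  have h := mul_neg_geom_sum (1 - a) n
  rw [sub_sub_cancel] at h
  rw [h]
  have := pow_nonneg (sub_nonneg.2 ha1) n
  linarith

/-- Second moment of the actor iterates, long trajectories. -/
theorem ex_norm_actorOut_sq_le_long (h : ActorSetup M X Θ G₁ G₂ μ lam p T θ)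
    (hlong : 8 * G₁ ^ 2 * mixTime M X Θ ≤ μ * 2 ^ Nat.log 2 p.Tmax) (g : Signal)
    (ξ : CriticVec m) (n : ℕ) (s : S) :
    ex (truncLoop M (X.π θ) p.Tmax n s)
      (fun l => ‖actorOut M X p g θ ξ l - npgDir M X g θ‖ ^ 2) ≤
      (1 - p.γω * μ) ^ n * ‖npgDir M X g θ‖ ^ 2 + (1 / μ) * (24 / μ *
        (4 * G₁ ^ 2 * (epsApp M X p.cγ Θ + ‖ξ - criticOpt M X p.cγ g θ‖ ^ 2) +
        128 / 9 * (mixTime M X Θ / 2 ^ Nat.log 2 p.Tmax) ^ 2 * (driftConst G₁ μ lam *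
        ((mixTime M X Θ : ℝ) ^ 2 + ‖ξ - criticOpt M X p.cγ g θ‖ ^ 2))) +
        15 * p.γω * (32 * Nat.log 2 p.Tmax * mixTime M X Θ * (driftConst G₁ μ lam *
        ((mixTime M X Θ : ℝ) ^ 2 + ‖ξ - criticOpt M X p.cγ g θ‖ ^ 2)))) := by
  have hstep := fun s ω => h.ex_norm_actorStep_sq_le h.two_le h.γω_nonneg h.γω_small hlong g ξ ω s
    (h.norm_mlmcMean_drift_sq_le_add g ξ s) (h.ex_norm_mlmc_drift_sq_le g ξ s)
  have h1 := ex_norm_actorOut_sq_le p g ξ (sub_nonneg.2 h.γω_mul_μ_le) hstep n s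
  refine h1.trans (add_le_add le_rfl ?_)
  have hμ := h.μ_pos
  have hγ := h.γω_nonneg
  have hε := epsApp_nonneg M X p.cγ Θ
  have hdc := driftConst_nonneg (G₁ := G₁) (μ := μ) (lam := lam)
  have h2 := mul_geom_sum_le h.γω_mul_μ_le n
  set D := 24 / μ *
        (4 * G₁ ^ 2 * (epsApp M X p.cγ Θ + ‖ξ - criticOpt M X p.cγ g θ‖ ^ 2) +
        128 / 9 * (mixTime M X Θ / 2 ^ Nat.log 2 p.Tmax) ^ 2 * (driftConst G₁ μ lam *
        ((mixTime M X Θ : ℝ) ^ 2 + ‖ξ - criticOpt M X p.cγ g θ‖ ^ 2))) +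
        15 * p.γω * (32 * Nat.log 2 p.Tmax * mixTime M X Θ * (driftConst G₁ μ lam *
        ((mixTime M X Θ : ℝ) ^ 2 + ‖ξ - criticOpt M X p.cγ g θ‖ ^ 2))) with hD
  have hD0 : 0 ≤ D := by rw [hD]; positivity
  calc _ = (1 / μ) * D * (p.γω * μ * ∑ i ∈ Finset.range n, (1 - p.γω * μ) ^ i) := by
        field_simp
    _ ≤ (1 / μ) * D * 1 := by gcongr
    _ = _ := mul_one _

/-- Second moment of the actor iterates, short trajectories. -/
theorem ex_norm_actorOut_sq_le_short (h : ActorSetup M X Θ G₁ G₂ μ lam p T θ)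
    (hshort : μ * 2 ^ Nat.log 2 p.Tmax ≤ 8 * G₁ ^ 2 * mixTime M X Θ) (g : Signal)
    (ξ : CriticVec m) (s : S) :
    ex (truncLoop M (X.π θ) p.Tmax p.H s)
      (fun l => ‖actorOut M X p g θ ξ l - npgDir M X g θ‖ ^ 2) ≤
      9 * ‖npgDir M X g θ‖ ^ 2 + 18 * Real.log T / μ * ((1 + Real.log T) / μ +
        64 * p.γω * Nat.log 2 p.Tmax * mixTime M X Θ) * (driftConst G₁ μ lam *
        ((mixTime M X Θ : ℝ) ^ 2 + ‖ξ - criticOpt M X p.cγ g θ‖ ^ 2)) := by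
  have hμ := h.μ_pos
  have hγ := h.γω_nonneg
  have hlT := h.log_T_nonneg
  -- This rate keeps γκH = 2 log T/(1 + log T) ≤ 2, so the growth over the loop is at most e² ≤ 9,
  -- while κ⁻¹ costs only a logarithm.
  set κ := μ / (1 + Real.log T) with hκ
  have hκ0 : 0 < κ := by positivity
  have hstep := fun s ω => h.ex_norm_actorStep_sq_le_of_short h.two_le h.γω_nonneg h.γω_small
    hshort g ξ ω s hκ0 (h.norm_mlmcMean_drift_sq_le g ξ s) (h.ex_norm_mlmc_drift_sq_le g ξ s)
  have h1 := ex_norm_actorOut_sq_le p g ξ (by positivity) hstep p.H s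
  refine h1.trans ?_
  set Y := driftConst G₁ μ lam *
        ((mixTime M X Θ : ℝ) ^ 2 + ‖ξ - criticOpt M X p.cγ g θ‖ ^ 2) with hY
  have hY0 : 0 ≤ Y := mul_nonneg driftConst_nonneg (by positivity)
  have hρ : (1 + p.γω * κ) ^ p.H ≤ 9 := by
    have e1 : 1 + p.γω * κ ≤ Real.exp (p.γω * κ) := by
      have := Real.add_one_le_exp (p.γω * κ); linarith
    refine (pow_le_pow_left₀ (by positivity) e1 _).trans ?_
    rw [← Real.exp_nat_mul]
    have e2 : (p.H : ℝ) * (p.γω * κ) ≤ 2 := by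
      have e3 : (p.H : ℝ) * (p.γω * κ) = (p.γω * μ * p.H) / (1 + Real.log T) := by
        rw [hκ]; ring
      rw [e3, h.γω_mul_H, div_le_iff₀ (by positivity)]
      linarith
    refine (Real.exp_le_exp.2 e2).trans ?_
    have e4 : Real.exp 2 = Real.exp 1 ^ 2 := by rw [← Real.exp_nat_mul]; norm_num
    rw [e4]
    have e5 := Real.exp_one_lt_d9
    have e6 := Real.exp_pos 1
    nlinarith
  have hsum : ∑ i ∈ Finset.range p.H, (1 + p.γω * κ) ^ i ≤ p.H * 9 := by
    refine (Finset.sum_le_card_nsmul _ _ 9 fun i hi => ?_).trans_eq (by simp)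
    refine (pow_le_pow_right₀ ?_ (Finset.mem_range.1 hi).le).trans hρ
    have : 0 ≤ p.γω * κ := by positivity
    linarith
  refine add_le_add (mul_le_mul_of_nonneg_right hρ (sq_nonneg _)) ?_
  calc _ ≤ p.γω * (κ⁻¹ * Y + 2 * p.γω * (32 * Nat.log 2 p.Tmax * mixTime M X Θ * Y)) *
        (p.H * 9) := by gcongr
    _ = 9 / μ * (p.γω * μ * p.H) * (κ⁻¹ + 64 * p.γω * Nat.log 2 p.Tmax * mixTime M X Θ) * Y := by
        field_simp; ring
    _ = _ := by rw [h.γω_mul_H, hκ, inv_div]; ring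

/-- Bias of the actor iterates relative to the noiseless recursion, long trajectories. -/
theorem norm_ex_actorOut_sub_sq_le (h : ActorSetup M X Θ G₁ G₂ μ lam p T θ)
    (g : Signal) (ξ : CriticVec m) (s : S) {R : ℝ}
    (hR : ∀ n, ex (truncLoop M (X.π θ) p.Tmax n s)
      (fun l => ‖actorOut M X p g θ ξ l - npgDir M X g θ‖ ^ 2) ≤ R) :
    ‖ex (truncLoop M (X.π θ) p.Tmax p.H s)
        (fun l => actorOut M X p g θ ξ l - npgDir M X g θ) -
      detIter M X θ p.γω (-npgDir M X g θ) (meanDrift M X g θ ξ) p.H‖ ^ 2 ≤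
      (mixTime M X Θ / 2 ^ Nat.log 2 p.Tmax) ^ 2 * (128 / 9 * G₁ ^ 4 / μ ^ 2 * R +
        512 / 9 / μ ^ 2 * (driftConst G₁ μ lam *
          ((mixTime M X Θ : ℝ) ^ 2 + ‖ξ - criticOpt M X p.cγ g θ‖ ^ 2))) := by
  have hμ := h.μ_pos
  have hγ := h.γω_nonneg
  have hG := h.G₁_pos
  have hR0 : 0 ≤ R := (ex_nonneg _ fun _ => sq_nonneg _).trans (hR 0)
  set y := ‖ξ - criticOpt M X p.cγ g θ‖
  have hB0 := h.driftBound_nonneg (norm_nonneg (ξ - criticOpt M X p.cγ g θ))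
  have hB := driftBound_sq_le (M := M) (X := X) (Θ := Θ) (G₁ := G₁) (μ := μ) (lam := lam) y
  set r := (mixTime M X Θ : ℝ) / 2 ^ Nat.log 2 p.Tmax with hr
  have hr0 : 0 ≤ r := by positivity
  -- The bias of the linear part is proportional to the error of the iterate, so a first moment
  -- bound is needed; √R supplies it by Jensen's inequality.
  have h1 := h.norm_ex_actorOut_sub_detIter_le h.two_le hγ h.γω_mul_sq_le h.γω_mul_μ_le g ξ s
    (e₁ := 4 / 3 * G₁ ^ 2 * r) (e₂ := 8 / 3 * r * driftBound M X Θ G₁ μ lam y) (R := √R)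
    (N := p.H) (by positivity)
    (fun x s => (h.norm_mlmcMean_fisher_sub_le p.Tmax x s).trans_eq (by rw [hr]; ring))
    (fun s => h.norm_mlmcMean_drift_sub_le g ξ s)
    (fun n _ => Real.le_sqrt_of_sq_le ((ex_sq_le _ _).trans (hR n)))
  set B := driftBound M X Θ G₁ μ lam y
  have h2 := mul_geom_sum_le (a := p.γω * μ / 2) (by linarith [h.γω_mul_μ_le]) p.H
  have h3 : p.γω * (4 / 3 * G₁ ^ 2 * r * √R + 8 / 3 * r * B) *
      ∑ i ∈ Finset.range p.H, (1 - p.γω * μ / 2) ^ i ≤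
      2 / μ * (4 / 3 * G₁ ^ 2 * r * √R + 8 / 3 * r * B) := by
    calc _ = 2 / μ * (4 / 3 * G₁ ^ 2 * r * √R + 8 / 3 * r * B) *
          (p.γω * μ / 2 * ∑ i ∈ Finset.range p.H, (1 - p.γω * μ / 2) ^ i) := by field_simp
      _ ≤ 2 / μ * (4 / 3 * G₁ ^ 2 * r * √R + 8 / 3 * r * B) * 1 := by gcongr
      _ = _ := mul_one _
  have h4 := pow_le_pow_left₀ (norm_nonneg _) (h1.trans h3) 2
  refine h4.trans ?_
  have h5 : √R ^ 2 = R := Real.sq_sqrt hR0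
  calc (2 / μ * (4 / 3 * G₁ ^ 2 * r * √R + 8 / 3 * r * B)) ^ 2
      = 4 / μ ^ 2 * r ^ 2 * (4 / 3 * G₁ ^ 2 * √R + 8 / 3 * B) ^ 2 := by ring
    _ ≤ 4 / μ ^ 2 * r ^ 2 * (2 * (4 / 3 * G₁ ^ 2 * √R) ^ 2 + 2 * (8 / 3 * B) ^ 2) := by
        gcongr
        nlinarith [sq_nonneg (4 / 3 * G₁ ^ 2 * √R - 8 / 3 * B)]
    _ = r ^ 2 * (128 / 9 * G₁ ^ 4 / μ ^ 2 * √R ^ 2 + 512 / 9 / μ ^ 2 * B ^ 2) := by ring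
    _ ≤ _ := by rw [h5]; gcongr

/-- The contraction 1 − γμ/2 reduces y by a factor 1/T over the loop, and the constant forcing
accumulates to at most (2/μ)‖v‖. -/
theorem norm_detIter_sq_le (h : ActorSetup M X Θ G₁ G₂ μ lam p T θ) (y v : Param d) :
    ‖detIter M X θ p.γω y v p.H‖ ^ 2 ≤ 2 * ‖y‖ ^ 2 / T ^ 2 + 8 / μ ^ 2 * ‖v‖ ^ 2 := by
  have hμ := h.μ_pos
  have hγ := h.γω_nonneg
  have hT : (0 : ℝ) < T := by exact_mod_cast h.T_pos
  have h1 := norm_le_geom (v := detIter M X θ p.γω y v) (N := p.H)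
    (by linarith [h.γω_mul_μ_le])
    (fun n _ => h.norm_detIter_succ_le hγ h.γω_mul_sq_le h.γω_mul_μ_le y v n) le_rfl
  have h2 := mul_geom_sum_le (a := p.γω * μ / 2) (by linarith [h.γω_mul_μ_le]) p.H
  have h3 : p.γω * ‖v‖ * ∑ i ∈ Finset.range p.H, (1 - p.γω * μ / 2) ^ i ≤ 2 / μ * ‖v‖ := by
    calc _ = 2 / μ * ‖v‖ *
          (p.γω * μ / 2 * ∑ i ∈ Finset.range p.H, (1 - p.γω * μ / 2) ^ i) := by field_simp
      _ ≤ 2 / μ * ‖v‖ * 1 := by gcongr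
      _ = _ := mul_one _
  have h4 : ‖detIter M X θ p.γω y v p.H‖ ≤ 1 / T * ‖y‖ + 2 / μ * ‖v‖ :=
    h1.trans (add_le_add (mul_le_mul_of_nonneg_right h.one_sub_half_pow_le (norm_nonneg _)) h3)
  refine (pow_le_pow_left₀ (norm_nonneg _) h4 2).trans ?_
  calc (1 / T * ‖y‖ + 2 / μ * ‖v‖) ^ 2 ≤ 2 * (1 / T * ‖y‖) ^ 2 + 2 * (2 / μ * ‖v‖) ^ 2 := by
        nlinarith [sq_nonneg (1 / T * ‖y‖ - 2 / μ * ‖v‖)]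
    _ = _ := by ring

end ActorSetup

end Actor

/-! ### Assembling the bounds for long and short trajectories -/

section Bounds

variable {S A : Type*} [Fintype S] [DecidableEq S] [Fintype A] {d m : ℕ}
  {M : CMDP S A} {X : Approximator S A d m} {Θ : Set (Param d)} {G₁ G₂ μ lam : ℝ}
  {p : AlgParams d} {T : ℕ} {θ : Param d}

/-- The constant of the second moment bound for long trajectories. -/
def longConst (G₁ μ lam : ℝ) : ℝ :=
  25 * G₁ ^ 2 / μ ^ 2 + 96 * G₁ ^ 2 / μ ^ 2 +
    1024 / 3 / μ ^ 2 * driftConst G₁ μ lam *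
      (2 * (μ / (8 * G₁ ^ 2)) + (μ / (8 * G₁ ^ 2)) ^ 2) +
    1440 / μ ^ 2 * driftConst G₁ μ lam + 30 / G₁ ^ 4 * driftConst G₁ μ lam

/-- The constant of the second moment bound for short trajectories. -/
def shortConst (G₁ μ lam : ℝ) : ℝ :=
  225 * G₁ ^ 2 / μ ^ 2 + 18 / μ * (1 / μ + 4 * μ / G₁ ^ 4) * driftConst G₁ μ lam

/-- The constant of the bias bound for long trajectories. -/
def biasConst (G₁ μ lam : ℝ) : ℝ :=
  128 / 9 * G₁ ^ 4 / μ ^ 2 * longConst G₁ μ lam + 512 / 9 / μ ^ 2 * driftConst G₁ μ lam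

/-- The logarithmic factor `(1 + log T)(1 + log T_max)`. -/
def logFactor (T Tmax : ℕ) : ℝ := (1 + Real.log T) * (1 + Real.log Tmax)

theorem longConst_nonneg (hμ : 0 < μ) : 0 ≤ longConst G₁ μ lam := by
  have := ActorSetup.driftConst_nonneg (G₁ := G₁) (μ := μ) (lam := lam)
  rw [longConst]; positivity

theorem shortConst_nonneg (hμ : 0 < μ) : 0 ≤ shortConst G₁ μ lam := by
  have := ActorSetup.driftConst_nonneg (G₁ := G₁) (μ := μ) (lam := lam)
  rw [shortConst]; positivity

theorem biasConst_nonneg (hμ : 0 < μ) : 0 ≤ biasConst G₁ μ lam := by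
  have := longConst_nonneg (G₁ := G₁) (lam := lam) hμ
  have := ActorSetup.driftConst_nonneg (G₁ := G₁) (μ := μ) (lam := lam)
  rw [biasConst]; positivity

namespace ActorSetup

theorem norm_npgDir_sq_le (h : ActorSetup M X Θ G₁ G₂ μ lam p T θ) (g : Signal) :
    ‖npgDir M X g θ‖ ^ 2 ≤ 25 * G₁ ^ 2 / μ ^ 2 * (mixTime M X Θ : ℝ) ^ 2 := by
  refine (pow_le_pow_left₀ (norm_nonneg _) (h.norm_npgDir_le g) 2).trans_eq ?_
  ring

theorem log_Tmax_nonneg (h : ActorSetup M X Θ G₁ G₂ μ lam p T θ) : 0 ≤ Real.log p.Tmax := by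
  have := h.level_pos
  have := h.level_le
  linarith

theorem one_add_log_le_logFactor (h : ActorSetup M X Θ G₁ G₂ μ lam p T θ) :
    1 + Real.log T ≤ logFactor T p.Tmax := by
  have h1 := h.log_T_nonneg
  have h2 := h.log_Tmax_nonneg
  rw [logFactor]
  nlinarith

theorem one_le_logFactor (h : ActorSetup M X Θ G₁ G₂ μ lam p T θ) : 1 ≤ logFactor T p.Tmax := by
  have h1 := h.log_T_nonneg
  have h2 := h.one_add_log_le_logFactor
  linarith

theorem ratio_le (h : ActorSetup M X Θ G₁ G₂ μ lam p T θ)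
    (hlong : 8 * G₁ ^ 2 * mixTime M X Θ ≤ μ * 2 ^ Nat.log 2 p.Tmax) :
    (mixTime M X Θ : ℝ) / 2 ^ Nat.log 2 p.Tmax ≤ μ / (8 * G₁ ^ 2) := by
  have := h.G₁_pos
  rw [div_le_div_iff₀ (by positivity) (by positivity)]
  linarith

theorem inv_pow_level_le (h : ActorSetup M X Θ G₁ G₂ μ lam p T θ) :
    ((2 : ℝ) ^ Nat.log 2 p.Tmax)⁻¹ ≤ 2 / p.Tmax := by
  have h1 := le_two_mul_two_pow_log p.Tmax
  have h2 : (0 : ℝ) < p.Tmax := by exact_mod_cast (by have := h.two_le; omega : 0 < p.Tmax)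
  rw [inv_eq_one_div, div_le_div_iff₀ (by positivity) h2]
  linarith

theorem γω_level_mixTime_le (h : ActorSetup M X Θ G₁ G₂ μ lam p T θ) :
    p.γω * Nat.log 2 p.Tmax * mixTime M X Θ ≤ μ / (16 * G₁ ^ 4) := by
  have := h.G₁_pos
  rw [le_div_iff₀ (by positivity)]
  have := h.γω_small
  linarith

/-- The step size is 2 log T/(μH); this is how τ/H enters the final bound. -/
theorem γω_level_mixTime_le_logFactor (h : ActorSetup M X Θ G₁ G₂ μ lam p T θ) :
    p.γω * Nat.log 2 p.Tmax * mixTime M X Θ ≤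
      3 / μ * logFactor T p.Tmax * (mixTime M X Θ / p.H) := by
  have hμ := h.μ_pos
  have hH : (0 : ℝ) < p.H := by exact_mod_cast h.H_pos
  have h1 := h.log_T_nonneg
  have h2 := h.log_Tmax_nonneg
  have h3 := h.level_le
  have h4 := h.γω_nonneg
  calc _ ≤ p.γω * (3 / 2 * Real.log p.Tmax) * mixTime M X Θ := by gcongr
    _ = 3 / μ * (Real.log T * Real.log p.Tmax) * (mixTime M X Θ / p.H) := by
        rw [h.γω_eq]; field_simp
    _ ≤ _ := by
        gcongr
        rw [logFactor]
        nlinarith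

/-- Two estimates of each small factor are used. Against τ², the ratio r = τ/2^J counts once as a
constant and once as 2τ/T_max, and γJτ counts as a logarithmic multiple of τ/H. Against ‖ξ − ξ^*‖²
both are merely bounded, so that this term keeps a constant coefficient. -/
theorem second_moment_long (h : ActorSetup M X Θ G₁ G₂ μ lam p T θ)
    (hlong : 8 * G₁ ^ 2 * mixTime M X Θ ≤ μ * 2 ^ Nat.log 2 p.Tmax) (g : Signal)
    (ξ : CriticVec m) (s : S) :
    ex (truncLoop M (X.π θ) p.Tmax p.H s)
      (fun l => ‖actorOut M X p g θ ξ l - npgDir M X g θ‖ ^ 2) ≤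
      longConst G₁ μ lam * logFactor T p.Tmax * (epsApp M X p.cγ Θ +
        (1 / (T : ℝ) ^ 2 + mixTime M X Θ / p.H + mixTime M X Θ / p.Tmax) *
          (mixTime M X Θ : ℝ) ^ 2 + ‖ξ - criticOpt M X p.cγ g θ‖ ^ 2) := by
  refine (h.ex_norm_actorOut_sq_le_long hlong g ξ p.H s).trans ?_
  have hμ := h.μ_pos
  have hG := h.G₁_pos
  have hr := h.ratio_le hlong
  have hN := h.inv_pow_level_le
  have hγ1 := h.γω_level_mixTime_le
  have hγ2 := h.γω_level_mixTime_le_logFactor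
  have hw := h.norm_npgDir_sq_le g
  have hΛ := h.one_le_logFactor
  have hε := epsApp_nonneg M X p.cγ Θ
  have hρ := h.one_sub_pow_le
  have hb := driftConst_nonneg (G₁ := G₁) (μ := μ) (lam := lam)
  have hT : (0 : ℝ) < T := by exact_mod_cast h.T_pos
  rw [longConst]
  set b := driftConst G₁ μ lam
  set Λ := logFactor T p.Tmax
  set τ : ℝ := (mixTime M X Θ : ℝ)
  have hτ : 1 ≤ τ := h.one_le_mixTime
  set y := ‖ξ - criticOpt M X p.cγ g θ‖
  set ε := epsApp M X p.cγ Θ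
  set N : ℝ := 2 ^ Nat.log 2 p.Tmax with hNdef
  set r := τ / N with hrdef
  set ρ₀ := μ / (8 * G₁ ^ 2)
  have hr0 : 0 ≤ r := by positivity
  have hρ₀ : 0 ≤ ρ₀ := by positivity
  have e1 : (1 - p.γω * μ) ^ p.H * ‖npgDir M X g θ‖ ^ 2 ≤
      25 * G₁ ^ 2 / μ ^ 2 * (1 / (T : ℝ) ^ 2 * τ ^ 2) := by
    calc _ ≤ 1 / (T : ℝ) ^ 2 * (25 * G₁ ^ 2 / μ ^ 2 * τ ^ 2) := by gcongr
      _ = _ := by ring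
  have hrT : r ≤ 2 * (τ / p.Tmax) := by
    calc r = τ * N⁻¹ := div_eq_mul_inv _ _
      _ ≤ τ * (2 / p.Tmax) := by gcongr
      _ = _ := by ring
  have e2 : r ^ 2 * τ ^ 2 ≤ 2 * ρ₀ * (τ / p.Tmax * τ ^ 2) := by
    calc r ^ 2 * τ ^ 2 = r * r * τ ^ 2 := by ring
      _ ≤ ρ₀ * (2 * (τ / p.Tmax)) * τ ^ 2 := by gcongr
      _ = _ := by ring
  have e3 : r ^ 2 * y ^ 2 ≤ ρ₀ ^ 2 * y ^ 2 := by gcongr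
  have e4 : p.γω * Nat.log 2 p.Tmax * τ * τ ^ 2 ≤ 3 / μ * Λ * (τ / p.H * τ ^ 2) := by
    calc _ ≤ 3 / μ * Λ * (τ / p.H) * τ ^ 2 := by gcongr
      _ = _ := by ring
  have e5 : p.γω * Nat.log 2 p.Tmax * τ * y ^ 2 ≤ μ / (16 * G₁ ^ 4) * y ^ 2 := by gcongr
  set t₁ := 1 / (T : ℝ) ^ 2 * τ ^ 2 with ht₁
  set t₂ := τ / p.H * τ ^ 2 with ht₂
  set t₃ := τ / p.Tmax * τ ^ 2 with ht₃
  have ht₁0 : 0 ≤ t₁ := by positivity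
  have ht₂0 : 0 ≤ t₂ := by positivity
  have ht₃0 : 0 ≤ t₃ := by positivity
  have hy0 : 0 ≤ y ^ 2 := sq_nonneg _
  have hsum : (1 / (T : ℝ) ^ 2 + τ / p.H + τ / p.Tmax) * τ ^ 2 = t₁ + t₂ + t₃ := by
    rw [ht₁, ht₂, ht₃]; ring
  rw [hsum]
  set Z := ε + (t₁ + t₂ + t₃) + y ^ 2 with hZ
  have hZ0 : 0 ≤ Z := by positivity
  have hΛZ : Z ≤ Λ * Z := le_mul_of_one_le_left hZ0 hΛ
  have f1 : 25 * G₁ ^ 2 / μ ^ 2 * t₁ ≤ 25 * G₁ ^ 2 / μ ^ 2 * (Λ * Z) :=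
    mul_le_mul_of_nonneg_left (by linarith) (by positivity)
  have f2 : 96 * G₁ ^ 2 / μ ^ 2 * (ε + y ^ 2) ≤ 96 * G₁ ^ 2 / μ ^ 2 * (Λ * Z) :=
    mul_le_mul_of_nonneg_left (by linarith) (by positivity)
  have f3 : 1024 / 3 / μ ^ 2 * b * (r ^ 2 * τ ^ 2 + r ^ 2 * y ^ 2) ≤
      1024 / 3 / μ ^ 2 * b * ((2 * ρ₀ + ρ₀ ^ 2) * (Λ * Z)) := by
    refine mul_le_mul_of_nonneg_left ?_ (by positivity)
    have i1 : 2 * ρ₀ * t₃ ≤ 2 * ρ₀ * (Λ * Z) :=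
      mul_le_mul_of_nonneg_left (by linarith) (by positivity)
    have i2 : ρ₀ ^ 2 * y ^ 2 ≤ ρ₀ ^ 2 * (Λ * Z) :=
      mul_le_mul_of_nonneg_left (by linarith) (by positivity)
    linarith
  have f4 : 480 / μ * b * (p.γω * Nat.log 2 p.Tmax * τ * τ ^ 2 +
      p.γω * Nat.log 2 p.Tmax * τ * y ^ 2) ≤
      1440 / μ ^ 2 * b * (Λ * Z) + 30 / G₁ ^ 4 * b * (Λ * Z) := by
    have i1 : 3 / μ * Λ * t₂ ≤ 3 / μ * (Λ * Z) := by
      rw [mul_assoc]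
      gcongr
      linarith
    have i2 : μ / (16 * G₁ ^ 4) * y ^ 2 ≤ μ / (16 * G₁ ^ 4) * (Λ * Z) :=
      mul_le_mul_of_nonneg_left (by linarith) (by positivity)
    calc _ ≤ 480 / μ * b * (3 / μ * (Λ * Z) + μ / (16 * G₁ ^ 4) * (Λ * Z)) := by
          exact mul_le_mul_of_nonneg_left (add_le_add (e4.trans i1) (e5.trans i2)) (by positivity)
      _ = _ := by field_simp; ring
  calc _ ≤ 25 * G₁ ^ 2 / μ ^ 2 * t₁ + (96 * G₁ ^ 2 / μ ^ 2 * (ε + y ^ 2) +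
        1024 / 3 / μ ^ 2 * b * (r ^ 2 * τ ^ 2 + r ^ 2 * y ^ 2) +
        480 / μ * b * (p.γω * Nat.log 2 p.Tmax * τ * τ ^ 2 +
          p.γω * Nat.log 2 p.Tmax * τ * y ^ 2)) := by
        refine add_le_add e1 (le_of_eq ?_)
        field_simp
        ring
    _ ≤ 25 * G₁ ^ 2 / μ ^ 2 * (Λ * Z) + (96 * G₁ ^ 2 / μ ^ 2 * (Λ * Z) +
        1024 / 3 / μ ^ 2 * b * ((2 * ρ₀ + ρ₀ ^ 2) * (Λ * Z)) +
        (1440 / μ ^ 2 * b * (Λ * Z) + 30 / G₁ ^ 4 * b * (Λ * Z))) := by linarith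
    _ = _ := by ring

/-- A bound without decay but valid at every step of the loop; it is the R required by the
comparison with the noiseless recursion. -/
theorem second_moment_uniform (h : ActorSetup M X Θ G₁ G₂ μ lam p T θ)
    (hlong : 8 * G₁ ^ 2 * mixTime M X Θ ≤ μ * 2 ^ Nat.log 2 p.Tmax) (g : Signal)
    (ξ : CriticVec m) (n : ℕ) (s : S) :
    ex (truncLoop M (X.π θ) p.Tmax n s)
      (fun l => ‖actorOut M X p g θ ξ l - npgDir M X g θ‖ ^ 2) ≤
      longConst G₁ μ lam * (epsApp M X p.cγ Θ + (mixTime M X Θ : ℝ) ^ 2 +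
        ‖ξ - criticOpt M X p.cγ g θ‖ ^ 2) := by
  refine (h.ex_norm_actorOut_sq_le_long hlong g ξ n s).trans ?_
  have hμ := h.μ_pos
  have hG := h.G₁_pos
  have hr := h.ratio_le hlong
  have hγ1 := h.γω_level_mixTime_le
  have hw := h.norm_npgDir_sq_le g
  have hε := epsApp_nonneg M X p.cγ Θ
  have hb := driftConst_nonneg (G₁ := G₁) (μ := μ) (lam := lam)
  have hρ : (1 - p.γω * μ) ^ n ≤ 1 := by
    refine pow_le_one₀ (by linarith [h.γω_mul_μ_le]) ?_
    have := mul_nonneg h.γω_nonneg hμ.le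
    linarith
  rw [longConst]
  set b := driftConst G₁ μ lam
  set τ : ℝ := (mixTime M X Θ : ℝ)
  set y := ‖ξ - criticOpt M X p.cγ g θ‖
  set ε := epsApp M X p.cγ Θ
  set r := τ / 2 ^ Nat.log 2 p.Tmax with hrdef
  set ρ₀ := μ / (8 * G₁ ^ 2)
  have hr0 : 0 ≤ r := by positivity
  have hρ₀ : 0 ≤ ρ₀ := by positivity
  set Z := ε + τ ^ 2 + y ^ 2 with hZ
  have hτ0 : 0 ≤ τ ^ 2 := sq_nonneg _
  have hy0 : 0 ≤ y ^ 2 := sq_nonneg _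
  have hZ0 : 0 ≤ Z := by positivity
  have e1 : (1 - p.γω * μ) ^ n * ‖npgDir M X g θ‖ ^ 2 ≤ 25 * G₁ ^ 2 / μ ^ 2 * Z := by
    calc _ ≤ 1 * (25 * G₁ ^ 2 / μ ^ 2 * τ ^ 2) := by gcongr
      _ = 25 * G₁ ^ 2 / μ ^ 2 * τ ^ 2 := one_mul _
      _ ≤ _ := mul_le_mul_of_nonneg_left (by linarith) (by positivity)
  have e2 : 96 * G₁ ^ 2 / μ ^ 2 * (ε + y ^ 2) ≤ 96 * G₁ ^ 2 / μ ^ 2 * Z :=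
    mul_le_mul_of_nonneg_left (by linarith) (by positivity)
  have e3 : 1024 / 3 / μ ^ 2 * b * (r ^ 2 * (τ ^ 2 + y ^ 2)) ≤
      1024 / 3 / μ ^ 2 * b * (ρ₀ ^ 2 * Z) := by
    gcongr
    linarith
  have e4 : 480 / μ * b * (p.γω * Nat.log 2 p.Tmax * τ * (τ ^ 2 + y ^ 2)) ≤
      30 / G₁ ^ 4 * b * Z := by
    calc _ ≤ 480 / μ * b * (μ / (16 * G₁ ^ 4) * Z) := by
          gcongr
          linarith
      _ = _ := by field_simp; ring
  have e5 : 0 ≤ 1024 / 3 / μ ^ 2 * b * (2 * ρ₀ * Z) + 1440 / μ ^ 2 * b * Z := by positivity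
  calc _ ≤ 25 * G₁ ^ 2 / μ ^ 2 * Z + (96 * G₁ ^ 2 / μ ^ 2 * (ε + y ^ 2) +
        1024 / 3 / μ ^ 2 * b * (r ^ 2 * (τ ^ 2 + y ^ 2)) +
        480 / μ * b * (p.γω * Nat.log 2 p.Tmax * τ * (τ ^ 2 + y ^ 2))) := by
        refine add_le_add e1 (le_of_eq ?_)
        field_simp
        ring
    _ ≤ 25 * G₁ ^ 2 / μ ^ 2 * Z + (96 * G₁ ^ 2 / μ ^ 2 * Z +
        1024 / 3 / μ ^ 2 * b * (ρ₀ ^ 2 * Z) + 30 / G₁ ^ 4 * b * Z) +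
        (1024 / 3 / μ ^ 2 * b * (2 * ρ₀ * Z) + 1440 / μ ^ 2 * b * Z) := by linarith
    _ = _ := by ring

/-- The two logarithmic factors are the total step length γH = 2 log T/μ and the inverse growth rate
κ⁻¹ = (1 + log T)/μ. -/
theorem second_moment_short (h : ActorSetup M X Θ G₁ G₂ μ lam p T θ)
    (hshort : μ * 2 ^ Nat.log 2 p.Tmax ≤ 8 * G₁ ^ 2 * mixTime M X Θ) (g : Signal)
    (ξ : CriticVec m) (s : S) :
    ex (truncLoop M (X.π θ) p.Tmax p.H s)
      (fun l => ‖actorOut M X p g θ ξ l - npgDir M X g θ‖ ^ 2) ≤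
      shortConst G₁ μ lam * logFactor T p.Tmax ^ 2 * ((mixTime M X Θ : ℝ) ^ 2 +
        ‖ξ - criticOpt M X p.cγ g θ‖ ^ 2) := by
  refine (h.ex_norm_actorOut_sq_le_short hshort g ξ s).trans ?_
  have hμ := h.μ_pos
  have hG := h.G₁_pos
  have hγ1 := h.γω_level_mixTime_le
  have hw := h.norm_npgDir_sq_le g
  have hΛ := h.one_add_log_le_logFactor
  have hlT := h.log_T_nonneg
  have hb := driftConst_nonneg (G₁ := G₁) (μ := μ) (lam := lam)
  rw [shortConst]
  set b := driftConst G₁ μ lam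
  set τ : ℝ := (mixTime M X Θ : ℝ)
  set y := ‖ξ - criticOpt M X p.cγ g θ‖
  set Λ := logFactor T p.Tmax
  set lT := Real.log T
  have hΛ1 : 1 ≤ Λ := by linarith
  have hΛ2 : 1 ≤ Λ ^ 2 := one_le_pow₀ hΛ1
  have e1 : 9 * ‖npgDir M X g θ‖ ^ 2 ≤ 225 * G₁ ^ 2 / μ ^ 2 * (Λ ^ 2 * (τ ^ 2 + y ^ 2)) := by
    calc _ ≤ 9 * (25 * G₁ ^ 2 / μ ^ 2 * τ ^ 2) := by gcongr
      _ = 225 * G₁ ^ 2 / μ ^ 2 * (1 * (τ ^ 2 + 0)) := by ring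
      _ ≤ _ := by gcongr; positivity
  have e2 : 18 * lT / μ * ((1 + lT) / μ + 64 * p.γω * Nat.log 2 p.Tmax * τ) ≤
      18 / μ * (1 / μ + 4 * μ / G₁ ^ 4) * Λ ^ 2 := by
    have i1 : (1 + lT) / μ + 64 * p.γω * Nat.log 2 p.Tmax * τ ≤
        (1 / μ + 4 * μ / G₁ ^ 4) * Λ := by
      have i2 : 64 * p.γω * Nat.log 2 p.Tmax * τ ≤ 4 * μ / G₁ ^ 4 * Λ := by
        calc _ = 64 * (p.γω * Nat.log 2 p.Tmax * τ) := by ring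
          _ ≤ 64 * (μ / (16 * G₁ ^ 4)) := by gcongr
          _ = 4 * μ / G₁ ^ 4 * 1 := by field_simp; ring
          _ ≤ _ := by gcongr
      have i3 : (1 + lT) / μ ≤ 1 / μ * Λ := by
        rw [div_mul_eq_mul_div, one_mul]; gcongr
      linarith
    calc _ ≤ 18 * Λ / μ * ((1 / μ + 4 * μ / G₁ ^ 4) * Λ) := by
          have := h.γω_nonneg
          gcongr
          linarith
      _ = _ := by ring
  calc _ ≤ 225 * G₁ ^ 2 / μ ^ 2 * (Λ ^ 2 * (τ ^ 2 + y ^ 2)) +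
        18 / μ * (1 / μ + 4 * μ / G₁ ^ 4) * Λ ^ 2 * (b * (τ ^ 2 + y ^ 2)) := by
        refine add_le_add e1 ?_
        gcongr
    _ = _ := by ring

/-- This makes short trajectories harmless: τ/T_max is bounded below, so bounded moments are enough.
The factor 16 is 8 times the 2 lost in T_max ≤ 2·2^J. -/
theorem one_le_ratio (h : ActorSetup M X Θ G₁ G₂ μ lam p T θ)
    (hshort : μ * 2 ^ Nat.log 2 p.Tmax ≤ 8 * G₁ ^ 2 * mixTime M X Θ) :
    1 ≤ 16 * G₁ ^ 2 / μ * (mixTime M X Θ / p.Tmax) := by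
  have hμ := h.μ_pos
  have h1 := le_two_mul_two_pow_log p.Tmax
  have h2 : (0 : ℝ) < p.Tmax := by exact_mod_cast (by have := h.two_le; omega : 0 < p.Tmax)
  rw [div_mul_div_comm, le_div_iff₀ (by positivity), one_mul]
  nlinarith

/-- The factor r² is at most a constant, used against ε_app, and at most 2τ²/T_max, used against the
remaining terms. -/
theorem bias_long (h : ActorSetup M X Θ G₁ G₂ μ lam p T θ)
    (hlong : 8 * G₁ ^ 2 * mixTime M X Θ ≤ μ * 2 ^ Nat.log 2 p.Tmax) (g : Signal)
    (ξ : CriticVec m) (s : S) :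
    ‖ex (truncLoop M (X.π θ) p.Tmax p.H s)
        (fun l => actorOut M X p g θ ξ l - npgDir M X g θ) -
      detIter M X θ p.γω (-npgDir M X g θ) (meanDrift M X g θ ξ) p.H‖ ^ 2 ≤
      biasConst G₁ μ lam * (2 + (μ / (8 * G₁ ^ 2)) ^ 2) * (epsApp M X p.cγ Θ +
        (mixTime M X Θ : ℝ) ^ 2 / p.Tmax * (‖ξ - criticOpt M X p.cγ g θ‖ ^ 2 +
          (mixTime M X Θ : ℝ) ^ 2)) := by
  refine (h.norm_ex_actorOut_sub_sq_le g ξ s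
    (fun n => h.second_moment_uniform hlong g ξ n s)).trans ?_
  have hμ := h.μ_pos
  have hG := h.G₁_pos
  have hK := longConst_nonneg (G₁ := G₁) (lam := lam) h.μ_pos
  have hr := h.ratio_le hlong
  have hN := h.inv_pow_level_le
  have hε := epsApp_nonneg M X p.cγ Θ
  have hb := driftConst_nonneg (G₁ := G₁) (μ := μ) (lam := lam)
  have hB := biasConst_nonneg (G₁ := G₁) (lam := lam) h.μ_pos
  set b := driftConst G₁ μ lam
  set τ : ℝ := (mixTime M X Θ : ℝ)
  set y := ‖ξ - criticOpt M X p.cγ g θ‖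
  set ε := epsApp M X p.cγ Θ
  set N : ℝ := 2 ^ Nat.log 2 p.Tmax with hNdef
  set r := τ / N with hrdef
  set ρ₀ := μ / (8 * G₁ ^ 2)
  have hr0 : 0 ≤ r := by positivity
  have hN1 : 1 ≤ N := one_le_pow₀ (by norm_num)
  have e1 : 128 / 9 * G₁ ^ 4 / μ ^ 2 * (longConst G₁ μ lam * (ε + τ ^ 2 + y ^ 2)) +
      512 / 9 / μ ^ 2 * (b * (τ ^ 2 + y ^ 2)) ≤
      biasConst G₁ μ lam * (ε + τ ^ 2 + y ^ 2) := by
    have : 512 / 9 / μ ^ 2 * (b * (τ ^ 2 + y ^ 2)) ≤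
        512 / 9 / μ ^ 2 * (b * (ε + τ ^ 2 + y ^ 2)) := by gcongr; linarith
    rw [biasConst]
    linarith
  have e2 : r ^ 2 ≤ 2 * (τ ^ 2 / p.Tmax) := by
    calc r ^ 2 = τ ^ 2 * (N⁻¹ * N⁻¹) := by rw [hrdef]; ring
      _ ≤ τ ^ 2 * (2 / p.Tmax * 1) := by
          gcongr
          exact inv_le_one_of_one_le₀ hN1
      _ = _ := by ring
  have e3 : r ^ 2 ≤ ρ₀ ^ 2 := by gcongr
  set v := τ ^ 2 / (p.Tmax : ℝ)
  have hv : 0 ≤ v := by positivity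
  calc _ ≤ r ^ 2 * (biasConst G₁ μ lam * (ε + τ ^ 2 + y ^ 2)) := by gcongr
    _ = biasConst G₁ μ lam * (r ^ 2 * ε + r ^ 2 * (y ^ 2 + τ ^ 2)) := by ring
    _ ≤ biasConst G₁ μ lam * (ρ₀ ^ 2 * ε + 2 * v * (y ^ 2 + τ ^ 2)) := by gcongr
    _ ≤ biasConst G₁ μ lam * ((2 + ρ₀ ^ 2) * (ε + v * (y ^ 2 + τ ^ 2))) := by
        gcongr
        have i1 : 0 ≤ ρ₀ ^ 2 * (v * (y ^ 2 + τ ^ 2)) := by positivity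
        linarith
    _ = _ := by ring

end ActorSetup

/-- The law of the samples of one epoch, with truncated levels. -/
def truncEpoch (M : CMDP S A) (π : S → PMF A) (H Tmax : ℕ) (s : S) : PMF (Epoch S A) :=
  (truncLoop M π Tmax H s).bind fun cs =>
    (truncLoop M π Tmax H (cs.foldl endState s)).map fun as => (cs, as)

instance (M : CMDP S A) (π : S → PMF A) (H Tmax : ℕ) (s : S) :
    FinSupp (truncEpoch M π H Tmax s) := by
  rw [truncEpoch]; infer_instance

theorem ex_truncEpoch {E : Type*} [NormedAddCommGroup E] [NormedSpace ℝ E] (M : CMDP S A)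
    (π : S → PMF A) (H Tmax : ℕ) (s : S) (f : Epoch S A → E) :
    ex (truncEpoch M π H Tmax s) f = ex (truncLoop M π Tmax H s) fun cs =>
      ex (truncLoop M π Tmax H (cs.foldl endState s)) fun as => f (cs, as) := by
  simp only [truncEpoch, ex_bind, ex_map]

/-- The constant of the theorem. -/
def mainConst (G₁ μ lam : ℝ) : ℝ :=
  1 + longConst G₁ μ lam + shortConst G₁ μ lam * (1 + 16 * G₁ ^ 2 / μ) +
    (2 * (biasConst G₁ μ lam * (2 + (μ / (8 * G₁ ^ 2)) ^ 2)) + 100 * G₁ ^ 2 / μ ^ 2 +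
      32 * G₁ ^ 2 / μ ^ 2)

namespace ActorSetup

/-- Second moment of the error of the natural gradient estimate of an epoch. -/
theorem epoch_second_moment (h : ActorSetup M X Θ G₁ G₂ μ lam p T θ) (g : Signal) (s : S) :
    ex (truncEpoch M (X.π θ) p.H p.Tmax s)
      (fun e => ‖actorOut M X p g θ (criticOut M X p g e.1) e.2 - npgDir M X g θ‖ ^ 2) ≤
      mainConst G₁ μ lam * logFactor T p.Tmax ^ 2 * (epsApp M X p.cγ Θ +
        (1 / (T : ℝ) ^ 2 + mixTime M X Θ / p.H + mixTime M X Θ / p.Tmax) *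
          (mixTime M X Θ : ℝ) ^ 2 +
        ex (truncEpoch M (X.π θ) p.H p.Tmax s)
          (fun e => ‖criticOut M X p g e.1 - criticOpt M X p.cγ g θ‖ ^ 2)) := by
  have hΛ := h.one_le_logFactor
  have hμ := h.μ_pos
  have hK1 := longConst_nonneg (G₁ := G₁) (lam := lam) h.μ_pos
  have hK2 := shortConst_nonneg (G₁ := G₁) (lam := lam) h.μ_pos
  have hK3 := biasConst_nonneg (G₁ := G₁) (lam := lam) h.μ_pos
  have hε := epsApp_nonneg M X p.cγ Θ
  set c := ((1 / (T : ℝ) ^ 2 + mixTime M X Θ / p.H + mixTime M X Θ / p.Tmax) *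
          (mixTime M X Θ : ℝ) ^ 2) with hc
  have hc0 : 0 ≤ c := by positivity
  have hpt : ∀ (ξ : CriticVec m) (s : S), ex (truncLoop M (X.π θ) p.Tmax p.H s)
      (fun l => ‖actorOut M X p g θ ξ l - npgDir M X g θ‖ ^ 2) ≤
      mainConst G₁ μ lam * logFactor T p.Tmax ^ 2 * (epsApp M X p.cγ Θ + c +
        ‖ξ - criticOpt M X p.cγ g θ‖ ^ 2) := by
    intro ξ s
    have hy := sq_nonneg ‖ξ - criticOpt M X p.cγ g θ‖
    rcases le_total (8 * G₁ ^ 2 * (mixTime M X Θ : ℝ)) (μ * 2 ^ Nat.log 2 p.Tmax) with hl | hl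
    · refine (h.second_moment_long hl g ξ s).trans ?_
      have hlm : longConst G₁ μ lam ≤ mainConst G₁ μ lam := by
        rw [mainConst]
        have : 0 ≤ shortConst G₁ μ lam * (1 + 16 * G₁ ^ 2 / μ) +
          (2 * (biasConst G₁ μ lam * (2 + (μ / (8 * G₁ ^ 2)) ^ 2)) + 100 * G₁ ^ 2 / μ ^ 2 +
          32 * G₁ ^ 2 / μ ^ 2) := by positivity
        linarith
      have hm := hK1.trans hlm
      have hΛ2 : logFactor T p.Tmax ≤ logFactor T p.Tmax ^ 2 := le_self_pow₀ hΛ two_ne_zero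
      gcongr
    -- Here τ² is already dominated by the summand (τ/T_max) τ² of the right-hand side.
    · refine (h.second_moment_short hl g ξ s).trans ?_
      have h1 := h.one_le_ratio hl
      have h2 : (mixTime M X Θ : ℝ) ^ 2 ≤ 16 * G₁ ^ 2 / μ * c := by
        calc (mixTime M X Θ : ℝ) ^ 2 = 1 * (mixTime M X Θ : ℝ) ^ 2 := (one_mul _).symm
          _ ≤ 16 * G₁ ^ 2 / μ * (mixTime M X Θ / p.Tmax) * (mixTime M X Θ : ℝ) ^ 2 := by gcongr
          _ = 16 * G₁ ^ 2 / μ * ((0 + mixTime M X Θ / p.Tmax) * (mixTime M X Θ : ℝ) ^ 2) := by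
              ring
          _ ≤ _ := by rw [hc]; gcongr; positivity
      set y2 := ‖ξ - criticOpt M X p.cγ g θ‖ ^ 2
      have h3 : (mixTime M X Θ : ℝ) ^ 2 + y2 ≤
          (1 + 16 * G₁ ^ 2 / μ) * (epsApp M X p.cγ Θ + c + y2) := by
        have i1 : 0 ≤ 16 * G₁ ^ 2 / μ * (epsApp M X p.cγ Θ + y2) := by positivity
        linarith
      have h4 : shortConst G₁ μ lam * (1 + 16 * G₁ ^ 2 / μ) ≤ mainConst G₁ μ lam := by
        rw [mainConst]
        have : 0 ≤ (2 * (biasConst G₁ μ lam * (2 + (μ / (8 * G₁ ^ 2)) ^ 2)) +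
          100 * G₁ ^ 2 / μ ^ 2 + 32 * G₁ ^ 2 / μ ^ 2) := by positivity
        linarith
      calc _ ≤ shortConst G₁ μ lam * logFactor T p.Tmax ^ 2 *
            ((1 + 16 * G₁ ^ 2 / μ) * (epsApp M X p.cγ Θ + c + y2)) := by gcongr
        _ = (shortConst G₁ μ lam * (1 + 16 * G₁ ^ 2 / μ)) * logFactor T p.Tmax ^ 2 *
            (epsApp M X p.cγ Θ + c + y2) := by ring
        _ ≤ _ := by gcongr
  rw [ex_truncEpoch, ex_truncEpoch]
  simp only [ex_const]
  refine (ex_mono _ fun cs _ => hpt _ _).trans_eq ?_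
  rw [ex_mul, ex_add, ex_const]

/-- Bias of the natural gradient estimate of an epoch. -/
theorem epoch_bias (h : ActorSetup M X Θ G₁ G₂ μ lam p T θ) (g : Signal) (s : S) :
    ‖ex (truncEpoch M (X.π θ) p.H p.Tmax s)
      (fun e => actorOut M X p g θ (criticOut M X p g e.1) e.2) - npgDir M X g θ‖ ^ 2 ≤
      mainConst G₁ μ lam * logFactor T p.Tmax ^ 2 * (epsApp M X p.cγ Θ +
        (mixTime M X Θ : ℝ) ^ 2 / T ^ 2 + (mixTime M X Θ : ℝ) ^ 2 / p.Tmax *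
        (ex (truncEpoch M (X.π θ) p.H p.Tmax s)
          (fun e => ‖criticOut M X p g e.1 - criticOpt M X p.cγ g θ‖ ^ 2) +
          (mixTime M X Θ : ℝ) ^ 2) +
        ‖ex (truncEpoch M (X.π θ) p.H p.Tmax s) (fun e => criticOut M X p g e.1) -
          criticOpt M X p.cγ g θ‖ ^ 2) := by
  have hΛ := h.one_le_logFactor
  have hΛ2 : 1 ≤ logFactor T p.Tmax ^ 2 := one_le_pow₀ hΛ
  have hμ := h.μ_pos
  have hK1 := longConst_nonneg (G₁ := G₁) (lam := lam) h.μ_pos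
  have hK2 := shortConst_nonneg (G₁ := G₁) (lam := lam) h.μ_pos
  have hK3 := biasConst_nonneg (G₁ := G₁) (lam := lam) h.μ_pos
  have hε := epsApp_nonneg M X p.cγ Θ
  have hτ := h.one_le_mixTime
  have hsub : ex (truncEpoch M (X.π θ) p.H p.Tmax s)
      (fun e => actorOut M X p g θ (criticOut M X p g e.1) e.2) - npgDir M X g θ =
      ex (truncEpoch M (X.π θ) p.H p.Tmax s)
      (fun e => actorOut M X p g θ (criticOut M X p g e.1) e.2 - npgDir M X g θ) := by
    rw [ex_sub, ex_const]
  rw [hsub]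
  set Y := ex (truncEpoch M (X.π θ) p.H p.Tmax s)
          (fun e => ‖criticOut M X p g e.1 - criticOpt M X p.cγ g θ‖ ^ 2) with hY
  have hY0 : 0 ≤ Y := ex_nonneg _ fun _ => sq_nonneg _
  have hYc : Y = ex (truncLoop M (X.π θ) p.Tmax p.H s)
      (fun cs => ‖criticOut M X p g cs - criticOpt M X p.cγ g θ‖ ^ 2) := by
    rw [hY, ex_truncEpoch]
    simp only [ex_const]
  set ξb := ex (truncEpoch M (X.π θ) p.H p.Tmax s) (fun e => criticOut M X p g e.1) with hξb
  have hξc : ξb = ex (truncLoop M (X.π θ) p.Tmax p.H s) (criticOut M X p g) := by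
    rw [hξb, ex_truncEpoch]
    simp only [ex_const]
  set y2 := ‖ξb - criticOpt M X p.cγ g θ‖ ^ 2
  have hy2 : 0 ≤ y2 := sq_nonneg _
  set ε := epsApp M X p.cγ Θ
  set v := (mixTime M X Θ : ℝ) ^ 2 / p.Tmax with hv
  have hv0 : 0 ≤ v := by positivity
  set t := (mixTime M X Θ : ℝ) ^ 2 / (T : ℝ) ^ 2 with ht
  have ht0 : 0 ≤ t := by positivity
  have hYτ : 0 ≤ v * (Y + (mixTime M X Θ : ℝ) ^ 2) := by positivity
  set Z := ε + t + v * (Y + (mixTime M X Θ : ℝ) ^ 2) + y2 with hZ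
  have hZ0 : 0 ≤ Z := by positivity
  rcases le_total (8 * G₁ ^ 2 * (mixTime M X Θ : ℝ)) (μ * 2 ^ Nat.log 2 p.Tmax) with hl | hl
  · set q := truncLoop M (X.π θ) p.Tmax p.H s
    set z := fun cs => ex (truncLoop M (X.π θ) p.Tmax p.H (cs.foldl endState s))
      (fun l => actorOut M X p g θ (criticOut M X p g cs) l - npgDir M X g θ) with hz
    set w := fun cs => detIter M X θ p.γω (-npgDir M X g θ)
      (meanDrift M X g θ (criticOut M X p g cs)) p.H with hw
    have e0 : ex (truncEpoch M (X.π θ) p.H p.Tmax s)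
        (fun e => actorOut M X p g θ (criticOut M X p g e.1) e.2 - npgDir M X g θ) =
        ex q (fun cs => z cs - w cs) + ex q w := by
      rw [ex_truncEpoch, ex_sub, sub_add_cancel]
    -- Noiseless iterates are affine in the drift, and the drift is affine in ξ; hence averaging
    -- over the critic loop evaluates the recursion at the mean of ξ.
    have e1 : ex q w = detIter M X θ p.γω (-npgDir M X g θ) (meanDrift M X g θ ξb) p.H := by
      obtain ⟨a, B, hB⟩ := h.exists_meanDrift_affine g
      rw [hw, ex_detIter]
      congr 1
      simp only [hB, ex_sub, ex_const]
      congr 1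
      rw [hξc]
      exact (map_ex q B.toLinearMap _).symm
    have e2 : ‖ex q (fun cs => z cs - w cs)‖ ^ 2 ≤
        biasConst G₁ μ lam * (2 + (μ / (8 * G₁ ^ 2)) ^ 2) *
          (ε + v * (Y + (mixTime M X Θ : ℝ) ^ 2)) := by
      refine (norm_ex_sq_le q _).trans ((ex_mono _ fun cs _ =>
        h.bias_long hl g (criticOut M X p g cs) (cs.foldl endState s)).trans_eq ?_)
      rw [ex_mul, ex_add, ex_mul, ex_add, ex_const, ex_const, hYc]
    have e3 : ‖ex q w‖ ^ 2 ≤ 50 * G₁ ^ 2 / μ ^ 2 * t + 16 * G₁ ^ 2 / μ ^ 2 * (ε + y2) := by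
      rw [e1]
      refine (h.norm_detIter_sq_le _ _).trans ?_
      rw [norm_neg]
      have i1 := h.norm_npgDir_sq_le g
      have i2 := h.norm_meanDrift_sq_le g ξb
      calc _ ≤ 2 * (25 * G₁ ^ 2 / μ ^ 2 * (mixTime M X Θ : ℝ) ^ 2) / (T : ℝ) ^ 2 +
            8 / μ ^ 2 * (2 * G₁ ^ 2 * (ε + y2)) := by gcongr
        _ = _ := by rw [ht]; ring
    rw [e0]
    have e4 : ‖ex q (fun cs => z cs - w cs) + ex q w‖ ^ 2 ≤
        2 * ‖ex q (fun cs => z cs - w cs)‖ ^ 2 + 2 * ‖ex q w‖ ^ 2 := by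
      have := pow_le_pow_left₀ (norm_nonneg _) (norm_add_le (ex q (fun cs => z cs - w cs)) (ex q w)) 2
      nlinarith [sq_nonneg (‖ex q (fun cs => z cs - w cs)‖ - ‖ex q w‖)]
    set K := biasConst G₁ μ lam * (2 + (μ / (8 * G₁ ^ 2)) ^ 2) with hK
    have hK0 : 0 ≤ K := by positivity
    have e5 : K * (ε + v * (Y + (mixTime M X Θ : ℝ) ^ 2)) ≤ K * Z :=
      mul_le_mul_of_nonneg_left (by linarith) hK0
    have e6 : 50 * G₁ ^ 2 / μ ^ 2 * t ≤ 50 * G₁ ^ 2 / μ ^ 2 * Z :=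
      mul_le_mul_of_nonneg_left (by linarith) (by positivity)
    have e7 : 16 * G₁ ^ 2 / μ ^ 2 * (ε + y2) ≤ 16 * G₁ ^ 2 / μ ^ 2 * Z :=
      mul_le_mul_of_nonneg_left (by linarith) (by positivity)
    have e8 : 2 * K + 100 * G₁ ^ 2 / μ ^ 2 + 32 * G₁ ^ 2 / μ ^ 2 ≤ mainConst G₁ μ lam := by
      rw [mainConst]
      have : 0 ≤ shortConst G₁ μ lam * (1 + 16 * G₁ ^ 2 / μ) := by positivity
      linarith
    have e9 : 0 ≤ 2 * K + 100 * G₁ ^ 2 / μ ^ 2 + 32 * G₁ ^ 2 / μ ^ 2 := by positivity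
    have hm := e9.trans e8
    calc _ ≤ 2 * (K * Z) + 2 * (50 * G₁ ^ 2 / μ ^ 2 * Z + 16 * G₁ ^ 2 / μ ^ 2 * Z) := by linarith
      _ = (2 * K + 100 * G₁ ^ 2 / μ ^ 2 + 32 * G₁ ^ 2 / μ ^ 2) * 1 * Z := by ring
      _ ≤ _ := by gcongr
  -- For short trajectories the squared bias is simply bounded by the second moment, because
  -- (τ²/T_max)(E‖ξ − ξ^*‖² + τ²) already dominates it up to constants and logarithms.
  · have h1 := h.one_le_ratio hl
    have h2 : 1 ≤ 16 * G₁ ^ 2 / μ * v := by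
      refine h1.trans ?_
      rw [hv]
      gcongr
      exact le_self_pow₀ hτ two_ne_zero
    refine (norm_ex_sq_le _ _).trans ?_
    rw [ex_truncEpoch]
    refine (ex_mono _ fun cs _ => h.second_moment_short hl g _ _).trans ?_
    rw [ex_mul, ex_add, ex_const, ← hYc]
    have h3 : (mixTime M X Θ : ℝ) ^ 2 + Y ≤ (1 + 16 * G₁ ^ 2 / μ) * Z := by
      calc (mixTime M X Θ : ℝ) ^ 2 + Y = 1 * (Y + (mixTime M X Θ : ℝ) ^ 2) := by ring
        _ ≤ 16 * G₁ ^ 2 / μ * v * (Y + (mixTime M X Θ : ℝ) ^ 2) := by gcongr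
        _ = 16 * G₁ ^ 2 / μ * (v * (Y + (mixTime M X Θ : ℝ) ^ 2)) := by ring
        _ ≤ 16 * G₁ ^ 2 / μ * Z := mul_le_mul_of_nonneg_left (by linarith) (by positivity)
        _ ≤ _ := by linarith
    have h4 : shortConst G₁ μ lam * (1 + 16 * G₁ ^ 2 / μ) ≤ mainConst G₁ μ lam := by
      rw [mainConst]
      have : 0 ≤ (2 * (biasConst G₁ μ lam * (2 + (μ / (8 * G₁ ^ 2)) ^ 2)) +
        100 * G₁ ^ 2 / μ ^ 2 + 32 * G₁ ^ 2 / μ ^ 2) := by positivity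
      linarith
    calc _ ≤ shortConst G₁ μ lam * logFactor T p.Tmax ^ 2 * ((1 + 16 * G₁ ^ 2 / μ) * Z) := by
          gcongr
      _ = (shortConst G₁ μ lam * (1 + 16 * G₁ ^ 2 / μ)) * logFactor T p.Tmax ^ 2 * Z := by ring
      _ ≤ _ := by gcongr

end ActorSetup

end Bounds

/-! ### Reduction to finitely many levels -/

section Truncation

variable {S A : Type*}

/-- Replace all levels beyond `log₂ T_max` by one and the same. -/
def truncate (Tmax : ℕ) (b : Batch S A) : Batch S A := (min b.1 (Nat.log 2 Tmax + 1), b.2)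

/-- Above log₂ T_max the correction is absent, so the estimate no longer depends on the level. -/
theorem mlmc_truncate {E : Type*} [AddCommGroup E] [Module ℝ E] {Tmax : ℕ} (hT : Tmax ≠ 0)
    (f : S × A × S → E) (b : Batch S A) : mlmc Tmax f (truncate Tmax b) = mlmc Tmax f b := by
  simp only [mlmc, truncate, two_pow_le_iff hT]
  rcases le_or_gt b.1 (Nat.log 2 Tmax) with h | h
  · rw [min_eq_left (by omega)]
  · rw [if_neg (by omega), if_neg (by omega)]

theorem trajLength_min {Tmax : ℕ} (hT : Tmax ≠ 0) (q : ℕ) :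
    trajLength Tmax (min q (Nat.log 2 Tmax + 1)) = trajLength Tmax q := by
  rcases le_or_gt q (Nat.log 2 Tmax) with h | h
  · rw [min_eq_left (by omega)]
  · rw [trajLength_of_lt hT h, trajLength_of_lt hT (by omega)]

theorem foldl_endState_truncate (Tmax : ℕ) (s : S) (l : List (Batch S A)) :
    (l.map (truncate Tmax)).foldl endState s = l.foldl endState s := by
  rw [List.foldl_map]
  rfl

theorem map_batchLaw (M : CMDP S A) (π : S → PMF A) {Tmax : ℕ} (hT : Tmax ≠ 0) (s : S) :
    (batchLaw M π Tmax s).map (truncate Tmax) = truncBatch M π Tmax s := by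
  simp only [batchLaw, truncBatch, truncLevel, PMF.map_bind, PMF.bind_map, PMF.map_comp]
  congr 1
  funext q
  simp only [Function.comp_apply, trajLength_min hT]
  rfl

theorem map_loopLaw (M : CMDP S A) (π : S → PMF A) {Tmax : ℕ} (hT : Tmax ≠ 0) (n : ℕ) (s : S) :
    (loopLaw M π Tmax n s).map (List.map (truncate Tmax)) = truncLoop M π Tmax n s := by
  induction n generalizing s with
  | zero => rw [loopLaw, truncLoop, PMF.pure_map, List.map_nil]
  | succ n ih =>
    simp only [loopLaw, truncLoop, ← map_batchLaw M π hT, PMF.map_bind, PMF.bind_map, PMF.map_comp,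
      ← ih]
    rfl

/-- Truncation of all levels of an epoch. -/
def truncateEpoch (Tmax : ℕ) (e : Epoch S A) : Epoch S A :=
  (e.1.map (truncate Tmax), e.2.map (truncate Tmax))

theorem map_epochLaw (M : CMDP S A) (π : S → PMF A) (H : ℕ) {Tmax : ℕ} (hT : Tmax ≠ 0) (s : S) :
    (epochLaw M π H Tmax s).map (truncateEpoch Tmax) = truncEpoch M π H Tmax s := by
  simp only [epochLaw, truncEpoch, ← map_loopLaw M π hT, PMF.map_bind, PMF.bind_map, PMF.map_comp]
  congr 1
  funext cs
  simp only [Function.comp_apply, foldl_endState_truncate]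
  rfl

variable {d m : ℕ}

theorem criticOut_truncate (M : CMDP S A) (X : Approximator S A d m) {p : AlgParams d}
    (hT : p.Tmax ≠ 0) (g : Signal) (l : List (Batch S A)) :
    criticOut M X p g (l.map (truncate p.Tmax)) = criticOut M X p g l := by
  simp only [criticOut, List.foldl_map, mlmc_truncate hT]

theorem actorOut_truncate (M : CMDP S A) (X : Approximator S A d m) {p : AlgParams d}
    (hT : p.Tmax ≠ 0) (g : Signal) (θ : Param d) (ξ : CriticVec m) (l : List (Batch S A)) :
    actorOut M X p g θ ξ (l.map (truncate p.Tmax)) = actorOut M X p g θ ξ l := by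
  simp only [actorOut, List.foldl_map, mlmc_truncate hT]

end Truncation

/-! ### Conditional law of an epoch given its past -/

section Conditioning

theorem bind_congr_support {α β : Type*} (p : PMF α) {f g : α → PMF β}
    (h : ∀ a ∈ p.support, f a = g a) : p.bind f = p.bind g := by
  ext b
  simp only [PMF.bind_apply]
  refine tsum_congr fun a => ?_
  by_cases ha : p a = 0
  · rw [ha, zero_mul, zero_mul]
  · rw [h a ((p.mem_support_iff a).2 ha)]

variable {S A : Type*} {d m : ℕ}

theorem length_of_mem_runLaw (M : CMDP S A) (X : Approximator S A d m) (p : AlgParams d)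
    {K : ℕ} {x : History S A} (hx : x ∈ (runLaw M X p K).support) : x.epochs.length = K := by
  induction K generalizing x with
  | zero =>
    rw [runLaw, PMF.mem_support_map_iff] at hx
    obtain ⟨s, -, rfl⟩ := hx
    rfl
  | succ K ih =>
    rw [runLaw, PMF.mem_support_bind_iff] at hx
    obtain ⟨y, hy, hx⟩ := hx
    rw [PMF.mem_support_map_iff] at hx
    obtain ⟨e, -, rfl⟩ := hx
    simp [ih hy]

/-- The joint law of the history before epoch `k` and of the samples of epoch `k`. -/
theorem map_runLaw (M : CMDP S A) (X : Approximator S A d m) (p : AlgParams d) {K k : ℕ}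
    (hk : k < K) :
    (runLaw M X p K).map (fun x => (x.upTo k, x.epoch k)) =
      (runLaw M X p k).bind fun x =>
        (epochLaw M (X.π (x.state M X p).θ) p.H p.Tmax (x.state M X p).s).map fun e => (x, e) := by
  induction K with
  | zero => omega
  | succ K ih =>
    rcases Nat.lt_succ_iff_lt_or_eq.1 hk with h | rfl
    -- Appending a later epoch changes neither the first k epochs nor epoch k, so its samples
    -- integrate out.
    · rw [← ih h, runLaw, PMF.map_bind, ← PMF.bind_pure_comp]
      refine bind_congr_support _ fun x hx => ?_
      have hl := length_of_mem_runLaw M X p hx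
      rw [PMF.map_comp]
      refine Eq.trans ?_ (PMF.map_const (epochLaw M (X.π (x.state M X p).θ) p.H p.Tmax
        (x.state M X p).s) _)
      congr 1
      funext e
      simp only [Function.comp_apply, Function.const_apply, History.upTo, History.epoch]
      rw [List.take_append_of_le_length (by omega), List.getD_append _ _ _ _ (by omega)]
    -- Here epoch k is the one just appended, and the earlier history has exactly k epochs, so
    -- cutting at k returns it.
    · rw [runLaw, PMF.map_bind]
      refine bind_congr_support _ fun x hx => ?_
      have hl := length_of_mem_runLaw M X p hx
      rw [PMF.map_comp]
      congr 1
      funext e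
      simp only [Function.comp_apply, History.upTo, History.epoch]
      rw [List.take_append_of_le_length (by omega), List.take_of_length_le (by omega),
        List.getD_append_right _ _ _ _ (by omega), hl]
      simp

section Disintegration

variable {α β γ : Type*} [MeasurableSpace α] [DiscreteMeasurableSpace α]
  [MeasurableSpace γ] [DiscreteMeasurableSpace γ]
  {p : PMF α} {f : α → β} {e : α → γ} {r : PMF β} {q : β → PMF γ}

/-- The event is the preimage of {h} × t under the joint map, and in the mixture only the component
b = h charges that product. -/
theorem toMeasure_inter_of_map_eq
    (hj : p.map (fun x => (f x, e x)) = r.bind fun b => (q b).map fun c => (b, c))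
    (h : β) (t : Set γ) :
    p.toMeasure ({x | f x = h} ∩ e ⁻¹' t) = r h * (q h).toMeasure t := by
  classical
  have h1 : {x | f x = h} ∩ e ⁻¹' t = (fun x => (f x, e x)) ⁻¹' ({h} ×ˢ t) := by
    ext x
    simp
  rw [PMF.toMeasure_apply_eq_toOuterMeasure_apply _ (MeasurableSet.of_discrete),
    PMF.toMeasure_apply_eq_toOuterMeasure_apply _ (MeasurableSet.of_discrete), h1,
    ← PMF.toOuterMeasure_map_apply, hj, PMF.toOuterMeasure_bind_apply, tsum_eq_single h]
  · rw [PMF.toOuterMeasure_map_apply]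
    congr 2
    ext c
    simp
  · intro b hb
    rw [PMF.toOuterMeasure_map_apply]
    have : (fun c => (b, c)) ⁻¹' ({h} ×ˢ t) = (∅ : Set γ) := by
      ext c
      simp [hb]
    rw [this, measure_empty, mul_zero]

/-- Disintegration of a discrete joint law. -/
theorem map_cond_of_map_eq
    (hj : p.map (fun x => (f x, e x)) = r.bind fun b => (q b).map fun c => (b, c))
    {h : β} (hh : p.toMeasure {x | f x = h} ≠ 0) :
    (cond p.toMeasure {x | f x = h}).map e = (q h).toMeasure := by
  have h1 : p.toMeasure {x | f x = h} = r h := by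
    have := toMeasure_inter_of_map_eq hj h Set.univ
    simpa using this
  ext t ht
  rw [Measure.map_apply (Measurable.of_discrete) ht, cond_apply (MeasurableSet.of_discrete),
    toMeasure_inter_of_map_eq hj, h1, ← mul_assoc, ENNReal.inv_mul_cancel (h1 ▸ hh)
      (r.apply_ne_top h), one_mul]

variable {E : Type*} [NormedAddCommGroup E] [NormedSpace ℝ E] [CompleteSpace E]
  [SecondCountableTopology E]

/-- On a finite support every function is almost surely bounded. -/
theorem memLp_toMeasure (q : PMF γ) [FinSupp q] (Φ : γ → E) : MemLp Φ 2 q.toMeasure := by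
  borelize E
  obtain ⟨t, ht⟩ := FinSupp.exists_finset q
  refine MemLp.of_bound (Measurable.of_discrete).aestronglyMeasurable (∑ c ∈ t, ‖Φ c‖) ?_
  have h1 : q.toMeasure (q.support)ᶜ = 0 :=
    (q.toMeasure_apply_eq_zero_iff MeasurableSet.of_discrete).2 disjoint_compl_right
  have h2 : ∀ᵐ c ∂q.toMeasure, c ∈ q.support := h1
  filter_upwards [h2] with c hc
  exact Finset.single_le_sum (f := fun c => ‖Φ c‖) (fun _ _ => norm_nonneg _) ((ht c).2 hc)

theorem integral_toMeasure (q : PMF γ) [FinSupp q] (Φ : γ → E) :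
    ∫ c, Φ c ∂q.toMeasure = ex q Φ :=
  q.integral_eq_tsum Φ ((memLp_toMeasure q Φ).integrable (by norm_num))

theorem ae_cond_eq {h : β} {G : α → E} {Φ : γ → E} (hG : ∀ x, f x = h → G x = Φ (e x)) :
    G =ᵐ[cond p.toMeasure {x | f x = h}] Φ ∘ e :=
  (ae_cond_mem MeasurableSet.of_discrete).mono fun x hx => hG x hx

theorem memLp_cond
    (hj : p.map (fun x => (f x, e x)) = r.bind fun b => (q b).map fun c => (b, c))
    {h : β} (hh : p.toMeasure {x | f x = h} ≠ 0) [FinSupp (q h)] {G : α → E} {Φ : γ → E}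
    (hG : ∀ x, f x = h → G x = Φ (e x)) :
    MemLp G 2 (cond p.toMeasure {x | f x = h}) := by
  rw [memLp_congr_ae (ae_cond_eq hG)]
  have h1 := memLp_toMeasure (q h) Φ
  rw [← map_cond_of_map_eq hj hh] at h1
  exact h1.comp_of_map (Measurable.of_discrete).aemeasurable

theorem integral_cond
    (hj : p.map (fun x => (f x, e x)) = r.bind fun b => (q b).map fun c => (b, c))
    {h : β} (hh : p.toMeasure {x | f x = h} ≠ 0) [FinSupp (q h)] {G : α → E} {Φ : γ → E}
    (hG : ∀ x, f x = h → G x = Φ (e x)) :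
    ∫ x, G x ∂(cond p.toMeasure {x | f x = h}) = ex (q h) Φ := by
  have h1 := (memLp_toMeasure (q h) Φ).1
  rw [integral_congr_ae (ae_cond_eq hG), ← integral_toMeasure (q h) Φ,
    ← map_cond_of_map_eq hj hh, integral_map (Measurable.of_discrete).aemeasurable]
  · rfl
  · rwa [map_cond_of_map_eq hj hh]

end Disintegration

theorem map_runLaw_truncate (M : CMDP S A) (X : Approximator S A d m) {p : AlgParams d}
    (hT : p.Tmax ≠ 0) {K k : ℕ} (hk : k < K) :
    (runLaw M X p K).map (fun x => (x.upTo k, truncateEpoch p.Tmax (x.epoch k))) =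
      (runLaw M X p k).bind fun x =>
        (truncEpoch M (X.π (x.state M X p).θ) p.H p.Tmax (x.state M X p).s).map
          fun e => (x, e) := by
  have h := congrArg (PMF.map (Prod.map id (truncateEpoch p.Tmax))) (map_runLaw M X p hk)
  rw [PMF.map_comp, PMF.map_bind] at h
  refine h.trans ?_
  congr 1
  funext x
  rw [← map_epochLaw M _ _ hT, PMF.map_comp, PMF.map_comp]
  rfl

variable [Fintype S] [DecidableEq S] [Fintype A]

instance : DiscreteMeasurableSpace (History S A) := ⟨fun _ => trivial⟩

theorem memLp_condLaw {E : Type*} [NormedAddCommGroup E] [NormedSpace ℝ E] [CompleteSpace E]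
    [SecondCountableTopology E] (M : CMDP S A) (X : Approximator S A d m) {p : AlgParams d}
    (hT : p.Tmax ≠ 0) {K k : ℕ} (hk : k < K) {h : History S A}
    (hh : (runLaw M X p K).toMeasure {x | x.upTo k = h} ≠ 0) {G : History S A → E}
    {Φ : Epoch S A → E} (hG : ∀ x, x.upTo k = h → G x = Φ (truncateEpoch p.Tmax (x.epoch k))) :
    MemLp G 2 (condLaw M X p K k h) := by
  -- The discrete σ-algebra makes every function of the samples measurable.
  let _ : MeasurableSpace (Epoch S A) := ⊤
  have : DiscreteMeasurableSpace (Epoch S A) := ⟨fun _ => trivial⟩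
  exact memLp_cond (q := fun x : History S A =>
    truncEpoch M (X.π (x.state M X p).θ) p.H p.Tmax (x.state M X p).s)
    (map_runLaw_truncate M X hT hk) hh hG

/-- Conditional expectations of functions of the samples of epoch `k`. -/
theorem integral_condLaw {E : Type*} [NormedAddCommGroup E] [NormedSpace ℝ E] [CompleteSpace E]
    [SecondCountableTopology E] (M : CMDP S A) (X : Approximator S A d m) {p : AlgParams d}
    (hT : p.Tmax ≠ 0) {K k : ℕ} (hk : k < K) {h : History S A}
    (hh : (runLaw M X p K).toMeasure {x | x.upTo k = h} ≠ 0) {G : History S A → E}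
    {Φ : Epoch S A → E} (hG : ∀ x, x.upTo k = h → G x = Φ (truncateEpoch p.Tmax (x.epoch k))) :
    ∫ x, G x ∂condLaw M X p K k h =
      ex (truncEpoch M (X.π (h.state M X p).θ) p.H p.Tmax (h.state M X p).s) Φ := by
  let _ : MeasurableSpace (Epoch S A) := ⊤
  have : DiscreteMeasurableSpace (Epoch S A) := ⟨fun _ => trivial⟩
  exact integral_cond (q := fun x : History S A =>
    truncEpoch M (X.π (x.state M X p).θ) p.H p.Tmax (x.state M X p).s)
    (map_runLaw_truncate M X hT hk) hh hG

theorem upTo_eq_of_ne_zero (M : CMDP S A) (X : Approximator S A d m) (p : AlgParams d)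
    {K k : ℕ} {h : History S A} (hh : (runLaw M X p K).toMeasure {x | x.upTo k = h} ≠ 0) :
    h.upTo k = h := by
  obtain ⟨x, rfl⟩ := nonempty_of_measure_ne_zero hh
  simp [History.upTo, List.take_take]

end Conditioning

/-! ### Rewriting the run's estimates over truncated samples -/

section Final

variable {S A : Type*} [Fintype S] [DecidableEq S] [Fintype A] {d m : ℕ}
  {M : CMDP S A} {X : Approximator S A d m} {Θ : Set (Param d)} {G₁ G₂ μ lam : ℝ}
  {p : AlgParams d} {θ : Param d}

theorem mainConst_pos (hμ : 0 < μ) : 0 < mainConst G₁ μ lam := by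
  have h1 := longConst_nonneg (G₁ := G₁) (lam := lam) hμ
  have h2 := shortConst_nonneg (G₁ := G₁) (lam := lam) hμ
  have h3 := biasConst_nonneg (G₁ := G₁) (lam := lam) hμ
  rw [mainConst]
  positivity

/-- In positive dimension the Fisher constants satisfy `μ ≤ G₁²`. -/
theorem Regular.μ_le_sq (h : Regular M X Θ G₁ G₂ μ lam θ) (hd : d ≠ 0) : μ ≤ G₁ ^ 2 := by
  have : NeZero d := ⟨hd⟩
  set x : Param d := EuclideanSpace.single 0 1
  have hx : ‖x‖ = 1 := by simp [x]
  have h1 := h.nondeg.le_inner h.mem x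
  have h2 := real_inner_le_norm x (Matrix.toEuclideanLin (fisher M X θ) x)
  have h3 := norm_fisher_le M h.scoreBounds h.mem x
  rw [hx] at h1 h2 h3
  linarith

theorem state_of_upTo_eq {k : ℕ} {h x : History S A} (hx : x.upTo k = h) :
    thetaAt M X p k x = (h.state M X p).θ := by
  rw [thetaAt, hx]

theorem xiAt_eq (hT : p.Tmax ≠ 0) (g : Signal) (k : ℕ) (x : History S A) :
    xiAt M X p g k x = criticOut M X p g (truncateEpoch p.Tmax (x.epoch k)).1 := by
  rw [xiAt, truncateEpoch, criticOut_truncate M X hT]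

theorem omegaAt_eq (hT : p.Tmax ≠ 0) (g : Signal) {k : ℕ} {h x : History S A}
    (hx : x.upTo k = h) :
    omegaAt M X p g k x = actorOut M X p g (h.state M X p).θ
      (criticOut M X p g (truncateEpoch p.Tmax (x.epoch k)).1)
      (truncateEpoch p.Tmax (x.epoch k)).2 := by
  rw [omegaAt, state_of_upTo_eq hx, ← xiAt_eq hT, truncateEpoch, actorOut_truncate M X hT]

end Final

end PDNAC

end

open PDNAC

theorem mainTheorem3 :
    ∃ q : ℕ, ∀ G₁ μ lam : ℝ, 0 < G₁ → 0 < μ → 0 < lam → ∃ C : ℝ, 0 < C ∧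
      ∀ (S A : Type*) [Fintype S] [DecidableEq S] [Fintype A] (d m : ℕ)
        (M : CMDP S A) (X : Approximator S A d m) (Θ : Set (Param d)) (p : AlgParams d)
        (G₂ L : ℝ) (T K : ℕ),
      -- ergodicity
      M.Ergodic →
      -- the critic constant, and a finite critic approximation error
      0 < p.cγ → (∀ g, BddAbove (criticErrorAt M X p.cγ g '' Θ)) →
      CriticPositive M X Θ lam →
      0 < G₂ → ScoreBounds X Θ G₁ G₂ →
      FisherNondegenerate M X Θ μ →
      (∀ g, SmoothOn (objective M X g) Θ L) →
      -- parameters of the algorithm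
      0 < p.δ → 1 ≤ T → 1 ≤ p.H → 2 ≤ p.Tmax →
      p.γω = 2 * Real.log T / (μ * p.H) →
      p.γω ≤ μ / (4 * (6 * G₁ ^ 4 * mixTime M X Θ * Real.log p.Tmax +
        2 * G₁ ^ 2 * (mixTime M X Θ : ℝ) ^ 2 * Real.log p.Tmax)) →
      8 * G₁ ^ 4 * mixTime M X Θ / μ ≤ p.Tmax →
      -- any epoch, any history before it that occurs with positive probability
      ∀ (g : Signal) (k : ℕ), k < K → ∀ h : History S A,
        (runLaw M X p K).toMeasure {x | x.upTo k = h} ≠ 0 →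
        thetaAt M X p k h ∈ Θ →
        MemLp (omegaAt M X p g k) 2 (condLaw M X p K k h) ∧
        MemLp (xiAt M X p g k) 2 (condLaw M X p K k h) ∧
        ‖(∫ x, omegaAt M X p g k x ∂condLaw M X p K k h) - npgDir M X g (thetaAt M X p k h)‖ ^ 2
          ≤ C * ((1 + Real.log T) * (1 + Real.log p.Tmax)) ^ q *
            (epsApp M X p.cγ Θ + (mixTime M X Θ : ℝ) ^ 2 / T ^ 2 +
              (mixTime M X Θ : ℝ) ^ 2 / p.Tmax *
                ((∫ x, ‖xiAt M X p g k x - criticOpt M X p.cγ g (thetaAt M X p k h)‖ ^ 2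
                    ∂condLaw M X p K k h) + (mixTime M X Θ : ℝ) ^ 2) +
              ‖(∫ x, xiAt M X p g k x ∂condLaw M X p K k h) -
                criticOpt M X p.cγ g (thetaAt M X p k h)‖ ^ 2) ∧
        (∫ x, ‖omegaAt M X p g k x - npgDir M X g (thetaAt M X p k h)‖ ^ 2
            ∂condLaw M X p K k h)
          ≤ C * ((1 + Real.log T) * (1 + Real.log p.Tmax)) ^ q *
            (epsApp M X p.cγ Θ +
              (1 / (T : ℝ) ^ 2 + mixTime M X Θ / p.H + mixTime M X Θ / p.Tmax) *
                (mixTime M X Θ : ℝ) ^ 2 +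
              ∫ x, ‖xiAt M X p g k x - criticOpt M X p.cγ g (thetaAt M X p k h)‖ ^ 2
                ∂condLaw M X p K k h) := by
  -- The exponent 2 is dictated by the short trajectories; the long ones need a single logarithmic
  -- factor.
  refine ⟨2, fun G₁ μ lam hG₁ hμ hlam => ⟨mainConst G₁ μ lam, mainConst_pos hμ, ?_⟩⟩
  intro S A _ _ _ d m M X Θ p G₂ L T K hM hcγ hbdd hcr _ hX hF _ _ hT hH hTm hγ hγ' _ g k hk h hh hΘ
  have hT0 : p.Tmax ≠ 0 := by omega
  -- A history of positive probability is itself cut at k, so its own final state gives θ_k.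
  have hθ : thetaAt M X p k h = (h.state M X p).θ := by
    rw [thetaAt, upTo_eq_of_ne_zero M X p hh]
  rw [hθ] at hΘ ⊢
  set θ := (h.state M X p).θ with hθdef
  have hreg : Regular M X Θ G₁ G₂ μ lam θ := ⟨hM, hX, hF, hcr, hΘ, hG₁, hμ, hlam⟩
  refine ⟨memLp_condLaw M X
      (Φ := fun e => actorOut M X p g θ (criticOut M X p g e.1) e.2) hT0 hk hh
      fun x hx => omegaAt_eq hT0 g hx,
    memLp_condLaw M X (Φ := fun e => criticOut M X p g e.1) hT0 hk hh
      fun x _ => xiAt_eq hT0 g k x, ?_⟩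
  rw [integral_condLaw M X
      (Φ := fun e => actorOut M X p g θ (criticOut M X p g e.1) e.2) hT0 hk hh
      fun x hx => omegaAt_eq hT0 g hx,
    integral_condLaw M X (Φ := fun e => criticOut M X p g e.1) hT0 hk hh
      fun x _ => xiAt_eq hT0 g k x,
    integral_condLaw M X (G := fun x => ‖xiAt M X p g k x - criticOpt M X p.cγ g θ‖ ^ 2)
      (Φ := fun e => ‖criticOut M X p g e.1 - criticOpt M X p.cγ g θ‖ ^ 2) hT0 hk hh
      fun x _ => by rw [xiAt_eq hT0 g k x],
    integral_condLaw M X (G := fun x => ‖omegaAt M X p g k x - npgDir M X g θ‖ ^ 2)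
      (Φ := fun e => ‖actorOut M X p g θ (criticOut M X p g e.1) e.2 - npgDir M X g θ‖ ^ 2)
      hT0 hk hh fun x hx => by rw [omegaAt_eq hT0 g hx]]
  -- In dimension zero nondegeneracy is vacuous and μ ≤ G₁² may fail, but all actor errors vanish
  -- and the right-hand sides are nonnegative.
  rcases eq_or_ne d 0 with rfl | hd
  · have hε := epsApp_nonneg M X p.cγ Θ
    have hC := mainConst_pos (G₁ := G₁) (lam := lam) hμ
    have hY : 0 ≤ ex (truncEpoch M (X.π θ) p.H p.Tmax (h.state M X p).s)
        (fun e => ‖criticOut M X p g e.1 - criticOpt M X p.cγ g θ‖ ^ 2) :=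
      ex_nonneg _ fun _ => sq_nonneg _
    have h0 : ∀ x : Param 0, ‖x‖ ^ 2 = 0 := fun x => by
      rw [Subsingleton.elim x 0, norm_zero, sq, zero_mul]
    constructor
    · rw [h0]
      positivity
    · simp only [h0, ex_const]
      positivity
  · have hset : ActorSetup M X Θ G₁ G₂ μ lam p T θ :=
      ⟨hreg, hcγ, hbdd, hT, hH, hTm, hγ, hγ', hreg.μ_le_sq hd⟩
    exact ⟨hset.epoch_bias g _, hset.epoch_second_moment g _⟩
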